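/- **Setting.** Fix a vocabulary and an infinite cardinal $\lambda$. Models are set-sized structures for this vocabulary, $|M|$ is identified with $M$, and $f[M]$ denotes the image structure of $M$ under an injection $f$. All classes, relations and functions on models below are arbitrary classes. "Continuous" means unions at limit stages, and $\delta$ denotes a limit ordinal. *Abstract elementary class (a.e.c.).* $(K,\preceq)$ is a class of models with a partial order $\preceq$ on $K$ contained in the submodel relation $\subseteq$, such that: $K$ and $\preceq$ are closed under isomorphisms; if $\langle M_\alpha:\alpha<\delta\rangle$ is $\preceq$-increasing continuous, then $M_0\preceq\bigcup_\alpha M_\alpha\in K$, and if moreover all $M_\alpha\preceq N$, then $\bigcup_\alpha M_\alpha\preceq N$; if $M_0\subseteq M_1\subseteq M_2$, $M_0\preceq M_2$ and $M_1\preceq M_2$, then $M_0\preceq M_1$; and there is a least cardinal $LST(K,\preceq)=\kappa$ such that for all $N\in K$ and $A\subseteq N$ there is $M$ with $A\subseteq M\preceq N$ and $\|M\|\le\kappa+|A|$. $K_\lambda$ is the class of $M\in K$ of cardinality $\lambda$; $M\prec N$ means $M\preceq N$, $M\ne N$. An embedding $f:M\to N$ is an isomorphism of $M$ onto some $f[M]\preceq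 N$; it is over $A$ if it is the identity on $A$. An amalgamation of $M_1,M_2$ over $M_0$ is $(f_1,f_2,M_3)$ with $M_3\in K_\lambda$ and $f_n:M_n\to M_3$ embeddings over $M_0$. Two amalgamations $(f_1,f_2,M_3)$, $(g_1,g_2,N_3)$ are equivalent if there are $P\in K_\lambda$ and embeddings $f:M_3\to P$, $g:N_3\to P$ with $f\circ f_n=g\circ g_n$ on $M_n$ ($n=1,2$). *Types.* For $M\preceq N$, $a\in N$, the type $tp(a,M,N)$ is the class of $(M,N,a)$ under the transitive closure of the relation: $(M,N_0,a_0)\sim(M,N_1,a_1)$ iff there are $N_2\succeq N_1$ and an embedding $f:N_0\to N_2$ over $M$ with $f(a_0)=a_1$. Types $p_0$ over $M_0$ and $p_1$ over $M_1$ conjugate if $p_n=tp(a_n,M_n,M_n^+)$ for some $a_n,M_n^+$ and there is an isomorphism $f:M_0^+\to M_1^+$ with $f[M_0]=M_1$ and $f(a_0)=a_1$. *Frame.* Let $\mathfrak s=(K,\preceq,S^{bs},\mathrm{nf})$ satisfy the following axioms, where $\mathrm{nf}(M_0,M_1,a,M_3)$ is read "$tp(a,M_1,M_3)$ does not fork over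 $M_0$" (these are the axioms of a semi-good $\lambda$-frame other than local character, which is not assumed here): 1. $(K,\preceq)$ is an a.e.c. with $LST(K,\preceq)\le\lambda$; $K_\lambda$ has joint embedding and amalgamation, both inside $K_\lambda$; no model in $K_\lambda$ is $\preceq$-maximal. 2. For $M\in K_\lambda$, $S^{bs}(M)$ is a set of at most $\lambda^+$ types $tp(a,M,N)$ with $M\prec N\in K_\lambda$, $a\in N\setminus M$. It respects isomorphisms. If $M\prec N$ are in $K_\lambda$, some $a\in N\setminus M$ has $tp(a,M,N)\in S^{bs}(M)$. 3. (a) $\mathrm{nf}(M_0,M_1,a,M_3)$ implies $M_0\preceq M_1\preceq M_3$, $M_0,M_1\in K_\lambda$, $M_3\in K$, $a\in M_3\setminus M_1$ and $tp(a,M_n,M_3)\in S^{bs}(M_n)$ for $n<2$; and $\mathrm{nf}$ is closed under isomorphisms. (b) If $M_0\preceq N_0\preceq N_1\preceq M_1\preceq M_3\preceq P$ and $N_1\cup\{a\}\subseteq N_3\preceq P$, then $\mathrm{nf}(M_0,M_1,a,M_3)$ implies $\mathrm{nf}(N_0,N_1,a,N_3)$. (c) Types over $N$ which do not fork over $M$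 and have the same restriction to $M$ are equal. (d) If $M_0\preceq M_1\preceq M_3$, $a_1\in M_1$, $tp(a_1,M_0,M_3)\in S^{bs}(M_0)$ and $\mathrm{nf}(M_0,M_1,a_2,M_3)$, then there are $M_2,P$ with $a_2\in M_2$, $M_0\preceq M_2\preceq P$, $M_3\preceq P$ and $\mathrm{nf}(M_0,M_2,a_1,P)$. (e) If $M\prec N$ are in $K_\lambda$, each $p\in S^{bs}(M)$ is the restriction to $M$ of a type over $N$ that does not fork over $M$. (f) If $\langle M_\alpha:\alpha\le\delta\rangle$ is an increasing continuous sequence in $K_\lambda$, $M_\delta\preceq N$, $a\in N$ and $\mathrm{nf}(M_0,M_\alpha,a,N)$ for all $\alpha<\delta$, then $\mathrm{nf}(M_0,M_\delta,a,N)$. $\mathfrak s$ *has conjugation* if any two models in $K_\lambda$ are isomorphic and whenever $M_1,M_2\in K_\lambda$ and $\mathrm{nf}(M_1,M_2,a,N)$, the types $tp(a,M_1,N)$ and $tp(a,M_2,N)$ conjugate. $K^{3,bs}$ is the class of $(M,N,a)$ with $M\preceq N$ in $K_\lambda$, $a\in N\setminus M$, $tp(a,M,N)\in S^{bs}(M)$.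 $K^{3,uq}$ (uniqueness triples) is the class of $(M_0,M_1,a)\in K^{3,bs}$ such that for every $M_2\in K_\lambda$ with $M_0\preceq M_2$ there is, up to equivalence, exactly one amalgamation $(f_1,f_2,M_3)$ of $M_1,M_2$ over $M_0$ with $tp(f_1(a),f_2[M_2],M_3)$ not forking over $M_0$. $\mathfrak s$ is *weakly successful* if for every $(M,N,a)\in K^{3,bs}$ there is $(M,N^*,a^*)\in K^{3,uq}$ with $tp(a^*,M,N^*)=tp(a,M,N)$. *The relation NF.* For $N_0,\dots,N_3\in K_\lambda$ with $N_0\preceq N_1\preceq N_3$, $N_0\preceq N_2\preceq N_3$, let $NF^*(N_0,N_1,N_2,N_3)$ hold if there are $\alpha^*<\lambda^+$, increasing continuous sequences $\langle N_{l,i}:i\le\alpha^*\rangle$ ($l=1,2$) in $K_\lambda$, and $\langle d_i:i<\alpha^*\rangle$ with $N_{1,0}=N_0$, $N_{1,\alpha^*}=N_1$, $N_{2,0}=N_2$, $N_{2,\alpha^*}=N_3$, $N_{1,i}\preceq N_{2,i}$ for $i\le\alpha^*$, and, for $i<\alpha^*$, $d_i\in N_{1,i+1}\setminus N_{1,i}$,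 $(N_{1,i},N_{1,i+1},d_i)\in K^{3,uq}$ and $tp(d_i,N_{2,i},N_{2,i+1})$ does not fork over $N_{1,i}$. For $M_0,\dots,M_3\in K_\lambda$, $NF(M_0,M_1,M_2,M_3)$ holds iff $M_0\preceq M_1\preceq M_3$, $M_0\preceq M_2\preceq M_3$ and there are $N_0=M_0$ and $N_l\succeq M_l$ ($l=1,2,3$) with $NF^*(N_0,N_1,N_2,N_3)$. *The axioms.* For a 4-place relation $R$ on $K_\lambda$, say $\bigotimes_R$ holds if (all $M$'s and $N$'s in $K_\lambda$): - (a) disjointness: $R(M_0,M_1,M_2,M_3)$ implies $M_0\preceq M_n\preceq M_3$ for $n=1,2$ and $M_1\cap M_2=M_0$; - (b) monotonicity: if $R(M_0,M_1,M_2,M_3)$, $N_0=M_0$, $N_n\preceq M_n$ and $N_0\preceq N_n\preceq N_3$ for $n=1,2$, and some $P$ satisfies $M_3\preceq P$ and $N_3\preceq P$, then $R(N_0,N_1,N_2,N_3)$; - (c) existence: if $N_0\preceq N_1$, $N_0\preceq N_2$, $N_1\cap N_2=N_0$, then $R(N_0,N_1,N_2,N_3)$ for some $N_3$; - (d) weak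 uniqueness: if $R(N_0,N_1,N_2,N^a)$ and $R(N_0,N_1,N_2,N^b)$, then $N^a,N^b$ embed over $N_1\cup N_2$ into a common model in $K_\lambda$; - (e) symmetry: $R(N_0,N_1,N_2,N_3)\Leftrightarrow R(N_0,N_2,N_1,N_3)$; - (f) long transitivity: if $\langle M_{x,i}:i\le\alpha\rangle$ ($x=a,b$) are increasing continuous sequences in $K_\lambda$, $M_{a,0}\preceq M_{b,0}$, and $R(M_{a,i},M_{a,i+1},M_{b,i},M_{b,i+1})$ for all $i<\alpha$, then $R(M_{a,0},M_{a,\alpha},M_{b,0},M_{b,\alpha})$. $R$ *respects* $\mathfrak s$ if $R(M_0,M_1,M_2,M_3)$ and $tp(a,M_0,M_1)\in S^{bs}(M_0)$ imply that $tp(a,M_2,M_3)$ does not fork over $M_0$. **Theorem 5.13.** Suppose $\mathfrak s$ satisfies the axioms above, is weakly successful and has conjugation. Then $NF$ is closed under isomorphisms, satisfies $\bigotimes_{NF}$ and respects $\mathfrak s$. Moreover, it is the only such relation: if $R$ is a 4-place relation on $K_\lambda$ that is closed under isomorphisms, satisfies $\bigotimes_R$ and respects $\mathfrak s$, then $R=NF$.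 -/

import Mathlib

universe u

open scoped FirstOrder

noncomputable section

/-- A (set-sized) model for the vocabulary `L`: its universe is a set of the cumulative hierarchy
`ZFSet.{u}` (given as a small class of sets), so that inclusions, intersections and unions of
different models are literal ones. -/
structure Model (L : FirstOrder.Language.{u, u}) where
  /-- the universe of the model -/
  carrier : Set ZFSet.{u}
  small : Small.{u} carrier
  /-- the interpretation of the symbols of the vocabulary -/
  str : L.Structure carrier

namespace Model

variable {L : FirstOrder.Language.{u, u}}

instance : CoeSort (Model L) (Type (u + 1)) := ⟨fun M => M.carrier⟩

instance (M : Model L) : L.Structure M := M.str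

/-- `M ⊆ N`: `M` is a submodel (substructure) of `N`. -/
def IsSubmodel (M N : Model L) : Prop :=
  ∃ e : M ↪[L] N, ∀ x : M, ((e x : N) : ZFSet.{u}) = (x : ZFSet.{u})

/-- The restriction of `f` to the universe of `M` is an isomorphism of `M` onto `N`; that is,
`N = f[M]`. Maps between models are given by functions on all sets, of which only the values on the
model in question matter. -/
def IsIso (f : ZFSet.{u} → ZFSet.{u}) (M N : Model L) : Prop :=
  ∃ e : M ≃[L] N, ∀ x : M, ((e x : N) : ZFSet.{u}) = f (x : ZFSet.{u})

/-- `N = ⋃ {M α : α < δ}`. -/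
def IsUnion (M : Ordinal.{u} → Model L) (δ : Ordinal.{u}) (N : Model L) : Prop :=
  N.carrier = (⋃ α ∈ Set.Iio δ, (M α).carrier) ∧ ∀ α < δ, IsSubmodel (M α) N

/-- `M` has cardinality `κ`. -/
def HasCard (M : Model L) (κ : Cardinal.{u}) : Prop :=
  Cardinal.mk M.carrier = Cardinal.lift.{u + 1, u} κ

end Model

/-- A triple `(M, N, a)`, as used in the definition of types. -/
structure Triple (L : FirstOrder.Language.{u, u}) where
  M : Model L
  N : Model L
  a : ZFSet.{u}

/-- A class `K` of models with a binary relation `le` on it (the relation `≼`). -/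
structure ModelClass (L : FirstOrder.Language.{u, u}) where
  K : Model L → Prop
  le : Model L → Model L → Prop

namespace ModelClass

variable {L : FirstOrder.Language.{u, u}} (C : ModelClass L)

/-- `⟨M i : i ∈ I⟩` is `≼`-increasing and continuous, where `I` is an initial segment of the
ordinals. -/
def IncCont (M : Ordinal.{u} → Model L) (I : Set Ordinal.{u}) : Prop :=
  (∀ i ∈ I, ∀ j ∈ I, i ≤ j → C.le (M i) (M j)) ∧
    ∀ i ∈ I, Order.IsSuccLimit i → Model.IsUnion M i (M i)

/-- `κ` satisfies the Löwenheim–Skolem–Tarski property. -/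
def LSTProp (κ : Cardinal.{u}) : Prop :=
  ∀ N, C.K N → ∀ A : Set ZFSet.{u}, A ⊆ N.carrier →
    ∃ M, A ⊆ M.carrier ∧ C.le M N ∧
      Cardinal.mk M.carrier ≤ Cardinal.lift.{u + 1, u} κ + Cardinal.mk A

/-- The Löwenheim–Skolem–Tarski number: the first cardinal with `LSTProp`. -/
def LST : Cardinal.{u} := sInf {κ | C.LSTProp κ}

/-- `(K, ≼)` is an abstract elementary class. -/
structure IsAEC : Prop where
  le_mem : ∀ M N, C.le M N → C.K M ∧ C.K N
  /-- closure under isomorphisms -/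
  iso_mem : ∀ f M N, C.K M → Model.IsIso f M N → C.K N
  iso_le : ∀ f M₀ M₁ N₀ N₁, C.le M₀ M₁ → Model.IsIso f M₁ N₁ → Model.IsIso f M₀ N₀ → C.le N₀ N₁
  /-- `≼` is a partial order included in the inclusion relation (hence antisymmetric) -/
  le_refl : ∀ M, C.K M → C.le M M
  le_trans : ∀ M₀ M₁ M₂, C.le M₀ M₁ → C.le M₁ M₂ → C.le M₀ M₂
  le_sub : ∀ M N, C.le M N → Model.IsSubmodel M N
  /-- closure under unions of chains -/
  union : ∀ (δ : Ordinal.{u}) (M : Ordinal.{u} → Model L), Order.IsSuccLimit δ →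
    C.IncCont M (Set.Iio δ) → ∀ U, Model.IsUnion M δ U → C.K U ∧ C.le (M 0) U
  /-- smoothness -/
  smooth : ∀ (δ : Ordinal.{u}) (M : Ordinal.{u} → Model L) (N : Model L), Order.IsSuccLimit δ →
    C.IncCont M (Set.Iio δ) → (∀ α < δ, C.le (M α) N) → ∀ U, Model.IsUnion M δ U → C.le U N
  /-- coherence -/
  coherence : ∀ M₀ M₁ M₂, Model.IsSubmodel M₀ M₁ → Model.IsSubmodel M₁ M₂ →
    C.le M₀ M₂ → C.le M₁ M₂ → C.le M₀ M₁
  /-- existence of a Löwenheim–Skolem–Tarski number -/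
  lst : ∃ κ, C.LSTProp κ

/-- `M ∈ K_κ`. -/
def KCard (κ : Cardinal.{u}) (M : Model L) : Prop := C.K M ∧ M.HasCard κ

/-- `M ≺ N`. -/
def lt (M N : Model L) : Prop := C.le M N ∧ M ≠ N

/-- `f` is a `≼`-embedding of `M` into `N`: an isomorphism of `M` onto some `f[M] ≼ N`. -/
def IsEmb (f : ZFSet.{u} → ZFSet.{u}) (M N : Model L) : Prop :=
  ∃ M', Model.IsIso f M M' ∧ C.le M' N

/-- `f` is a `≼`-embedding of `M` into `N` which is the identity on `A`. -/
def IsEmbOver (f : ZFSet.{u} → ZFSet.{u}) (M N : Model L) (A : Set ZFSet.{u}) : Prop :=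
  C.IsEmb f M N ∧ ∀ x ∈ A, f x = x

/-- `(M, N, a) ∈ K³`. -/
def K3 (t : Triple L) : Prop := C.le t.M t.N ∧ t.a ∈ t.N.carrier

/-- The relation `E*` on `K³`. -/
def EStar (t s : Triple L) : Prop :=
  C.K3 t ∧ C.K3 s ∧ t.M = s.M ∧
    ∃ N f, C.le s.N N ∧ C.IsEmbOver f t.N N t.M.carrier ∧ f t.a = s.a

/-- The relation `E`: the transitive closure of `E*`. -/
def E : Triple L → Triple L → Prop := Relation.TransGen C.EStar

/-- The type `tp(a, M, N)`: the class of `(M, N, a)` under `E`. -/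
def tp (a : ZFSet.{u}) (M N : Model L) : Set (Triple L) := {t | C.E ⟨M, N, a⟩ t}

/-- The types `p₀` over `M₀` and `p₁` over `M₁` conjugate. -/
def Conjugate (M₀ : Model L) (p₀ : Set (Triple L)) (M₁ : Model L) (p₁ : Set (Triple L)) : Prop :=
  ∃ a₀ N₀ a₁ N₁ f, C.tp a₀ M₀ N₀ = p₀ ∧ C.tp a₁ M₁ N₁ = p₁ ∧
    Model.IsIso f N₀ N₁ ∧ Model.IsIso f M₀ M₁ ∧ f a₀ = a₁

/-- `(f₁, f₂, M₃)` is an amalgamation of `M₁, M₂` over `M₀` in `K_κ`. -/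
def IsAmalgam (κ : Cardinal.{u}) (M₀ M₁ M₂ : Model L) (f₁ f₂ : ZFSet.{u} → ZFSet.{u})
    (M₃ : Model L) : Prop :=
  C.KCard κ M₃ ∧ C.IsEmbOver f₁ M₁ M₃ M₀.carrier ∧ C.IsEmbOver f₂ M₂ M₃ M₀.carrier

/-- The amalgamations `(f₁, f₂, M₃)` and `(g₁, g₂, N₃)` of `M₁, M₂` (over a common submodel) are
equivalent. -/
def AmalgamEquiv (κ : Cardinal.{u}) (M₁ M₂ : Model L) (f₁ f₂ : ZFSet.{u} → ZFSet.{u})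
    (M₃ : Model L) (g₁ g₂ : ZFSet.{u} → ZFSet.{u}) (N₃ : Model L) : Prop :=
  ∃ f g P, C.KCard κ P ∧ C.IsEmb f M₃ P ∧ C.IsEmb g N₃ P ∧
    (∀ x ∈ M₁.carrier, f (f₁ x) = g (g₁ x)) ∧ (∀ x ∈ M₂.carrier, f (f₂ x) = g (g₂ x))

end ModelClass

/-- The data `(K, ≼, S^bs, nf)` of a frame: `Sbs M` is the set of basic types over `M`, and
`nf M₀ M₁ a M₃` reads "`tp(a, M₁, M₃)` does not fork over `M₀`". -/
structure FrameData (L : FirstOrder.Language.{u, u}) extends ModelClass L where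
  Sbs : Model L → Set (Set (Triple L))
  nf : Model L → Model L → ZFSet.{u} → Model L → Prop

namespace FrameData

variable {L : FirstOrder.Language.{u, u}} (s : FrameData L) (κ : Cardinal.{u})

/-- The axioms of a semi-good `κ`-frame, except the local character axiom. -/
structure IsSemiGoodExceptLocalCharacter : Prop where
  infinite : Cardinal.aleph0 ≤ κ
  aec : s.toModelClass.IsAEC
  lst_le : s.LST ≤ κ
  joint_embedding : ∀ M₁ M₂, s.KCard κ M₁ → s.KCard κ M₂ →
    ∃ f₁ f₂ M₃, s.KCard κ M₃ ∧ s.IsEmb f₁ M₁ M₃ ∧ s.IsEmb f₂ M₂ M₃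
  amalgamation : ∀ M₀ M₁ M₂, s.KCard κ M₀ → s.KCard κ M₁ → s.KCard κ M₂ →
    s.le M₀ M₁ → s.le M₀ M₂ → ∃ f₁ f₂ M₃, s.IsAmalgam κ M₀ M₁ M₂ f₁ f₂ M₃
  no_maximal : ∀ M, s.KCard κ M → ∃ N, s.lt M N
  /-- basic types are non-algebraic types over models in `K_κ` -/
  basic_nonalg : ∀ M, s.KCard κ M → ∀ p ∈ s.Sbs M,
    ∃ N a, s.KCard κ N ∧ s.lt M N ∧ a ∈ N.carrier ∧ a ∉ M.carrier ∧ p = s.tp a M N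
  /-- the set of basic types respects isomorphisms -/
  basic_iso : ∀ f M N M' N' a, s.KCard κ M → s.le M N → s.tp a M N ∈ s.Sbs M →
    Model.IsIso f N N' → Model.IsIso f M M' → s.tp (f a) M' N' ∈ s.Sbs M'
  /-- density of the basic types -/
  basic_density : ∀ M N, s.KCard κ M → s.KCard κ N → s.lt M N →
    ∃ a, a ∈ N.carrier ∧ a ∉ M.carrier ∧ s.tp a M N ∈ s.Sbs M
  /-- basic weak stability -/
  basic_weak_stability : ∀ M, s.KCard κ M →
    Cardinal.mk (s.Sbs M) ≤ Cardinal.lift.{u + 1, u} (Order.succ κ)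
  nf_sub : ∀ M₀ M₁ a M₃, s.nf M₀ M₁ a M₃ →
    s.KCard κ M₀ ∧ s.KCard κ M₁ ∧ s.K M₃ ∧ s.le M₀ M₁ ∧ s.le M₁ M₃ ∧
      a ∈ M₃.carrier ∧ a ∉ M₁.carrier ∧ s.tp a M₀ M₃ ∈ s.Sbs M₀ ∧ s.tp a M₁ M₃ ∈ s.Sbs M₁
  /-- non-forking respects isomorphisms -/
  nf_iso : ∀ f M₀ M₁ a M₃ M₀' M₁' M₃', s.nf M₀ M₁ a M₃ →
    Model.IsIso f M₃ M₃' → Model.IsIso f M₀ M₀' → Model.IsIso f M₁ M₁' →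
      s.nf M₀' M₁' (f a) M₃'
  /-- monotonicity: `M₀ ≼ N₀ ≼ N₁ ≼ M₁ ≼ M₃ ≼ P` and `N₁ ∪ {a} ⊆ N₃ ≼ P` -/
  nf_mono : ∀ M₀ N₀ N₁ M₁ M₃ N₃ P a, s.le M₀ N₀ → s.le N₀ N₁ → s.le N₁ M₁ → s.le M₁ M₃ →
    s.le M₃ P → N₁.carrier ∪ {a} ⊆ N₃.carrier → s.le N₃ P →
      s.nf M₀ M₁ a M₃ → s.nf N₀ N₁ a N₃
  /-- uniqueness of the non-forking extension -/
  nf_unique : ∀ M N a N₁ b N₂, s.nf M N a N₁ → s.nf M N b N₂ →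
    s.tp a M N₁ = s.tp b M N₂ → s.tp a N N₁ = s.tp b N N₂
  /-- symmetry -/
  nf_symm : ∀ M₀ M₁ M₃ a₁ a₂, s.le M₀ M₁ → s.le M₁ M₃ → a₁ ∈ M₁.carrier →
    s.tp a₁ M₀ M₃ ∈ s.Sbs M₀ → s.nf M₀ M₁ a₂ M₃ →
      ∃ M₂ P, a₂ ∈ M₂.carrier ∧ s.le M₀ M₂ ∧ s.le M₂ P ∧ s.le M₃ P ∧ s.nf M₀ M₂ a₁ P
  /-- existence of a non-forking extension -/
  nf_exists : ∀ M N, s.KCard κ M → s.KCard κ N → s.lt M N → ∀ p ∈ s.Sbs M,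
    ∃ a N', s.nf M N a N' ∧ s.tp a M N' = p
  /-- continuity -/
  nf_cont : ∀ (δ : Ordinal.{u}) (M : Ordinal.{u} → Model L) (N : Model L) (a : ZFSet.{u}),
    Order.IsSuccLimit δ → (∀ α ≤ δ, s.KCard κ (M α)) → s.IncCont M (Set.Iic δ) →
      s.le (M δ) N → a ∈ N.carrier → (∀ α < δ, s.nf (M 0) (M α) a N) → s.nf (M 0) (M δ) a N

/-- The frame has conjugation: `K_κ` is categorical, and a basic type conjugates with each of its
non-forking extensions. -/
def HasConjugation : Prop :=
  (∀ M N, s.KCard κ M → s.KCard κ N → ∃ f, Model.IsIso f M N) ∧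
    ∀ M₁ M₂ a N, s.KCard κ M₁ → s.KCard κ M₂ → s.nf M₁ M₂ a N →
      s.Conjugate M₁ (s.tp a M₁ N) M₂ (s.tp a M₂ N)

/-- `(M, N, a) ∈ K^{3,bs}`. -/
def K3bs (M N : Model L) (a : ZFSet.{u}) : Prop :=
  s.KCard κ M ∧ s.KCard κ N ∧ s.le M N ∧ a ∈ N.carrier ∧ a ∉ M.carrier ∧ s.tp a M N ∈ s.Sbs M

/-- `(f₁, f₂, M₃)` is an amalgamation of `M₁, M₂` over `M₀` such that `tp(f₁(a), f₂[M₂], M₃)`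
does not fork over `M₀`. -/
def IsNFAmalgam (M₀ M₁ : Model L) (a : ZFSet.{u}) (M₂ : Model L)
    (f₁ f₂ : ZFSet.{u} → ZFSet.{u}) (M₃ : Model L) : Prop :=
  s.IsAmalgam κ M₀ M₁ M₂ f₁ f₂ M₃ ∧ ∃ M₂', Model.IsIso f₂ M₂ M₂' ∧ s.nf M₀ M₂' (f₁ a) M₃

/-- `(M₀, M₁, a) ∈ K^{3,uq}`, i.e. `(M₀, M₁, a)` is a uniqueness triple: for every `M₂ ∈ K_κ` with
`M₀ ≼ M₂` there is, up to equivalence over `M₀`, a unique amalgamation `(f₁, f₂, M₃)` of `M₁, M₂`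
over `M₀` such that `tp(f₁(a), f₂[M₂], M₃)` does not fork over `M₀`. -/
def K3uq (M₀ M₁ : Model L) (a : ZFSet.{u}) : Prop :=
  s.K3bs κ M₀ M₁ a ∧ ∀ M₂, s.KCard κ M₂ → s.le M₀ M₂ →
    (∃ f₁ f₂ M₃, s.IsNFAmalgam κ M₀ M₁ a M₂ f₁ f₂ M₃) ∧
    ∀ f₁ f₂ M₃ g₁ g₂ N₃, s.IsNFAmalgam κ M₀ M₁ a M₂ f₁ f₂ M₃ →
      s.IsNFAmalgam κ M₀ M₁ a M₂ g₁ g₂ N₃ → s.AmalgamEquiv κ M₁ M₂ f₁ f₂ M₃ g₁ g₂ N₃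

/-- The frame is weakly successful: the class of uniqueness triples has existence. -/
def WeaklySuccessful : Prop :=
  ∀ M N a, s.K3bs κ M N a → ∃ N' a', s.tp a' M N' = s.tp a M N ∧ s.K3uq κ M N' a'

/-- The relation `NF*`. -/
def NFStar (N₀ N₁ N₂ N₃ : Model L) : Prop :=
  s.KCard κ N₀ ∧ s.KCard κ N₁ ∧ s.KCard κ N₂ ∧ s.KCard κ N₃ ∧
  s.le N₀ N₁ ∧ s.le N₁ N₃ ∧ s.le N₀ N₂ ∧ s.le N₂ N₃ ∧
  ∃ α < (Order.succ κ).ord, ∃ (A B : Ordinal.{u} → Model L) (d : Ordinal.{u} → ZFSet.{u}),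
    (∀ i ≤ α, s.KCard κ (A i) ∧ s.KCard κ (B i)) ∧
    s.IncCont A (Set.Iic α) ∧ s.IncCont B (Set.Iic α) ∧
    A 0 = N₀ ∧ A α = N₁ ∧ B 0 = N₂ ∧ B α = N₃ ∧
    (∀ i ≤ α, s.le (A i) (B i)) ∧
    (∀ i < α, d i ∈ (A (Order.succ i)).carrier ∧ d i ∉ (A i).carrier) ∧
    (∀ i < α, s.K3uq κ (A i) (A (Order.succ i)) (d i)) ∧
    (∀ i < α, s.nf (A i) (B i) (d i) (B (Order.succ i)))

/-- The relation `NF`. -/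
def NF (M₀ M₁ M₂ M₃ : Model L) : Prop :=
  (s.KCard κ M₀ ∧ s.KCard κ M₁ ∧ s.KCard κ M₂ ∧ s.KCard κ M₃) ∧
  s.le M₀ M₁ ∧ s.le M₁ M₃ ∧ s.le M₀ M₂ ∧ s.le M₂ M₃ ∧
  ∃ N₀ N₁ N₂ N₃, N₀ = M₀ ∧ s.le M₀ N₀ ∧ s.le M₁ N₁ ∧ s.le M₂ N₂ ∧ s.le M₃ N₃ ∧
    s.NFStar κ N₀ N₁ N₂ N₃

variable (R : Model L → Model L → Model L → Model L → Prop)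

/-- The relation `R` is closed under isomorphisms. -/
def IsoClosed : Prop :=
  ∀ f M₀ M₁ M₂ M₃ M₀' M₁' M₂' M₃', R M₀ M₁ M₂ M₃ →
    Model.IsIso f M₃ M₃' → Model.IsIso f M₀ M₀' → Model.IsIso f M₁ M₁' → Model.IsIso f M₂ M₂' →
      R M₀' M₁' M₂' M₃'

/-- The axioms of a non-forking amalgamation relation. -/
structure IsNonforkingAmalgamation : Prop where
  /-- `R` is a relation on `K_κ` -/
  mem : ∀ M₀ M₁ M₂ M₃, R M₀ M₁ M₂ M₃ →
    s.KCard κ M₀ ∧ s.KCard κ M₁ ∧ s.KCard κ M₂ ∧ s.KCard κ M₃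
  disjointness : ∀ M₀ M₁ M₂ M₃, R M₀ M₁ M₂ M₃ →
    s.le M₀ M₁ ∧ s.le M₁ M₃ ∧ s.le M₀ M₂ ∧ s.le M₂ M₃ ∧
      M₁.carrier ∩ M₂.carrier = M₀.carrier
  monotonicity : ∀ M₀ M₁ M₂ M₃ N₀ N₁ N₂ N₃, R M₀ M₁ M₂ M₃ →
    s.KCard κ N₀ → s.KCard κ N₁ → s.KCard κ N₂ → s.KCard κ N₃ →
    N₀ = M₀ → s.le N₁ M₁ → s.le N₂ M₂ → s.le N₀ N₁ → s.le N₁ N₃ → s.le N₀ N₂ → s.le N₂ N₃ →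
    (∃ P, s.le M₃ P ∧ s.le N₃ P) → R N₀ N₁ N₂ N₃
  existence : ∀ N₀ N₁ N₂, s.KCard κ N₀ → s.KCard κ N₁ → s.KCard κ N₂ →
    s.le N₀ N₁ → s.le N₀ N₂ → N₁.carrier ∩ N₂.carrier = N₀.carrier → ∃ N₃, R N₀ N₁ N₂ N₃
  weak_uniqueness : ∀ N₀ N₁ N₂ Na Nb, R N₀ N₁ N₂ Na → R N₀ N₁ N₂ Nb →
    ∃ f g P, s.KCard κ P ∧ s.IsEmbOver f Na P (N₁.carrier ∪ N₂.carrier) ∧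
      s.IsEmbOver g Nb P (N₁.carrier ∪ N₂.carrier)
  symmetry : ∀ N₀ N₁ N₂ N₃, R N₀ N₁ N₂ N₃ ↔ R N₀ N₂ N₁ N₃
  /-- The requirement `A 0 ≼ B 0` follows from the others unless `α = 0`. -/
  long_transitivity : ∀ (α : Ordinal.{u}) (A B : Ordinal.{u} → Model L),
    (∀ i ≤ α, s.KCard κ (A i) ∧ s.KCard κ (B i)) →
    s.IncCont A (Set.Iic α) → s.IncCont B (Set.Iic α) → s.le (A 0) (B 0) →
    (∀ i < α, R (A i) (A (Order.succ i)) (B i) (B (Order.succ i))) →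
      R (A 0) (A α) (B 0) (B α)

/-- `R` respects the frame. -/
def Respects : Prop :=
  ∀ M₀ M₁ M₂ M₃ a, R M₀ M₁ M₂ M₃ → s.tp a M₀ M₁ ∈ s.Sbs M₀ → s.nf M₀ M₂ a M₃

end FrameData

end

open scoped FirstOrder

noncomputable section

open FirstOrder Language Set

namespace Model

variable {L : FirstOrder.Language.{u, u}}

theorem structure_eq_of_equiv {S : Type*} (σ τ : L.Structure S) (e : @Language.Equiv L S S σ τ)
    (he : ∀ x, @Language.Equiv.toEquiv L S S σ τ e x = x) : σ = τ := by
  apply Structure.ext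
  · funext n F x
    have h1 := @Language.Equiv.map_fun' L S S σ τ e n F x
    have h2 : ((@Language.Equiv.toEquiv L S S σ τ e).toFun ∘ x) = x := funext fun i => he (x i)
    rw [h2] at h1
    exact (he _).symm.trans h1
  · funext n R x
    have h1 := @Language.Equiv.map_rel' L S S σ τ e n R x
    have h2 : ((@Language.Equiv.toEquiv L S S σ τ e).toFun ∘ x) = x := funext fun i => he (x i)
    rw [h2] at h1
    exact propext h1.symm

theorem eq_of_equiv {M N : Model L} (e : M ≃[L] N)
    (he : ∀ x : M, ((e x : N) : ZFSet.{u}) = (x : ZFSet.{u})) : M = N := by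
  obtain ⟨S, hS, σ⟩ := M
  obtain ⟨T, hT, τ⟩ := N
  have hST : S = T := by
    ext x
    constructor
    · intro hx
      exact (congrArg (· ∈ T) (he ⟨x, hx⟩)).mp (e ⟨x, hx⟩).2
    · intro hx
      obtain ⟨y, hy⟩ := e.surjective ⟨x, hx⟩
      have h1 := he y
      rw [hy] at h1
      change x = _ at h1
      rw [h1]
      exact y.2
  subst hST
  have := structure_eq_of_equiv σ τ e fun x => Subtype.ext (he x)
  subst this
  rfl

theorem IsSubmodel.subset {M N : Model L} (h : IsSubmodel M N) : M.carrier ⊆ N.carrier := by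
  obtain ⟨e, he⟩ := h
  intro x hx
  exact (congrArg (· ∈ N.carrier) (he ⟨x, hx⟩)).mp (e ⟨x, hx⟩).2

theorem IsSubmodel.eq_of_subset {M N : Model L} (h : IsSubmodel M N)
    (h' : N.carrier ⊆ M.carrier) : M = N := by
  obtain ⟨e, he⟩ := h
  have hs : Function.Surjective e := fun y => ⟨⟨y, h' y.2⟩, Subtype.ext (he _)⟩
  refine eq_of_equiv (M := M) (N := N)
    { Equiv.ofBijective e ⟨e.injective, hs⟩ with
      map_fun' := fun F x => e.map_fun' F x
      map_rel' := fun R x => e.map_rel' R x } he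

theorem IsSubmodel.antisymm {M N : Model L} (h : IsSubmodel M N) (h' : IsSubmodel N M) : M = N :=
  h.eq_of_subset h'.subset

/-- Submodels of a common model are comparable as soon as their universes are. -/
theorem IsSubmodel.of_subset {M N P : Model L} (h : IsSubmodel M P) (h' : IsSubmodel N P)
    (hs : M.carrier ⊆ N.carrier) : IsSubmodel M N := by
  obtain ⟨e, he⟩ := h
  obtain ⟨e', he'⟩ := h'
  have key : ∀ x : M, e' (inclusion hs x) = e x := fun x => Subtype.ext (by rw [he, he'])
  refine ⟨{ toFun := inclusion hs, inj' := inclusion_injective hs, map_fun' := ?_, map_rel' := ?_ },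
    fun _ => rfl⟩
  · intro n F x
    apply e'.injective
    rw [e'.map_fun, key, e.map_fun]
    congr 1
    funext i
    exact (key (x i)).symm
  · intro n R x
    rw [← e'.map_rel, ← e.map_rel]
    have : e' ∘ (inclusion hs ∘ x) = e ∘ x := funext fun i => key (x i)
    rw [← this]

/-- A chosen preimage of a point in the image of `M`. -/
def preimg (f : ZFSet.{u} → ZFSet.{u}) (M : Model L) (x : f '' M.carrier) : M :=
  ⟨Classical.choose x.2, (Classical.choose_spec x.2).1⟩

theorem apply_preimg (f : ZFSet.{u} → ZFSet.{u}) (M : Model L) (x : f '' M.carrier) :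
    f (preimg f M x : ZFSet.{u}) = x := (Classical.choose_spec x.2).2

/-- The image model `f[M]`, meaningful for `f` injective on `M`. -/
def map (f : ZFSet.{u} → ZFSet.{u}) (M : Model L) : Model L where
  carrier := f '' M.carrier
  small := by
    have := M.small
    exact small_image f M.carrier
  str :=
    { funMap := fun F x =>
        ⟨f (Structure.funMap F (fun i => preimg f M (x i)) : M), mem_image_of_mem _ (Subtype.prop _)⟩
      RelMap := fun R x => Structure.RelMap R (fun i => preimg f M (x i)) }

@[simp] theorem map_carrier (f : ZFSet.{u} → ZFSet.{u}) (M : Model L) :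
    (map f M).carrier = f '' M.carrier := rfl

theorem isIso_map {f : ZFSet.{u} → ZFSet.{u}} {M : Model L} (hf : InjOn f M.carrier) :
    IsIso f M (map f M) := by
  have key : ∀ (x : M) (h : f (x : ZFSet.{u}) ∈ f '' M.carrier), preimg f M ⟨f x, h⟩ = x :=
    fun x h => Subtype.ext (hf (Subtype.prop _) x.2 (apply_preimg f M ⟨f x, h⟩))
  refine ⟨{ toFun := fun x => ⟨f x, mem_image_of_mem _ x.2⟩
            invFun := preimg f M
            left_inv := fun x => key x _
            right_inv := fun x => Subtype.ext (apply_preimg f M x)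
            map_fun' := ?_
            map_rel' := ?_ }, fun _ => rfl⟩
  · intro n F x
    apply Subtype.ext
    change f _ = f (Structure.funMap F (fun i => preimg f M ⟨f (x i), _⟩) : M)
    simp only [key]
  · intro n R x
    change Structure.RelMap R (fun i => preimg f M ⟨f (x i), _⟩) ↔ _
    simp only [key]

theorem isIso_iff {f : ZFSet.{u} → ZFSet.{u}} {M N : Model L} :
    IsIso f M N ↔ InjOn f M.carrier ∧ map f M = N := by
  constructor
  · rintro ⟨e, he⟩
    have hf : InjOn f M.carrier := by
      intro x hx y hy hxy
      have h1 : e ⟨x, hx⟩ = e ⟨y, hy⟩ := Subtype.ext (by rw [he, he]; exact hxy)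
      exact congrArg Subtype.val (e.injective h1)
    obtain ⟨e', he'⟩ := isIso_map hf
    refine ⟨hf, eq_of_equiv (e.comp e'.symm) fun x => ?_⟩
    obtain ⟨y, rfl⟩ := e'.surjective x
    rw [Language.Equiv.comp_apply, he, he', Language.Equiv.symm_apply_apply]
  · rintro ⟨hf, rfl⟩
    exact isIso_map hf

theorem IsIso.comp {f g : ZFSet.{u} → ZFSet.{u}} {M N P : Model L} (h : IsIso f M N)
    (h' : IsIso g N P) : IsIso (g ∘ f) M P := by
  obtain ⟨e, he⟩ := h
  obtain ⟨e', he'⟩ := h'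
  exact ⟨e'.comp e, fun x => by rw [Language.Equiv.comp_apply, he', he]; rfl⟩

theorem IsIso.congr {f g : ZFSet.{u} → ZFSet.{u}} {M N : Model L} (h : IsIso f M N)
    (hfg : EqOn f g M.carrier) : IsIso g M N := by
  obtain ⟨e, he⟩ := h
  exact ⟨e, fun x => (he x).trans (hfg x.2)⟩

theorem isIso_of_eqOn_id {f : ZFSet.{u} → ZFSet.{u}} {M : Model L} (h : ∀ x ∈ M.carrier, f x = x) :
    IsIso f M M := ⟨Language.Equiv.refl L M, fun x => (h x x.2).symm⟩

theorem map_of_eqOn_id {f : ZFSet.{u} → ZFSet.{u}} {M : Model L} (h : ∀ x ∈ M.carrier, f x = x) :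
    map f M = M := (isIso_iff.1 (isIso_of_eqOn_id h)).2

theorem map_congr {f g : ZFSet.{u} → ZFSet.{u}} {M : Model L} (hf : InjOn f M.carrier)
    (hfg : EqOn f g M.carrier) : map f M = map g M :=
  (isIso_iff.1 ((isIso_map hf).congr hfg)).2.symm

theorem map_map {f g : ZFSet.{u} → ZFSet.{u}} {M : Model L} (hf : InjOn f M.carrier)
    (hg : InjOn g (f '' M.carrier)) : map g (map f M) = map (g ∘ f) M :=
  (isIso_iff.1 ((isIso_map hf).comp (isIso_map (M := map f M) hg))).2.symm

theorem map_map_of_leftInv {f g : ZFSet.{u} → ZFSet.{u}} {M : Model L}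
    (h : ∀ x ∈ M.carrier, g (f x) = x) : map g (map f M) = M := by
  have hf : InjOn f M.carrier := fun x hx y hy hxy => by rw [← h x hx, ← h y hy, hxy]
  have hg : InjOn g (f '' M.carrier) := by
    rintro _ ⟨x, hx, rfl⟩ _ ⟨y, hy, rfl⟩ hxy
    rw [h x hx, h y hy] at hxy
    rw [hxy]
  rw [map_map hf hg]
  exact map_of_eqOn_id h

theorem IsSubmodel.map {f : ZFSet.{u} → ZFSet.{u}} {M N : Model L} (h : IsSubmodel M N)
    (hf : InjOn f N.carrier) : IsSubmodel (map f M) (map f N) := by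
  obtain ⟨e, he⟩ := h
  obtain ⟨e₁, h₁⟩ := isIso_map (M := M) (hf.mono (IsSubmodel.subset ⟨e, he⟩))
  obtain ⟨e₂, h₂⟩ := isIso_map hf
  refine ⟨e₂.toEmbedding.comp (e.comp e₁.symm.toEmbedding), fun x => ?_⟩
  obtain ⟨y, rfl⟩ := e₁.surjective x
  rw [Embedding.comp_apply, Embedding.comp_apply]
  change ((e₂ (e (e₁.symm (e₁ y))) : Model.map f N) : ZFSet.{u}) = _
  rw [Language.Equiv.symm_apply_apply, h₂, he, h₁]

/-- The union of a directed system of models indexed by the ordinals below a limit. -/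
theorem exists_isUnion {M : Ordinal.{u} → Model L} {δ : Ordinal.{u}} (hδ : Order.IsSuccLimit δ)
    (h : ∀ i j, i ≤ j → j < δ → IsSubmodel (M i) (M j)) : ∃ U, IsUnion M δ U := by
  have hδ0 : 0 < δ := hδ.bot_lt
  set S : Set ZFSet.{u} := ⋃ α ∈ Iio δ, (M α).carrier with hS
  have hmem : ∀ x : S, ∃ i < δ, (x : ZFSet.{u}) ∈ (M i).carrier := by
    rintro ⟨x, hx⟩
    simpa [hS] using hx
  have hfin : ∀ {n : ℕ} (x : Fin n → S), ∃ i < δ, ∀ k, (x k : ZFSet.{u}) ∈ (M i).carrier := by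
    intro n x
    choose i hi hx using fun k => hmem (x k)
    refine ⟨Finset.univ.sup i, ?_, fun k => ?_⟩
    · rw [Finset.sup_lt_iff (by simpa using hδ0)]
      exact fun k _ => hi k
    · refine (h _ _ (Finset.le_sup (Finset.mem_univ k)) ?_).subset (hx k)
      rw [Finset.sup_lt_iff (by simpa using hδ0)]
      exact fun k _ => hi k
  have hsub : ∀ i < δ, (M i).carrier ⊆ S := fun i hi x hx => by
    rw [hS]; exact mem_biUnion (show i ∈ Iio δ from hi) hx
  choose idx hidx hx using @hfin
  let σ : L.Structure S :=
    { funMap := fun F x => ⟨(Structure.funMap F (fun k => ⟨x k, hx x k⟩ : _ → M (idx x)) : M (idx x)),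
        hsub _ (hidx x) (Subtype.prop _)⟩
      RelMap := fun R x => Structure.RelMap R (fun k => ⟨x k, hx x k⟩ : _ → M (idx x)) }
  have hsmall : Small.{u} S := by
    have : ∀ i, Small.{u} (M i).carrier := fun i => (M i).small
    exact small_biUnion _ _
  have cmpF : ∀ {n : ℕ} (F : L.Functions n) (i j : Ordinal.{u}), i < δ → j < δ →
      ∀ (x : Fin n → M i) (y : Fin n → M j), (∀ k, (x k : ZFSet.{u}) = y k) →
      ((Structure.funMap F x : M i) : ZFSet.{u}) = (Structure.funMap F y : M j) := by
    have : ∀ {n : ℕ} (F : L.Functions n) (i j : Ordinal.{u}), i ≤ j → j < δ →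
      ∀ (x : Fin n → M i) (y : Fin n → M j), (∀ k, (x k : ZFSet.{u}) = y k) →
      ((Structure.funMap F x : M i) : ZFSet.{u}) = (Structure.funMap F y : M j) := by
      intro n F i j hij hj x y hxy
      obtain ⟨e, he⟩ := h i j hij hj
      rw [← he, e.map_fun]
      congr 2
      funext k
      exact Subtype.ext ((he _).trans (hxy k))
    intro n F i j hi hj x y hxy
    rcases le_total i j with hij | hij
    · exact this F i j hij hj x y hxy
    · exact (this F j i hij hi y x fun k => (hxy k).symm).symm
  have cmpR : ∀ {n : ℕ} (R : L.Relations n) (i j : Ordinal.{u}), i < δ → j < δ →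
      ∀ (x : Fin n → M i) (y : Fin n → M j), (∀ k, (x k : ZFSet.{u}) = y k) →
      (Structure.RelMap R x ↔ Structure.RelMap R y) := by
    have : ∀ {n : ℕ} (R : L.Relations n) (i j : Ordinal.{u}), i ≤ j → j < δ →
      ∀ (x : Fin n → M i) (y : Fin n → M j), (∀ k, (x k : ZFSet.{u}) = y k) →
      (Structure.RelMap R x ↔ Structure.RelMap R y) := by
      intro n R i j hij hj x y hxy
      obtain ⟨e, he⟩ := h i j hij hj
      rw [← e.map_rel]
      have : e ∘ x = y := funext fun k => Subtype.ext ((he _).trans (hxy k))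
      rw [this]
    intro n R i j hi hj x y hxy
    rcases le_total i j with hij | hij
    · exact this R i j hij hj x y hxy
    · exact (this R j i hij hi y x fun k => (hxy k).symm).symm
  have hemb : ∀ i < δ, ∃ e : M i ↪[L] S, ∀ x : M i, ((e x : S) : ZFSet.{u}) = x := by
    intro i hi
    refine ⟨⟨⟨inclusion (hsub i hi), inclusion_injective _⟩, ?_, ?_⟩, fun _ => rfl⟩
    · intro n F x
      apply Subtype.ext
      exact cmpF F i _ hi (hidx _) _ _ fun k => rfl
    · intro n R x
      exact cmpR R _ i (hidx _) hi _ _ fun k => rfl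
  exact ⟨⟨S, hsmall, σ⟩, rfl, hemb⟩

theorem IsUnion.congr {M N : Ordinal.{u} → Model L} {δ : Ordinal.{u}} {U : Model L}
    (h : IsUnion M δ U) (hMN : ∀ i < δ, M i = N i) : IsUnion N δ U := by
  refine ⟨?_, fun i hi => hMN i hi ▸ h.2 i hi⟩
  rw [h.1]
  exact iUnion₂_congr fun i hi => by rw [hMN i hi]

theorem IsUnion.mem_iff {M : Ordinal.{u} → Model L} {δ : Ordinal.{u}} {U : Model L}
    (h : IsUnion M δ U) {x : ZFSet.{u}} : x ∈ U.carrier ↔ ∃ i < δ, x ∈ (M i).carrier := by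
  rw [h.1]; simp

theorem IsUnion.map {M : Ordinal.{u} → Model L} {δ : Ordinal.{u}} {U : Model L}
    (h : IsUnion M δ U) {f : ZFSet.{u} → ZFSet.{u}} (hf : InjOn f U.carrier) :
    IsUnion (fun i => map f (M i)) δ (map f U) := by
  refine ⟨?_, fun i hi => (h.2 i hi).map hf⟩
  rw [map_carrier, h.1, image_iUnion₂]
  rfl

end Model

/-- An injection of a subset of a small set extends, with new values outside a given small set. -/
theorem exists_fresh_extension {f : ZFSet.{u} → ZFSet.{u}} {D Y : Set ZFSet.{u}}
    (hf : InjOn f D) (hD : Small.{u} D) (hY : Small.{u} Y) :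
    ∃ g : ZFSet.{u} → ZFSet.{u}, EqOn g f D ∧ Function.Injective g ∧ ∀ x ∉ D, g x ∉ Y := by
  classical
  have := hD
  have := hY
  have : Small.{u} ↥(Y ∪ f '' D) := small_union _ _
  let z : ZFSet.{u} := ZFSet.range (fun x : ↥(Y ∪ f '' D) => (x : ZFSet.{u}))
  have hz : ∀ x ∈ Y ∪ f '' D, ∀ y, x ≠ ZFSet.pair y z := by
    rintro x hx y rfl
    have h1 : ZFSet.pair y z ∈ z := by
      rw [ZFSet.mem_range]
      exact ⟨⟨_, hx⟩, rfl⟩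
    have h2 := ZFSet.rank_lt_of_mem h1
    have h3 : z.rank < ({y, z} : ZFSet.{u}).rank := ZFSet.rank_lt_of_mem (by simp)
    have h4 : ({y, z} : ZFSet.{u}).rank < (ZFSet.pair y z).rank :=
      ZFSet.rank_lt_of_mem (by simp [ZFSet.pair])
    exact absurd (h3.trans h4) h2.not_gt
  refine ⟨fun x => if x ∈ D then f x else ZFSet.pair x z, fun x hx => by simp [hx], ?_, ?_⟩
  · intro x y hxy
    by_cases hx : x ∈ D <;> by_cases hy : y ∈ D <;> simp only [hx, hy, if_true, if_false] at hxy
    · exact hf hx hy hxy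
    · exact absurd hxy (hz _ (Or.inr ⟨x, hx, rfl⟩) y)
    · exact absurd hxy.symm (hz _ (Or.inr ⟨y, hy, rfl⟩) x)
    · exact (ZFSet.pair_injective hxy).1
  · intro x hx hxY
    simp only [if_neg hx] at hxY
    exact hz _ (Or.inl hxY) x rfl

theorem exists_transfinite_sequence {X : Type*} (x₀ : X) (S : Ordinal.{u} → X → X)
    (T : Ordinal.{u} → (Ordinal.{u} → X) → X) :
    ∃ x : Ordinal.{u} → X, x 0 = x₀ ∧ (∀ i, x (Order.succ i) = S i (x i)) ∧
      ∀ δ, Order.IsSuccLimit δ → x δ = T δ (fun i => open Classical in if i < δ then x i else x₀) := by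
  classical
  let x : Ordinal.{u} → X := fun o => Ordinal.limitRecOn o x₀ (fun i y => S i y)
    (fun δ _ g => T δ (fun i => if h : i < δ then g i h else x₀))
  refine ⟨x, Ordinal.limitRecOn_zero .., fun i => ?_, fun δ hδ => ?_⟩
  · rw [Order.succ_eq_add_one]
    exact Ordinal.limitRecOn_add_one ..
  · change Ordinal.limitRecOn .. = _
    rw [Ordinal.limitRecOn_limit _ _ _ _ hδ]
    simp only [dite_eq_ite]
    rfl

namespace ModelClass

variable {L : FirstOrder.Language.{u, u}} {C : ModelClass L}

theorem isEmb_iff {f : ZFSet.{u} → ZFSet.{u}} {M N : Model L} :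
    C.IsEmb f M N ↔ InjOn f M.carrier ∧ C.le (Model.map f M) N := by
  constructor
  · rintro ⟨M', h, h'⟩
    obtain ⟨h₁, rfl⟩ := Model.isIso_iff.1 h
    exact ⟨h₁, h'⟩
  · rintro ⟨h, h'⟩
    exact ⟨_, Model.isIso_map h, h'⟩

theorem IsEmb.injOn {f : ZFSet.{u} → ZFSet.{u}} {M N : Model L} (h : C.IsEmb f M N) :
    InjOn f M.carrier := (isEmb_iff.1 h).1

theorem IsEmb.le {f : ZFSet.{u} → ZFSet.{u}} {M N : Model L} (h : C.IsEmb f M N) :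
    C.le (Model.map f M) N := (isEmb_iff.1 h).2

theorem IsEmb.congr {f g : ZFSet.{u} → ZFSet.{u}} {M N : Model L} (h : C.IsEmb f M N)
    (hfg : EqOn f g M.carrier) : C.IsEmb g M N := by
  rw [isEmb_iff] at h ⊢
  exact ⟨h.1.congr hfg, Model.map_congr h.1 hfg ▸ h.2⟩

theorem isEmb_of_le {f : ZFSet.{u} → ZFSet.{u}} {M N : Model L} (hMN : C.le M N)
    (hf : ∀ x ∈ M.carrier, f x = x) : C.IsEmb f M N :=
  ⟨M, Model.isIso_of_eqOn_id hf, hMN⟩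

namespace IsAEC

theorem subset (h : C.IsAEC) {M N : Model L} (hMN : C.le M N) : M.carrier ⊆ N.carrier :=
  (h.le_sub M N hMN).subset

theorem antisymm (h : C.IsAEC) {M N : Model L} (hMN : C.le M N) (hNM : C.le N M) : M = N :=
  (h.le_sub M N hMN).antisymm (h.le_sub N M hNM)

theorem eq_of_subset (h : C.IsAEC) {M N : Model L} (hMN : C.le M N) (hs : N.carrier ⊆ M.carrier) :
    M = N := (h.le_sub M N hMN).eq_of_subset hs

theorem trans (h : C.IsAEC) {M N P : Model L} (h₁ : C.le M N) (h₂ : C.le N P) : C.le M P :=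
  h.le_trans _ _ _ h₁ h₂

theorem left_mem (h : C.IsAEC) {M N : Model L} (hMN : C.le M N) : C.K M := (h.le_mem _ _ hMN).1

theorem right_mem (h : C.IsAEC) {M N : Model L} (hMN : C.le M N) : C.K N := (h.le_mem _ _ hMN).2

theorem refl_left (h : C.IsAEC) {M N : Model L} (hMN : C.le M N) : C.le M M :=
  h.le_refl _ (h.left_mem hMN)

theorem refl_right (h : C.IsAEC) {M N : Model L} (hMN : C.le M N) : C.le N N :=
  h.le_refl _ (h.right_mem hMN)

theorem le_of_subset (h : C.IsAEC) {M N P : Model L} (h₁ : C.le M P) (h₂ : C.le N P)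
    (hs : M.carrier ⊆ N.carrier) : C.le M N :=
  h.coherence _ _ _ ((h.le_sub _ _ h₁).of_subset (h.le_sub _ _ h₂) hs) (h.le_sub _ _ h₂) h₁ h₂

theorem map_mem (h : C.IsAEC) {f : ZFSet.{u} → ZFSet.{u}} {M : Model L} (hM : C.K M)
    (hf : InjOn f M.carrier) : C.K (Model.map f M) :=
  h.iso_mem f _ _ hM (Model.isIso_map hf)

theorem map_le (h : C.IsAEC) {f : ZFSet.{u} → ZFSet.{u}} {M N : Model L} (hMN : C.le M N)
    (hf : InjOn f N.carrier) : C.le (Model.map f M) (Model.map f N) :=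
  h.iso_le f _ _ _ _ hMN (Model.isIso_map hf) (Model.isIso_map (hf.mono (h.subset hMN)))

theorem le_map_of_id (h : C.IsAEC) {f : ZFSet.{u} → ZFSet.{u}} {M N : Model L} (hMN : C.le M N)
    (hf : InjOn f N.carrier) (hid : ∀ x ∈ M.carrier, f x = x) : C.le M (Model.map f N) := by
  have := h.map_le hMN hf
  rwa [Model.map_of_eqOn_id hid] at this

theorem map_kcard (h : C.IsAEC) {κ : Cardinal.{u}} {f : ZFSet.{u} → ZFSet.{u}} {M : Model L}
    (hM : C.KCard κ M) (hf : InjOn f M.carrier) : C.KCard κ (Model.map f M) :=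
  ⟨h.map_mem hM.1 hf, (Cardinal.mk_image_eq_of_injOn f _ hf).trans hM.2⟩

theorem isEmb_map (h : C.IsAEC) {f : ZFSet.{u} → ZFSet.{u}} {M : Model L} (hM : C.K M)
    (hf : InjOn f M.carrier) : C.IsEmb f M (Model.map f M) :=
  isEmb_iff.2 ⟨hf, h.le_refl _ (h.map_mem hM hf)⟩

theorem emb_trans_le (h : C.IsAEC) {f : ZFSet.{u} → ZFSet.{u}} {M N P : Model L}
    (h₁ : C.IsEmb f M N) (h₂ : C.le N P) : C.IsEmb f M P :=
  isEmb_iff.2 ⟨h₁.injOn, h.trans h₁.le h₂⟩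

theorem emb_of_le (h : C.IsAEC) {f : ZFSet.{u} → ZFSet.{u}} {M N P : Model L}
    (h₁ : C.IsEmb f N P) (h₂ : C.le M N) : C.IsEmb f M P :=
  isEmb_iff.2 ⟨h₁.injOn.mono (h.subset h₂), h.trans (h.map_le h₂ h₁.injOn) h₁.le⟩

theorem emb_image_subset (h : C.IsAEC) {f : ZFSet.{u} → ZFSet.{u}} {M N : Model L}
    (h₁ : C.IsEmb f M N) : f '' M.carrier ⊆ N.carrier := h.subset h₁.le

theorem emb_mem (h : C.IsAEC) {f : ZFSet.{u} → ZFSet.{u}} {M N : Model L}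
    (h₁ : C.IsEmb f M N) {x : ZFSet.{u}} (hx : x ∈ M.carrier) : f x ∈ N.carrier :=
  h.emb_image_subset h₁ ⟨x, hx, rfl⟩

theorem emb_comp (h : C.IsAEC) {f g : ZFSet.{u} → ZFSet.{u}} {M N P : Model L}
    (h₁ : C.IsEmb f M N) (h₂ : C.IsEmb g N P) : C.IsEmb (g ∘ f) M P := by
  have hg := h₂.injOn.mono (h.emb_image_subset h₁)
  refine isEmb_iff.2 ⟨h₂.injOn.comp h₁.injOn fun x hx => h.emb_mem h₁ hx, ?_⟩
  rw [← Model.map_map h₁.injOn hg]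
  exact h.trans (h.map_le h₁.le h₂.injOn) h₂.le

/-- An embedding becomes an inclusion after renaming its target, with the new elements outside a
given small set. -/
theorem exists_rename (h : C.IsAEC) {f : ZFSet.{u} → ZFSet.{u}} {M P : Model L}
    (hf : C.IsEmb f M P) (Y : Set ZFSet.{u}) (hY : Small.{u} Y) :
    ∃ g : ZFSet.{u} → ZFSet.{u}, Function.Injective g ∧ (∀ x ∈ M.carrier, g (f x) = x) ∧
      C.le M (Model.map g P) ∧ ∀ x ∈ (Model.map g P).carrier, x ∈ Y → x ∈ M.carrier := by
  have hsm : Small.{u} ↥(f '' M.carrier) := by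
    have := M.small
    exact small_image _ _
  have hinv : ∀ x ∈ M.carrier, Function.invFunOn f M.carrier (f x) = x :=
    fun x hx => hf.injOn.leftInvOn_invFunOn hx
  have hi : InjOn (Function.invFunOn f M.carrier) (f '' M.carrier) := by
    rintro _ ⟨x, hx, rfl⟩ _ ⟨y, hy, rfl⟩ hxy
    rw [hinv x hx, hinv y hy] at hxy
    rw [hxy]
  obtain ⟨g, hg, hinj, hnew⟩ := exists_fresh_extension hi hsm hY
  have hgf : ∀ x ∈ M.carrier, g (f x) = x := fun x hx => by rw [hg ⟨x, hx, rfl⟩, hinv x hx]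
  refine ⟨g, hinj, hgf, ?_, ?_⟩
  · have h1 := h.map_le hf.le hinj.injOn
    rwa [Model.map_map_of_leftInv hgf] at h1
  · rintro _ ⟨x, hx, rfl⟩ hxY
    by_contra hxM
    by_cases hxD : x ∈ f '' M.carrier
    · obtain ⟨y, hy, rfl⟩ := hxD
      rw [hgf y hy] at hxM
      exact hxM hy
    · exact hnew x hxD hxY

/-- The members of a chain are `≼`-below its union. -/
theorem le_union (h : C.IsAEC) {M : Ordinal.{u} → Model L} {δ : Ordinal.{u}} {U : Model L}
    (hδ : Order.IsSuccLimit δ) (hM : C.IncCont M (Iio δ)) (hU : Model.IsUnion M δ U) :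
    C.K U ∧ ∀ i < δ, C.le (M i) U := by
  refine ⟨(h.union δ M hδ hM U hU).1, fun i hi => ?_⟩
  have hmax : ∀ j < δ, max i j < δ := fun j hj => max_lt hi hj
  have h1 : C.IncCont (fun j => M (max i j)) (Iio δ) := by
    refine ⟨fun a ha b hb hab => hM.1 _ (hmax a ha) _ (hmax b hb) (max_le_max_left i hab), ?_⟩
    intro a ha hla
    refine ⟨?_, fun b hb => h.le_sub _ _ (hM.1 _ (hmax b (hb.trans ha)) _ (hmax a ha)
      (max_le_max_left i hb.le))⟩
    ext x
    simp only [mem_iUnion, mem_Iio, exists_prop]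
    rcases le_or_gt a i with hai | hia
    · rw [max_eq_left hai]
      constructor
      · intro hx
        exact ⟨0, hla.bot_lt, by simpa using hx⟩
      · rintro ⟨b, hb, hx⟩
        rwa [max_eq_left (hb.le.trans hai)] at hx
    · rw [max_eq_right hia.le, (hM.2 a ha hla).mem_iff]
      constructor
      · rintro ⟨b, hb, hx⟩
        exact ⟨b, hb, h.subset (hM.1 b (hb.trans ha) _ (hmax b (hb.trans ha)) (le_max_right _ _)) hx⟩
      · rintro ⟨b, hb, hx⟩
        exact ⟨max i b, max_lt hia hb, hx⟩
  have h2 : Model.IsUnion (fun j => M (max i j)) δ U := by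
    refine ⟨?_, fun b hb => hU.2 _ (hmax b hb)⟩
    ext x
    rw [hU.mem_iff]
    simp only [mem_iUnion, mem_Iio, exists_prop]
    constructor
    · rintro ⟨b, hb, hx⟩
      exact ⟨b, hb, h.subset (hM.1 b hb _ (hmax b hb) (le_max_right _ _)) hx⟩
    · rintro ⟨b, hb, hx⟩
      exact ⟨max i b, hmax b hb, hx⟩
  have h3 := (h.union δ _ hδ h1 U h2).2
  simpa using h3

theorem exists_union (h : C.IsAEC) {M : Ordinal.{u} → Model L} {δ : Ordinal.{u}}
    (hδ : Order.IsSuccLimit δ) (hM : C.IncCont M (Iio δ)) : ∃ U, Model.IsUnion M δ U :=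
  Model.exists_isUnion hδ fun i j hij hj =>
    h.le_sub _ _ (hM.1 i (hij.trans_lt hj) j hj hij)

end IsAEC

theorem IncCont.mono {M : Ordinal.{u} → Model L} {I I' : Set Ordinal.{u}} (hM : C.IncCont M I)
    (hI : I' ⊆ I) : C.IncCont M I' :=
  ⟨fun i hi j hj => hM.1 i (hI hi) j (hI hj), fun i hi => hM.2 i (hI hi)⟩

theorem IncCont.congr {M N : Ordinal.{u} → Model L} {Λ : Ordinal.{u}} (hM : C.IncCont M (Iio Λ))
    (hMN : ∀ i < Λ, M i = N i) : C.IncCont N (Iio Λ) := by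
  refine ⟨fun i hi j hj hij => hMN i hi ▸ hMN j hj ▸ hM.1 i hi j hj hij, fun i hi hl => ?_⟩
  rw [← hMN i hi]
  exact (hM.2 i hi hl).congr fun j hj => hMN j (hj.trans hi)

theorem IncCont.map {M : Ordinal.{u} → Model L} {Λ : Ordinal.{u}} (h : C.IsAEC)
    (hM : C.IncCont M (Iio Λ)) {f : ZFSet.{u} → ZFSet.{u}}
    (hf : ∀ i < Λ, InjOn f (M i).carrier) : C.IncCont (fun i => Model.map f (M i)) (Iio Λ) :=
  ⟨fun i hi j hj hij => h.map_le (hM.1 i hi j hj hij) (hf j hj),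
    fun i hi hl => (hM.2 i hi hl).map (hf i hi)⟩

namespace IsAEC

theorem incCont_of_steps (h : C.IsAEC) {M : Ordinal.{u} → Model L} {Λ : Ordinal.{u}}
    (h0 : C.K (M 0)) (hs : ∀ i, Order.succ i < Λ → C.le (M i) (M (Order.succ i)))
    (hl : ∀ i < Λ, Order.IsSuccLimit i → Model.IsUnion M i (M i)) : C.IncCont M (Iio Λ) := by
  have key : ∀ j, j < Λ → ∀ i ≤ j, C.le (M i) (M j) := by
    intro j
    induction j using Ordinal.limitRecOn with
    | zero =>
      intro _ i hi
      rw [nonpos_iff_eq_zero.1 hi]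
      exact h.le_refl _ h0
    | add_one j ih =>
      intro hj i hi
      rw [← Order.succ_eq_add_one] at hj hi ⊢
      have h1 := hs j hj
      rcases hi.lt_or_eq with hi | rfl
      · exact h.trans (ih ((Order.lt_succ j).trans hj) i (Order.lt_succ_iff.1 hi)) h1
      · exact h.refl_right h1
    | limit j hlj ih =>
      intro hj i hi
      have h1 : C.IncCont M (Iio j) :=
        ⟨fun a ha b hb hab => ih b hb (hb.trans hj) a hab,
          fun a ha hla => hl a (ha.trans hj) hla⟩
      have h2 := h.le_union hlj h1 (hl j hj hlj)
      rcases hi.lt_or_eq with hi | rfl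
      · exact h2.2 i hi
      · exact h.le_refl _ h2.1
  exact ⟨fun i _ j hj hij => key j hj i hij, fun i hi => hl i hi⟩

theorem le_of_forall_le (h : C.IsAEC) {M : Ordinal.{u} → Model L} {δ : Ordinal.{u}} {N : Model L}
    (hδ : Order.IsSuccLimit δ) (hM : C.IncCont M (Iic δ)) (hN : ∀ i < δ, C.le (M i) N) :
    C.le (M δ) N :=
  h.smooth δ M N hδ (hM.mono Iio_subset_Iic_self) hN _ (hM.2 δ self_mem_Iic hδ)

/-- A map which embeds each member of a chain embeds the union. -/
theorem isEmb_limit (h : C.IsAEC) {M : Ordinal.{u} → Model L} {δ : Ordinal.{u}} {N : Model L}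
    (hδ : Order.IsSuccLimit δ) (hM : C.IncCont M (Iic δ)) {f : ZFSet.{u} → ZFSet.{u}}
    (hf : ∀ i < δ, C.IsEmb f (M i) N) : C.IsEmb f (M δ) N := by
  have hU := hM.2 δ self_mem_Iic hδ
  have hinj : InjOn f (M δ).carrier := by
    intro x hx y hy hxy
    obtain ⟨i, hi, hx⟩ := hU.mem_iff.1 hx
    obtain ⟨j, hj, hy⟩ := hU.mem_iff.1 hy
    have hm := max_lt hi hj
    exact (hf _ hm).injOn (h.subset (hM.1 i hi.le _ hm.le (le_max_left _ _)) hx)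
      (h.subset (hM.1 j hj.le _ hm.le (le_max_right _ _)) hy) hxy
  refine isEmb_iff.2 ⟨hinj, ?_⟩
  have h1 : C.IncCont (fun i => Model.map f (M i)) (Iio (Order.succ δ)) :=
    IncCont.map h (hM.mono fun i (hi : i < Order.succ δ) => Order.lt_succ_iff.1 hi)
      fun i hi => hinj.mono (h.subset (hM.1 i (Order.lt_succ_iff.1 hi) δ self_mem_Iic
        (Order.lt_succ_iff.1 hi)))
  exact h.le_of_forall_le hδ (h1.mono fun i (hi : i ≤ δ) => Order.lt_succ_iff.2 hi) fun i hi => (hf i hi).le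

theorem kcard_union (h : C.IsAEC) {κ : Cardinal.{u}} (hκ : Cardinal.aleph0 ≤ κ)
    {M : Ordinal.{u} → Model L} {δ : Ordinal.{u}} (hδ : Order.IsSuccLimit δ)
    (hδκ : δ < (Order.succ κ).ord) (hM : C.IncCont M (Iic δ))
    (hc : ∀ i < δ, C.KCard κ (M i)) : C.KCard κ (M δ) := by
  have hU := hM.2 δ self_mem_Iic hδ
  refine ⟨h.right_mem (hM.1 0 (mem_Iic.2 zero_le) δ self_mem_Iic zero_le), le_antisymm ?_ ?_⟩
  · rw [hU.1, biUnion_eq_iUnion]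
    refine (Cardinal.mk_iUnion_le _).trans ?_
    have h1 : Cardinal.mk (Iio δ) ≤ Cardinal.lift.{u + 1} κ := by
      rw [Cardinal.mk_Iio_ordinal, Cardinal.lift_le]
      exact Order.lt_succ_iff.1 (Cardinal.lt_ord.1 hδκ)
    have h2 : ⨆ i : Iio δ, Cardinal.mk (M i).carrier ≤ Cardinal.lift.{u + 1} κ :=
      ciSup_le' fun i => (hc i i.2).2.le
    refine (mul_le_mul' h1 h2).trans (Cardinal.mul_eq_self ?_).le
    rwa [Cardinal.aleph0_le_lift]
  · rw [← (hc 0 hδ.bot_lt).2]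
    exact Cardinal.mk_le_mk_of_subset (h.subset (hM.1 0 (mem_Iic.2 zero_le) δ self_mem_Iic zero_le))

theorem exists_kcard_between (h : C.IsAEC) {κ : Cardinal.{u}} (hκ : Cardinal.aleph0 ≤ κ)
    (hL : C.LST ≤ κ) {M N : Model L} (hM : C.KCard κ M) (hN : C.K N)
    (hMN : M.carrier ⊆ N.carrier) {A : Set ZFSet.{u}} (hA : A ⊆ N.carrier)
    (hAc : Cardinal.mk A ≤ Cardinal.lift.{u + 1} κ) :
    ∃ P, C.KCard κ P ∧ C.le P N ∧ M.carrier ⊆ P.carrier ∧ A ⊆ P.carrier := by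
  have hL' : C.LSTProp C.LST := csInf_mem (s := {κ | C.LSTProp κ}) h.lst
  obtain ⟨P, hP, hPN, hPc⟩ := hL' N hN (M.carrier ∪ A) (union_subset hMN hA)
  have hκ' : Cardinal.aleph0 ≤ Cardinal.lift.{u + 1} κ := by rwa [Cardinal.aleph0_le_lift]
  have hun : Cardinal.mk ↥(M.carrier ∪ A) ≤ Cardinal.lift.{u + 1} κ :=
    (Cardinal.mk_union_le _ _).trans
      ((add_le_add hM.2.le hAc).trans (Cardinal.add_eq_self hκ').le)
  refine ⟨P, ⟨h.left_mem hPN, le_antisymm ?_ ?_⟩, hPN, subset_union_left.trans hP,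
    subset_union_right.trans hP⟩
  · refine hPc.trans ((add_le_add (Cardinal.lift_le.2 hL) hun).trans
      (Cardinal.add_eq_self hκ').le)
  · rw [← hM.2]
    exact Cardinal.mk_le_mk_of_subset (subset_union_left.trans hP)

/-- Transfinite construction of continuous chains of models together with coherent maps. -/
theorem exists_chain (h : C.IsAEC) {μ ι : Type*} (Λ : Ordinal.{u})
    (dom : ι → Ordinal.{u} → Set ZFSet.{u})
    (hdom : ∀ k i j, i ≤ j → j < Λ → dom k i ⊆ dom k j)
    (J : Ordinal.{u} → (μ → Model L) → (ι → ZFSet.{u} → ZFSet.{u}) → Prop)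
    (Φ : Ordinal.{u} → (μ → Model L) → (ι → ZFSet.{u} → ZFSet.{u}) →
      (μ → Model L) → (ι → ZFSet.{u} → ZFSet.{u}) → Prop)
    (P₀ : μ → Model L) (f₀ : ι → ZFSet.{u} → ZFSet.{u}) (hK : ∀ m, C.K (P₀ m)) (h0 : J 0 P₀ f₀)
    (step : ∀ i P f, Order.succ i < Λ → J i P f → ∃ P' f', (∀ m, C.le (P m) (P' m)) ∧
      (∀ k, EqOn (f k) (f' k) (dom k i)) ∧ Φ i P f P' f' ∧ J (Order.succ i) P' f')
    (lim : ∀ (δ : Ordinal.{u}) (P : Ordinal.{u} → μ → Model L)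
      (f : Ordinal.{u} → ι → ZFSet.{u} → ZFSet.{u}), Order.IsSuccLimit δ → δ < Λ → P 0 = P₀ →
      (∀ i < δ, J i (P i) (f i)) →
      (∀ i < δ, Φ i (P i) (f i) (P (Order.succ i)) (f (Order.succ i))) →
      (∀ k i, i ≤ δ → EqOn (f i k) (f δ k) (dom k i)) →
      (∀ m, C.IncCont (fun i => P i m) (Iic δ)) → J δ (P δ) (f δ)) :
    ∃ (P : Ordinal.{u} → μ → Model L) (f : Ordinal.{u} → ι → ZFSet.{u} → ZFSet.{u}),
      P 0 = P₀ ∧ f 0 = f₀ ∧ (∀ m, C.IncCont (fun i => P i m) (Iio Λ)) ∧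
      (∀ i < Λ, J i (P i) (f i)) ∧
      (∀ i, Order.succ i < Λ → Φ i (P i) (f i) (P (Order.succ i)) (f (Order.succ i))) ∧
      ∀ k i j, i ≤ j → j < Λ → EqOn (f i k) (f j k) (dom k i) := by
  classical
  let G : Ordinal.{u} → (μ → Model L) × (ι → ZFSet.{u} → ZFSet.{u}) →
      (μ → Model L) × (ι → ZFSet.{u} → ZFSet.{u}) → Prop := fun i x y =>
    (∀ m, C.le (x.1 m) (y.1 m)) ∧ (∀ k, EqOn (x.2 k) (y.2 k) (dom k i)) ∧
      Φ i x.1 x.2 y.1 y.2 ∧ J (Order.succ i) y.1 y.2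
  obtain ⟨x, hx0, hxs, hxl⟩ := exists_transfinite_sequence.{u} (P₀, f₀)
    (fun i x => if hy : ∃ y, G i x y then hy.choose else x)
    (fun δ x => (fun m => if hU : ∃ U, Model.IsUnion (fun i => (x i).1 m) δ U then hU.choose
        else P₀ m,
      fun k z => if hz : ∃ i < δ, z ∈ dom k i then (x hz.choose).2 k z else z))
  have hstep : ∀ i, Order.succ i < Λ → J i (x i).1 (x i).2 → G i (x i) (x (Order.succ i)) := by
    intro i hi hJ
    obtain ⟨P', f', h1⟩ := step i _ _ hi hJ
    have hy : ∃ y, G i (x i) y := ⟨(P', f'), h1⟩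
    rw [hxs i, dif_pos hy]
    exact hy.choose_spec
  have key : ∀ j, j < Λ → J j (x j).1 (x j).2 ∧
      (∀ k i, i ≤ j → EqOn ((x i).2 k) ((x j).2 k) (dom k i)) ∧
      (∀ m, C.IncCont (fun i => (x i).1 m) (Iio (Order.succ j))) := by
    intro j
    induction j using Ordinal.limitRecOn with
    | zero =>
      intro _
      refine ⟨hx0 ▸ h0, fun k i hi => ?_, fun m => ?_⟩
      · rw [nonpos_iff_eq_zero.1 hi]
        exact eqOn_refl _ _
      · refine h.incCont_of_steps (by rw [hx0]; exact hK m) ?_ ?_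
        · intro i hi
          exact absurd (Order.lt_succ_iff.1 hi) (not_le.2 (bot_lt_iff_ne_bot.2 (Order.succ_ne_bot i)))
        · intro i hi hli
          exact absurd (Order.lt_succ_iff.1 hi) (not_le.2 hli.bot_lt)
    | add_one j ih =>
      intro hj
      rw [← Order.succ_eq_add_one] at hj ⊢
      obtain ⟨ih1, ih2, ih3⟩ := ih ((Order.lt_succ j).trans hj)
      obtain ⟨g1, g2, g3, g4⟩ := hstep j hj ih1
      refine ⟨g4, fun k i hi => ?_, fun m => ?_⟩
      · rcases hi.lt_or_eq with hi | rfl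
        · have hi := Order.lt_succ_iff.1 hi
          exact (ih2 k i hi).trans ((g2 k).mono (hdom k i j hi ((Order.lt_succ j).trans hj)))
        · exact eqOn_refl _ _
      · refine h.incCont_of_steps (by rw [hx0]; exact hK m) ?_ ?_
        · intro i hi
          have hi := Order.lt_succ_iff.1 hi
          rcases hi.lt_or_eq with hi | hi
          · have hi := Order.lt_succ_iff.1 hi
            exact (ih3 m).1 i ((Order.lt_succ i).trans_le (hi.trans (Order.le_succ j))) _
              (Order.lt_succ_iff.2 hi) (Order.le_succ i)
          · obtain rfl := Order.succ_injective hi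
            exact g1 m
        · intro i hi hli
          rcases (Order.lt_succ_iff.1 hi).lt_or_eq with hi | rfl
          · exact (ih3 m).2 i hi hli
          · exact absurd hli (Order.not_isSuccLimit_succ j)
    | limit j hlj ih =>
      intro hj
      have hinc : ∀ m, C.IncCont (fun i => (x i).1 m) (Iio j) := by
        intro m
        refine ⟨fun a ha b hb hab => ?_, fun a ha hla => ?_⟩
        · exact ((ih b hb (hb.trans hj)).2.2 m).1 a (Order.lt_succ_iff.2 hab) b (Order.lt_succ b) hab
        · exact ((ih a ha (ha.trans hj)).2.2 m).2 a (Order.lt_succ a) hla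
      have hun : ∀ m, Model.IsUnion (fun i => (x i).1 m) j ((x j).1 m) := by
        intro m
        obtain ⟨U, hU⟩ := h.exists_union hlj (hinc m)
        have hex : ∃ U, Model.IsUnion
            (fun i => (if i < j then x i else (P₀, f₀)).1 m) j U :=
          ⟨U, hU.congr fun i hi => by rw [if_pos hi]⟩
        have h1 := hex.choose_spec
        rw [hxl j hlj]
        simp only [dif_pos hex]
        exact h1.congr fun i hi => by rw [if_pos hi]
      have hco : ∀ k i, i ≤ j → EqOn ((x i).2 k) ((x j).2 k) (dom k i) := by
        intro k i hi z hz
        rcases hi.lt_or_eq with hi | rfl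
        · have hex : ∃ i < j, z ∈ dom k i := ⟨i, hi, hz⟩
          rw [hxl j hlj]
          simp only [dif_pos hex, if_pos hex.choose_spec.1]
          obtain ⟨hc1, hc2⟩ := hex.choose_spec
          rcases le_total i hex.choose with hic | hic
          · exact (ih _ hc1 (hc1.trans hj)).2.1 k i hic hz
          · exact ((ih i hi (hi.trans hj)).2.1 k _ hic hc2).symm
        · rfl
      have hinc' : ∀ m, C.IncCont (fun i => (x i).1 m) (Iio (Order.succ j)) := by
        intro m
        refine h.incCont_of_steps (by rw [hx0]; exact hK m) ?_ ?_
        · intro i hi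
          have hi := Order.succ_le_iff.1 (Order.lt_succ_iff.1 hi)
          exact (hinc m).1 i hi _ (hlj.succ_lt hi) (Order.le_succ i)
        · intro i hi hli
          rcases (Order.lt_succ_iff.1 hi).lt_or_eq with hi | rfl
          · exact (hinc m).2 i hi hli
          · exact hun m
      refine ⟨?_, hco, hinc'⟩
      refine lim j (fun i => (x i).1) (fun i => (x i).2) hlj hj (by simp only [hx0])
        (fun i hi => (ih i hi (hi.trans hj)).1) (fun i hi => ?_) hco
        (fun m => (hinc' m).mono fun i (hi : i ≤ j) => Order.lt_succ_iff.2 hi)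
      exact (hstep i ((hlj.succ_lt hi).trans hj) (ih i hi (hi.trans hj)).1).2.2.1
  refine ⟨fun i => (x i).1, fun i => (x i).2, by simp only [hx0], by simp only [hx0], fun m => ?_,
    fun i hi => (key i hi).1, fun i hi => ?_, fun k i j hij hj => (key j hj).2.1 k i hij⟩
  · exact ⟨fun a ha b hb hab => ((key b hb).2.2 m).1 a (Order.lt_succ_iff.2 hab) b
      (Order.lt_succ b) hab, fun a ha hla => ((key a ha).2.2 m).2 a (Order.lt_succ a) hla⟩
  · exact (hstep i hi (key i ((Order.lt_succ i).trans hi)).1).2.2.1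

end IsAEC

end ModelClass

namespace FrameData

variable {L : FirstOrder.Language.{u, u}} {s : FrameData L} {κ : Cardinal.{u}}

namespace IsSemiGoodExceptLocalCharacter

theorem shrink (hs : s.IsSemiGoodExceptLocalCharacter κ) {M N : Model L} (hM : s.KCard κ M)
    (hN : s.K N) (hMN : M.carrier ⊆ N.carrier) {A : Set ZFSet.{u}} (hA : A ⊆ N.carrier)
    (hAc : Cardinal.mk A ≤ Cardinal.lift.{u + 1} κ) :
    ∃ P, s.KCard κ P ∧ s.le P N ∧ M.carrier ⊆ P.carrier ∧ A ⊆ P.carrier :=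
  hs.aec.exists_kcard_between hs.infinite hs.lst_le hM hN hMN hA hAc

theorem shrink_insert (hs : s.IsSemiGoodExceptLocalCharacter κ) {M N : Model L}
    (hM : s.KCard κ M) (hMN : s.le M N) {a : ZFSet.{u}} (ha : a ∈ N.carrier) :
    ∃ P, s.KCard κ P ∧ s.le P N ∧ s.le M P ∧ a ∈ P.carrier := by
  obtain ⟨P, h1, h2, h3, h4⟩ := hs.shrink hM (hs.aec.right_mem hMN) (hs.aec.subset hMN)
    (singleton_subset_iff.2 ha) ((Cardinal.mk_singleton a).le.trans
      (Cardinal.one_lt_aleph0.le.trans (Cardinal.aleph0_le_lift.2 hs.infinite)))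
  exact ⟨P, h1, h2, hs.aec.le_of_subset hMN h2 h3, singleton_subset_iff.1 h4⟩

theorem shrink_pair (hs : s.IsSemiGoodExceptLocalCharacter κ) {M N P : Model L}
    (hM : s.KCard κ M) (hN : s.KCard κ N) (hMP : s.le M P) (hNP : s.le N P) :
    ∃ Q, s.KCard κ Q ∧ s.le Q P ∧ s.le M Q ∧ s.le N Q := by
  obtain ⟨Q, h1, h2, h3, h4⟩ := hs.shrink hM (hs.aec.right_mem hMP) (hs.aec.subset hMP)
    (hs.aec.subset hNP) hN.2.le
  exact ⟨Q, h1, h2, hs.aec.le_of_subset hMP h2 h3, hs.aec.le_of_subset hNP h2 h4⟩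

theorem exists_fresh_injective {f : ZFSet.{u} → ZFSet.{u}} {M : Model L}
    (hf : InjOn f M.carrier) (Y : Set ZFSet.{u}) (hY : Small.{u} Y) :
    ∃ g : ZFSet.{u} → ZFSet.{u}, EqOn g f M.carrier ∧ Function.Injective g ∧
      ∀ x ∉ M.carrier, g x ∉ Y :=
  exists_fresh_extension hf M.small hY

/-- Amalgamation along an embedding. -/
theorem amalg (hs : s.IsSemiGoodExceptLocalCharacter κ) {M₀ M₁ M₂ : Model L}
    {e : ZFSet.{u} → ZFSet.{u}} (h0 : s.KCard κ M₀) (h1 : s.KCard κ M₁) (h2 : s.KCard κ M₂)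
    (he : s.IsEmb e M₀ M₁) (h02 : s.le M₀ M₂) :
    ∃ P f, s.KCard κ P ∧ s.le M₁ P ∧ s.IsEmb f M₂ P ∧ EqOn f e M₀.carrier := by
  obtain ⟨e', he', hinj, -⟩ := exists_fresh_injective he.injOn ∅ (small_empty)
  have hmap : Model.map e' M₀ = Model.map e M₀ := Model.map_congr hinj.injOn he'
  have h02' := hs.aec.map_le h02 (f := e') hinj.injOn
  rw [hmap] at h02'
  obtain ⟨f₁, f₂, M₃, hM₃, ⟨hf₁, hid₁⟩, ⟨hf₂, hid₂⟩⟩ := hs.amalgamation (Model.map e M₀) M₁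
    (Model.map e' M₂) (hs.aec.map_kcard h0 he.injOn) h1 (hs.aec.map_kcard h2 hinj.injOn) he.le h02'
  obtain ⟨g, hg, hgf, hle, -⟩ := hs.aec.exists_rename hf₁ ∅ small_empty
  refine ⟨Model.map g M₃, g ∘ f₂ ∘ e', hs.aec.map_kcard hM₃ hg.injOn, hle, ?_, ?_⟩
  · exact hs.aec.emb_comp (hs.aec.emb_comp (hs.aec.isEmb_map h2.1 hinj.injOn) hf₂)
      (hs.aec.isEmb_map hM₃.1 hg.injOn)
  · intro x hx
    have hex : e x ∈ (Model.map e M₀).carrier := ⟨x, hx, rfl⟩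
    have h3 := hgf (e x) (hs.aec.subset he.le hex)
    rw [hid₁ _ hex] at h3
    simp only [Function.comp, he' hx, hid₂ _ hex, h3]

end IsSemiGoodExceptLocalCharacter

end FrameData

namespace ModelClass

variable {L : FirstOrder.Language.{u, u}} {C : ModelClass L}

theorem eStar_symm (h : C.IsAEC) {t t' : Triple L} (htt' : C.EStar t t') : C.EStar t' t := by
  obtain ⟨h1, h2, h3, N, f, h4, ⟨h5, h6⟩, h7⟩ := htt'
  obtain ⟨g, hg, hgf, hle, -⟩ := h.exists_rename h5 ∅ small_empty
  have hgM : ∀ x ∈ t.M.carrier, g x = x := fun x hx => by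
    have := hgf x (h.subset h1.1 hx)
    rwa [h6 x hx] at this
  refine ⟨h2, h1, h3.symm, Model.map g N, g, hle, ⟨?_, ?_⟩, ?_⟩
  · exact h.emb_of_le (h.isEmb_map (h.right_mem h4) hg.injOn) h4
  · rw [← h3]
    exact hgM
  · rw [← h7]
    exact hgf _ h1.2

theorem eStar_refl (h : C.IsAEC) {t : Triple L} (ht : C.K3 t) : C.EStar t t :=
  ⟨ht, ht, rfl, t.N, id, h.refl_right ht.1, ⟨isEmb_of_le (h.refl_right ht.1) fun _ _ => rfl,
    fun _ _ => rfl⟩, rfl⟩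

theorem e_symm (h : C.IsAEC) {t t' : Triple L} (htt' : C.E t t') : C.E t' t := by
  induction htt' with
  | single h1 => exact .single (eStar_symm h h1)
  | tail _ h2 ih => exact .head (eStar_symm h h2) ih

theorem E.left_mem {t t' : Triple L} (htt' : C.E t t') : C.K3 t := by
  induction htt' with
  | single h1 => exact h1.1
  | tail _ _ ih => exact ih

theorem E.right_mem {t t' : Triple L} (htt' : C.E t t') : C.K3 t' := by
  cases htt' with
  | single h1 => exact h1.2.1
  | tail _ h1 => exact h1.2.1

theorem E.base_eq {t t' : Triple L} (htt' : C.E t t') : t.M = t'.M := by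
  induction htt' with
  | single h1 => exact h1.2.2.1
  | tail _ h2 ih => exact ih.trans h2.2.2.1

theorem tp_eq_of_e (h : C.IsAEC) {M N M' N' : Model L} {a b : ZFSet.{u}}
    (hE : C.E ⟨M, N, a⟩ ⟨M', N', b⟩) : C.tp a M N = C.tp b M' N' := by
  ext t
  exact ⟨fun ht => Relation.TransGen.trans (e_symm h hE) ht, fun ht => Relation.TransGen.trans hE ht⟩

theorem e_of_tp_eq (h : C.IsAEC) {M N M' N' : Model L} {a b : ZFSet.{u}}
    (ht : C.tp a M N = C.tp b M' N') (hM : C.le M' N') (hb : b ∈ N'.carrier) :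
    C.E ⟨M, N, a⟩ ⟨M', N', b⟩ := by
  have : (⟨M', N', b⟩ : Triple L) ∈ C.tp b M' N' := .single (eStar_refl h ⟨hM, hb⟩)
  rw [← ht] at this
  exact this

theorem tp_emb (h : C.IsAEC) {M N P : Model L} {a : ZFSet.{u}} {f : ZFSet.{u} → ZFSet.{u}}
    (hMN : C.le M N) (ha : a ∈ N.carrier) (hf : C.IsEmb f N P) (hid : ∀ x ∈ M.carrier, f x = x) :
    C.tp (f a) M P = C.tp a M N := by
  refine (tp_eq_of_e h (.single ⟨⟨hMN, ha⟩, ⟨?_, h.emb_mem hf ha⟩, rfl, P, f,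
    h.refl_right hf.le, ⟨hf, hid⟩, rfl⟩)).symm
  have := (h.emb_of_le hf hMN).le
  rwa [Model.map_of_eqOn_id hid] at this

theorem tp_le (h : C.IsAEC) {M N P : Model L} {a : ZFSet.{u}}
    (hMN : C.le M N) (ha : a ∈ N.carrier) (hNP : C.le N P) : C.tp a M P = C.tp a M N :=
  tp_emb h hMN ha (isEmb_of_le (f := id) hNP fun _ _ => rfl) fun _ _ => rfl

theorem E.mem_base {t t' : Triple L} (htt' : C.E t t') (ha : t.a ∈ t.M.carrier) :
    t'.a ∈ t'.M.carrier := by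
  have key : ∀ t t' : Triple L, C.EStar t t' → t.a ∈ t.M.carrier → t'.a ∈ t'.M.carrier := by
    rintro t t' ⟨h1, h2, h3, N, f, h4, ⟨h5, h6⟩, h7⟩ ha
    rw [← h7, h6 _ ha, ← h3]
    exact ha
  induction htt' with
  | single h1 => exact key _ _ h1 ha
  | tail _ h2 ih => exact key _ _ h2 ih

end ModelClass

namespace FrameData

variable {L : FirstOrder.Language.{u, u}} {s : FrameData L} {κ : Cardinal.{u}}

open ModelClass

namespace IsSemiGoodExceptLocalCharacter

/-- Equal types over a model in `K_κ` are realized by identified elements of an amalgam. -/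
theorem amalg_of_tp_eq (hs : s.IsSemiGoodExceptLocalCharacter κ) {M N N' : Model L}
    {a b : ZFSet.{u}} (hM : s.KCard κ M) (hN : s.KCard κ N) (hN' : s.KCard κ N')
    (hMN : s.le M N) (hMN' : s.le M N') (ha : a ∈ N.carrier) (hb : b ∈ N'.carrier)
    (ht : s.tp a M N = s.tp b M N') :
    ∃ P f, s.KCard κ P ∧ s.le N' P ∧ s.IsEmb f N P ∧ (∀ x ∈ M.carrier, f x = x) ∧ f a = b := by
  have hE := e_of_tp_eq hs.aec ht hMN' hb
  have h := hs.aec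
  have one : ∀ t t' : Triple L, s.EStar t t' → ∀ N₀ N₀', t.M = M → s.KCard κ N₀ → s.KCard κ N₀' →
      s.le M N₀ → s.le M N₀' → s.le N₀ t.N → s.le N₀' t'.N → t.a ∈ N₀.carrier → t'.a ∈ N₀'.carrier →
      ∃ P f, s.KCard κ P ∧ s.le N₀' P ∧ s.IsEmb f N₀ P ∧ (∀ x ∈ M.carrier, f x = x) ∧
        f t.a = t'.a := by
    rintro t t' ⟨h1, h2, h3, Q, f, h4, ⟨h5, h6⟩, h7⟩ N₀ N₀' htM hN₀ hN₀' hM hM' hle hle' ha hb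
    have hf := h.emb_of_le h5 hle
    obtain ⟨P, p1, p2, p3, p4⟩ := hs.shrink_pair hN₀' (h.map_kcard hN₀ hf.injOn) (h.trans hle' h4)
      hf.le
    exact ⟨P, f, p1, p3, isEmb_iff.2 ⟨hf.injOn, p4⟩, htM ▸ h6, h7⟩
  have key : ∀ t t' : Triple L, s.E t t' → ∀ N₀ N₀', t.M = M → s.KCard κ N₀ → s.KCard κ N₀' →
      s.le M N₀ → s.le M N₀' → s.le N₀ t.N → s.le N₀' t'.N → t.a ∈ N₀.carrier → t'.a ∈ N₀'.carrier →
      ∃ P f, s.KCard κ P ∧ s.le N₀' P ∧ s.IsEmb f N₀ P ∧ (∀ x ∈ M.carrier, f x = x) ∧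
        f t.a = t'.a := by
    intro t t' hE
    induction hE with
    | single h1 => exact one _ _ h1
    | @tail m t' htm h2 ih =>
      intro N₀ N₀' htM hN₀ hN₀' hM₁ hM₁' hle hle' ha hb
      have hmM : m.M = M := (E.base_eq htm).symm.trans htM
      obtain ⟨Nm, m1, m2, m3, m4⟩ := hs.shrink_insert hM (hmM ▸ (E.right_mem htm).1)
        (E.right_mem htm).2
      obtain ⟨P₁, f₁, p1, p2, p3, p4, p5⟩ := ih N₀ Nm htM hN₀ m1 hM₁ m3 hle m2 ha m4
      obtain ⟨P₂, f₂, q1, q2, q3, q4, q5⟩ := one _ _ h2 Nm N₀' hmM m1 hN₀' m3 hM₁' m2 hle' m4 hb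
      obtain ⟨P, g, r1, r2, r3, r4⟩ := hs.amalg m1 q1 p1 q3 p2
      refine ⟨P, g ∘ f₁, r1, h.trans q2 r2, h.emb_comp p3 r3, fun x hx => ?_, ?_⟩
      · rw [Function.comp, p4 x hx, r4 (h.subset m3 hx), q4 x hx]
      · rw [Function.comp, p5, r4 m4, q5]
  exact key _ _ hE N N' rfl hN hN' hMN hMN' (h.refl_right hMN) (h.refl_right hMN') ha hb

theorem basic_mem (hs : s.IsSemiGoodExceptLocalCharacter κ) {M N : Model L} {a : ZFSet.{u}}
    (hM : s.KCard κ M) (h : s.tp a M N ∈ s.Sbs M) : s.le M N ∧ a ∈ N.carrier ∧ a ∉ M.carrier := by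
  obtain ⟨N', b, -, h1, h2, h3, h4⟩ := hs.basic_nonalg M hM _ h
  have hE := e_of_tp_eq hs.aec h4 h1.1 h2
  exact ⟨(E.left_mem hE).1, (E.left_mem hE).2, fun ha => h3 (E.mem_base hE ha)⟩

theorem exists_lt (hs : s.IsSemiGoodExceptLocalCharacter κ) {M : Model L} (hM : s.KCard κ M) :
    ∃ N, s.KCard κ N ∧ s.lt M N := by
  obtain ⟨N, h1, h2⟩ := hs.no_maximal M hM
  have h3 : ¬ N.carrier ⊆ M.carrier := fun hsub => h2 (hs.aec.eq_of_subset h1 hsub)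
  obtain ⟨x, hx, hxM⟩ := not_subset.1 h3
  obtain ⟨P, p1, p2, p3, p4⟩ := hs.shrink_insert hM h1 hx
  exact ⟨P, p1, p3, fun he => hxM (he ▸ p4)⟩

theorem nf_up (hs : s.IsSemiGoodExceptLocalCharacter κ) {M₀ M₁ N P : Model L} {a : ZFSet.{u}}
    (h : s.nf M₀ M₁ a N) (hNP : s.le N P) : s.nf M₀ M₁ a P := by
  obtain ⟨-, -, -, h1, h2, h3, -⟩ := hs.nf_sub _ _ _ _ h
  refine hs.nf_mono M₀ M₀ M₁ M₁ N P P a (hs.aec.refl_left h1) h1 (hs.aec.refl_right h1) h2 hNP ?_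
    (hs.aec.refl_right hNP) h
  exact union_subset (hs.aec.subset (hs.aec.trans h2 hNP))
    (singleton_subset_iff.2 (hs.aec.subset hNP h3))

theorem nf_down (hs : s.IsSemiGoodExceptLocalCharacter κ) {M₀ M₁ N P : Model L} {a : ZFSet.{u}}
    (h : s.nf M₀ M₁ a P) (hNP : s.le N P) (hM : s.le M₁ N) (ha : a ∈ N.carrier) :
    s.nf M₀ M₁ a N := by
  obtain ⟨-, -, -, h1, h2, h3, -⟩ := hs.nf_sub _ _ _ _ h
  exact hs.nf_mono M₀ M₀ M₁ M₁ P N P a (hs.aec.refl_left h1) h1 (hs.aec.refl_right h1) h2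
    (hs.aec.refl_right hNP) (union_subset (hs.aec.subset hM) (singleton_subset_iff.2 ha)) hNP h

theorem nf_base (hs : s.IsSemiGoodExceptLocalCharacter κ) {M₀ N₀ N₁ M₁ P : Model L}
    {a : ZFSet.{u}} (h : s.nf M₀ M₁ a P) (h1 : s.le M₀ N₀) (h2 : s.le N₀ N₁) (h3 : s.le N₁ M₁) :
    s.nf N₀ N₁ a P := by
  obtain ⟨-, -, -, -, h5, h6, -⟩ := hs.nf_sub _ _ _ _ h
  exact hs.nf_mono M₀ N₀ N₁ M₁ P P P a h1 h2 h3 h5 (hs.aec.refl_right h5)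
    (union_subset (hs.aec.subset (hs.aec.trans h3 h5)) (singleton_subset_iff.2 h6))
    (hs.aec.refl_right h5) h

theorem nf_emb (hs : s.IsSemiGoodExceptLocalCharacter κ) {M₀ M₁ N P : Model L} {a : ZFSet.{u}}
    {f : ZFSet.{u} → ZFSet.{u}} (h : s.nf M₀ M₁ a N) (hf : s.IsEmb f N P) :
    s.nf (Model.map f M₀) (Model.map f M₁) (f a) P := by
  obtain ⟨-, -, -, h1, h2, h3, -⟩ := hs.nf_sub _ _ _ _ h
  have i1 := hf.injOn.mono (hs.aec.subset h2)
  exact hs.nf_up (hs.nf_iso f _ _ a _ _ _ _ h (Model.isIso_map hf.injOn)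
    (Model.isIso_map (i1.mono (hs.aec.subset h1))) (Model.isIso_map i1)) hf.le

theorem nf_map (hs : s.IsSemiGoodExceptLocalCharacter κ) {M₀ M₁ N : Model L} {a : ZFSet.{u}}
    {f : ZFSet.{u} → ZFSet.{u}} (h : s.nf M₀ M₁ a N) (hf : InjOn f N.carrier) :
    s.nf (Model.map f M₀) (Model.map f M₁) (f a) (Model.map f N) :=
  hs.nf_emb h (hs.aec.isEmb_map (hs.nf_sub _ _ _ _ h).2.2.1 hf)

theorem nf_emb_over (hs : s.IsSemiGoodExceptLocalCharacter κ) {M₀ M₁ N P : Model L}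
    {a : ZFSet.{u}} {f : ZFSet.{u} → ZFSet.{u}} (h : s.nf M₀ M₁ a N) (hf : s.IsEmb f N P)
    (hid : ∀ x ∈ M₁.carrier, f x = x) : s.nf M₀ M₁ (f a) P := by
  obtain ⟨-, -, -, h1, -⟩ := hs.nf_sub _ _ _ _ h
  have h2 := hs.nf_emb h hf
  rwa [Model.map_of_eqOn_id hid,
    Model.map_of_eqOn_id fun x hx => hid x (hs.aec.subset h1 hx)] at h2

/-- Non-forking depends only on the type. -/
theorem nf_congr (hs : s.IsSemiGoodExceptLocalCharacter κ) {M₀ M₁ N N' : Model L}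
    {a b : ZFSet.{u}} (h : s.nf M₀ M₁ a N) (hN' : s.le M₁ N') (hb : b ∈ N'.carrier)
    (ht : s.tp a M₁ N = s.tp b M₁ N') : s.nf M₀ M₁ b N' := by
  have hE := e_of_tp_eq hs.aec ht hN' hb
  have one : ∀ t t' : Triple L, s.EStar t t' → s.nf M₀ t.M t.a t.N → s.nf M₀ t'.M t'.a t'.N := by
    rintro t t' ⟨h1, h2, h3, Q, f, h4, ⟨h5, h6⟩, h7⟩ hn
    have := hs.nf_emb_over hn h5 h6
    rw [h7, h3] at this
    exact hs.nf_down this h4 h2.1 h2.2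
  have key : ∀ t t' : Triple L, s.E t t' → s.nf M₀ t.M t.a t.N → s.nf M₀ t'.M t'.a t'.N := by
    intro t t' hE hn
    induction hE with
    | single h1 => exact one _ _ h1 hn
    | tail _ h2 ih => exact one _ _ h2 ih
  exact key _ _ hE h

theorem nf_refl (hs : s.IsSemiGoodExceptLocalCharacter κ) {M N : Model L} {a : ZFSet.{u}}
    (hM : s.KCard κ M) (h : s.tp a M N ∈ s.Sbs M) : s.nf M M a N := by
  obtain ⟨M', hM', hlt⟩ := hs.exists_lt hM
  obtain ⟨b, N', h1, h2⟩ := hs.nf_exists M M' hM hM' hlt _ h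
  obtain ⟨h3, h4, -⟩ := hs.basic_mem hM h
  exact hs.nf_congr (hs.nf_base h1 (hs.aec.refl_left h3) (hs.aec.refl_left h3) hlt.1) h3 h4 h2

/-- A non-forking type extends to a non-forking type over any larger model. -/
theorem nf_extend (hs : s.IsSemiGoodExceptLocalCharacter κ) {M₀ M₁ M₂ N : Model L}
    {a : ZFSet.{u}} (h : s.nf M₀ M₁ a N) (hN : s.KCard κ N) (h12 : s.le M₁ M₂)
    (h2 : s.KCard κ M₂) :
    ∃ P f, s.KCard κ P ∧ s.le M₂ P ∧ s.IsEmb f N P ∧ (∀ x ∈ M₁.carrier, f x = x) ∧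
      s.nf M₀ M₂ (f a) P := by
  obtain ⟨k0, k1, k3, h01, h1N, haN, -, hb0, hb1⟩ := hs.nf_sub _ _ _ _ h
  by_cases heq : M₀ = M₂
  · subst heq
    obtain rfl := hs.aec.antisymm h01 h12
    exact ⟨N, id, hN, h1N, isEmb_of_le (hs.aec.refl_right h1N) fun _ _ => rfl, fun _ _ => rfl, h⟩
  · obtain ⟨b, N', q1, q2⟩ := hs.nf_exists M₀ M₂ k0 h2 ⟨hs.aec.trans h01 h12, heq⟩ _ hb0
    obtain ⟨-, -, -, h02, h2N', hbN', -⟩ := hs.nf_sub _ _ _ _ q1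
    obtain ⟨N₁, n1, n2, n3, n4⟩ := hs.shrink_insert h2 h2N' hbN'
    have q3 := hs.nf_down q1 n2 n3 n4
    have q4 := hs.nf_base q3 (hs.aec.refl_left h01) h01 h12
    have q5 : s.tp b M₀ N₁ = s.tp a M₀ N := by
      rw [← q2, tp_le hs.aec (hs.aec.trans h02 n3) n4 n2]
    have q6 := hs.nf_unique _ _ _ _ _ _ h q4 q5.symm
    obtain ⟨P, f, p1, p2, p3, p4, p5⟩ := hs.amalg_of_tp_eq k1 hN n1 h1N
      (hs.aec.trans h12 n3) haN n4 q6
    exact ⟨P, f, p1, hs.aec.trans n3 p2, p3, p4, p5 ▸ hs.nf_up q3 p2⟩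

theorem nf_trans (hs : s.IsSemiGoodExceptLocalCharacter κ) {M₀ M₁ M₂ N : Model L}
    {a : ZFSet.{u}} (h : s.nf M₀ M₁ a N) (h' : s.nf M₁ M₂ a N) : s.nf M₀ M₂ a N := by
  obtain ⟨k0, k1, -, h01, h1N, haN, -⟩ := hs.nf_sub _ _ _ _ h
  obtain ⟨-, k2, -, h12, h2N, -⟩ := hs.nf_sub _ _ _ _ h'
  obtain ⟨N₁, n1, n2, n3, n4⟩ := hs.shrink_insert k2 h2N haN
  have h1N₁ := hs.aec.trans h12 n3
  have q := hs.nf_down h n2 h1N₁ n4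
  have q' := hs.nf_down h' n2 n3 n4
  obtain ⟨P, f, p1, p2, p3, p4, p5⟩ := hs.nf_extend q n1 h12 k2
  have q1 := hs.nf_base p5 h01 h12 (hs.aec.refl_right h12)
  have q2 := hs.nf_unique _ _ _ _ _ _ q1 q' (tp_emb hs.aec h1N₁ n4 p3 p4)
  exact hs.nf_up (hs.nf_congr p5 n3 n4 q2) n2

/-- Two basic types over `M₀` can be realized symmetrically independently. -/
theorem symmetric_amalg (hs : s.IsSemiGoodExceptLocalCharacter κ) {M₀ M₁ M₂ : Model L}
    {a₁ a₂ : ZFSet.{u}} (h1 : s.K3bs κ M₀ M₁ a₁) (h2 : s.K3bs κ M₀ M₂ a₂) :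
    ∃ P f, s.KCard κ P ∧ s.le M₁ P ∧ s.IsEmb f M₂ P ∧ (∀ x ∈ M₀.carrier, f x = x) ∧
      s.nf M₀ (Model.map f M₂) a₁ P ∧ s.nf M₀ M₁ (f a₂) P := by
  have h := hs.aec
  obtain ⟨k0, k1, h01, ha1, -, hb1⟩ := h1
  obtain ⟨-, k2, h02, ha2, -, hb2⟩ := h2
  obtain ⟨M₃, f, p1, p2, p3, p4, p5⟩ := hs.nf_extend (hs.nf_refl k0 hb2) k2 h01 k1
  obtain ⟨N₂, P, q1, q2, q3, q4, q5⟩ := hs.nf_symm M₀ M₁ M₃ a₁ (f a₂) h01 p2 ha1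
    (by rwa [tp_le h h01 ha1 p2]) p5
  have kN₂ := (hs.nf_sub _ _ _ _ q5).2.1
  obtain ⟨P', r1, r2, r3, r4⟩ := hs.shrink_pair p1 kN₂ q4 q3
  have q6 := hs.nf_down q5 r2 r4 (h.subset (h.trans p2 r3) ha1)
  have hty : s.tp a₂ M₀ M₂ = s.tp (f a₂) M₀ N₂ := by
    rw [← tp_le h q2 q1 r4, ← tp_emb h h02 ha2 p3 p4, tp_le h _ (h.emb_mem p3 ha2) r3]
    exact h.trans h01 p2
  obtain ⟨N, e, n1, n2, n3, n4, n5⟩ := hs.amalg_of_tp_eq k0 k2 kN₂ h02 q2 ha2 q1 hty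
  obtain ⟨Q, k, t1, t2, t3, t4, t5⟩ := hs.nf_extend q6 r1 n2 n1
  obtain ⟨g, hg, hgk, hle, -⟩ := h.exists_rename t3 ∅ small_empty
  have hgN₂ : ∀ x ∈ N₂.carrier, g x = x := fun x hx => by
    have := hgk x (h.subset r4 hx)
    rwa [t4 x hx] at this
  have hgM₀ : ∀ x ∈ M₀.carrier, g x = x := fun x hx => hgN₂ x (h.subset q2 hx)
  have hN : s.IsEmb g N (Model.map g N) := h.isEmb_map n1.1 hg.injOn
  have hQ : s.le (Model.map g N) (Model.map g Q) := h.map_le t2 hg.injOn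
  have hge := h.emb_comp n3 hN
  refine ⟨Model.map g Q, g ∘ e, h.map_kcard t1 hg.injOn, h.trans (h.trans p2 r3) hle,
    h.emb_trans_le hge hQ, fun x hx => ?_, ?_, ?_⟩
  · rw [Function.comp, n4 x hx, hgM₀ x hx]
  · have u1 := hs.nf_map t5 (hg.injOn)
    rw [hgk a₁ (h.subset (h.trans p2 r3) ha1), Model.map_of_eqOn_id hgM₀] at u1
    refine hs.nf_base u1 (h.refl_left h01) ?_ hge.le
    exact h.le_map_of_id h02 hge.injOn fun x hx => (congrArg g (n4 x hx)).trans (hgM₀ x hx)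
  · rw [Function.comp, n5, hgN₂ _ q1]
    exact hs.nf_up p5 (h.trans r3 hle)

end IsSemiGoodExceptLocalCharacter

end FrameData

/-- A continuous chain of sets of size at most `κ`, indexed by `κ⁺`, catches up with any other
chain of sets. -/
theorem exists_catch_up {κ : Cardinal.{u}} (hκ : Cardinal.aleph0 ≤ κ)
    {S T : Ordinal.{u} → Set ZFSet.{u}} {Λ : Ordinal.{u}} (hΛ : Λ = (Order.succ κ).ord)
    (hS : ∀ i j, i ≤ j → j < Λ → S i ⊆ S j) (hT : ∀ i j, i ≤ j → j < Λ → T i ⊆ T j)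
    (hTl : ∀ i < Λ, Order.IsSuccLimit i → ∀ x ∈ T i, ∃ j < i, x ∈ T j)
    (hc : ∀ i < Λ, Cardinal.mk (T i) ≤ Cardinal.lift.{u + 1} κ) (hsm : ∀ i < Λ, Small.{u} (T i)) :
    ∃ i < Λ, ∀ x ∈ T i, ∀ j < Λ, x ∈ S j → x ∈ S i := by
  have hreg := Cardinal.isRegular_succ hκ
  have hcof : Λ.cof = Order.succ κ := by rw [hΛ, hreg.cof_ord]
  have hlim : Order.IsSuccLimit Λ := by
    rw [hΛ]
    exact Cardinal.isSuccLimit_ord (hκ.trans (Order.le_succ κ))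
  let r : ZFSet.{u} → Ordinal.{u} := fun x => sInf {j | j < Λ ∧ x ∈ S j}
  let D : Ordinal.{u} → Set ZFSet.{u} := fun i => {x | x ∈ T i ∧ ∃ j < Λ, x ∈ S j}
  have hr : ∀ i, ∀ x ∈ D i, r x < Λ ∧ x ∈ S (r x) := fun i x hx =>
    csInf_mem (s := {j | j < Λ ∧ x ∈ S j}) hx.2
  let g : Ordinal.{u} → Ordinal.{u} := fun i => ⨆ x : D i, r x
  have hDsm : ∀ i < Λ, Small.{u} (D i) := fun i hi => by
    have := hsm i hi
    exact small_subset (fun x hx => hx.1 : D i ⊆ T i)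
  have hg : ∀ i < Λ, g i < Λ := by
    intro i hi
    refine Ordinal.lift_iSup_lt_of_lt_cof ?_ fun x => (hr i x x.2).1
    rw [← Ordinal.lift_cof, hcof, Cardinal.lift_id'.{u, u + 1}]
    refine (Cardinal.mk_le_mk_of_subset (fun x hx => hx.1 : D i ⊆ T i)).trans_lt
      ((hc i hi).trans_lt ?_)
    exact Cardinal.lift_lt.2 (Order.lt_succ κ)
  have hle : ∀ i < Λ, ∀ x ∈ D i, r x ≤ g i := by
    intro i hi x hx
    have := hDsm i hi
    exact Ordinal.le_iSup (fun x : D i => r x) ⟨x, hx⟩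
  let f : Ordinal.{u} → Ordinal.{u} := fun i => Order.succ (max i (g i))
  have hf : ∀ i < Λ, f i < Λ := fun i hi => hlim.succ_lt (max_lt hi (hg i hi))
  have hδ : Ordinal.nfp f 0 < Λ := by
    refine Ordinal.nfp_lt_ord ?_ hf hlim.bot_lt
    rw [hcof]
    exact hκ.trans_lt (Order.lt_succ κ)
  have hit : ∀ n : ℕ, f^[n] 0 < Ordinal.nfp f 0 := fun n => by
    refine lt_of_lt_of_le ?_ (Ordinal.iterate_le_nfp f 0 (n + 1))
    rw [Function.iterate_succ_apply']
    exact Order.lt_succ_iff.2 (le_max_left _ _)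
  have hδl : Order.IsSuccLimit (Ordinal.nfp f 0) := by
    refine ⟨?_, Order.isSuccPrelimit_of_succ_lt fun a ha => ?_⟩
    · rw [isMin_iff_eq_bot]
      exact ((zero_le).trans_lt (hit 0)).ne'
    · obtain ⟨n, hn⟩ := Ordinal.lt_nfp_iff.1 ha
      exact (Order.succ_le_of_lt hn).trans_lt (hit n)
  refine ⟨_, hδ, fun x hx j hj hxj => ?_⟩
  obtain ⟨i, hi, hxi⟩ := hTl _ hδ hδl x hx
  obtain ⟨n, hn⟩ := Ordinal.lt_nfp_iff.1 hi
  have hnΛ := (hit n).trans hδ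
  have hxD : x ∈ D (f^[n] 0) := ⟨hT _ _ hn.le hnΛ hxi, j, hj, hxj⟩
  refine hS _ _ ?_ hδ (hr _ x hxD).2
  have h1 := (hit (n + 1)).le
  rw [Function.iterate_succ_apply'] at h1
  exact ((hle _ hnΛ x hxD).trans ((le_max_right _ _).trans (Order.le_succ _))).trans h1

namespace FrameData

variable {L : FirstOrder.Language.{u, u}} {s : FrameData L} {κ : Cardinal.{u}}

open ModelClass

/-- The triple `(M, N, a)` is reduced: its non-forking extensions are disjoint. -/
def Reduced (s : FrameData L) (κ : Cardinal.{u}) (M N : Model L) (a : ZFSet.{u}) : Prop :=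
  s.K3bs κ M N a ∧ ∀ M' N', s.KCard κ N' → s.le N N' → s.nf M M' a N' →
    ∀ x ∈ M'.carrier, x ∈ N.carrier → x ∈ M.carrier

/-- A decomposition `⟨A i : i ≤ α⟩` by triples in the class `Q`. -/
def Decomp (s : FrameData L) (κ : Cardinal.{u}) (Q : Model L → Model L → ZFSet.{u} → Prop)
    (A : Ordinal.{u} → Model L) (d : Ordinal.{u} → ZFSet.{u}) (α : Ordinal.{u}) : Prop :=
  α < (Order.succ κ).ord ∧ s.IncCont A (Iic α) ∧ (∀ i ≤ α, s.KCard κ (A i)) ∧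
    ∀ i < α, Q (A i) (A (Order.succ i)) (d i)

/-- `B` lifts the sequence `A` without forking. -/
def Lift (s : FrameData L) (κ : Cardinal.{u}) (A : Ordinal.{u} → Model L)
    (d : Ordinal.{u} → ZFSet.{u}) (α : Ordinal.{u}) (B : Ordinal.{u} → Model L) : Prop :=
  s.IncCont B (Iic α) ∧ (∀ i ≤ α, s.KCard κ (B i)) ∧ (∀ i ≤ α, s.le (A i) (B i)) ∧
    ∀ i < α, s.nf (A i) (B i) (d i) (B (Order.succ i))

namespace IsSemiGoodExceptLocalCharacter

theorem K3bs_of_nf (hs : s.IsSemiGoodExceptLocalCharacter κ) {M M' N : Model L} {a : ZFSet.{u}}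
    (h : s.nf M M' a N) (hN : s.KCard κ N) : s.K3bs κ M' N a := by
  obtain ⟨-, h1, -, -, h2, h3, h4, -, h5⟩ := hs.nf_sub _ _ _ _ h
  exact ⟨h1, hN, h2, h3, h4, h5⟩

theorem K3bs_map (hs : s.IsSemiGoodExceptLocalCharacter κ) {M N : Model L} {a : ZFSet.{u}}
    {f : ZFSet.{u} → ZFSet.{u}} (h : s.K3bs κ M N a) (hf : InjOn f N.carrier) :
    s.K3bs κ (Model.map f M) (Model.map f N) (f a) := by
  obtain ⟨h1, h2, h3, h4, h5, h6⟩ := h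
  have hfM := hf.mono (hs.aec.subset h3)
  refine ⟨hs.aec.map_kcard h1 hfM, hs.aec.map_kcard h2 hf, hs.aec.map_le h3 hf, ⟨a, h4, rfl⟩, ?_,
    hs.basic_iso f M N _ _ a h1 h3 h6 (Model.isIso_map hf) (Model.isIso_map hfM)⟩
  rintro ⟨b, hb, hba⟩
  exact h5 (hf (hs.aec.subset h3 hb) h4 hba ▸ hb)

theorem K3bs_of_tp_eq (hs : s.IsSemiGoodExceptLocalCharacter κ) {M N : Model L} {a : ZFSet.{u}}
    (hM : s.KCard κ M) (hN : s.KCard κ N) (h : s.tp a M N ∈ s.Sbs M) : s.K3bs κ M N a := by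
  obtain ⟨h1, h2, h3⟩ := hs.basic_mem hM h
  exact ⟨hM, hN, h1, h2, h3, h⟩

theorem reduced_map (hs : s.IsSemiGoodExceptLocalCharacter κ) {M N : Model L} {a : ZFSet.{u}}
    {f : ZFSet.{u} → ZFSet.{u}} (h : s.Reduced κ M N a) (hf : InjOn f N.carrier) :
    s.Reduced κ (Model.map f M) (Model.map f N) (f a) := by
  have hMN := h.1.2.2.1
  have haN := h.1.2.2.2.1
  refine ⟨hs.K3bs_map h.1 hf, ?_⟩
  rintro M' N' hN' hle hnf _ hxM' ⟨x, hx, rfl⟩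
  have hemb : s.IsEmb f N N' := isEmb_iff.2 ⟨hf, hle⟩
  obtain ⟨g, hg, hgf, hle', -⟩ := hs.aec.exists_rename hemb ∅ small_empty
  have h1 := hs.nf_map hnf (hg.injOn (s := N'.carrier))
  rw [hgf a haN, Model.map_map_of_leftInv fun y hy => hgf y (hs.aec.subset hMN hy)] at h1
  refine ⟨x, h.2 _ _ (hs.aec.map_kcard hN' hg.injOn) hle' h1 x ?_ hx, rfl⟩
  exact ⟨f x, hxM', hgf x hx⟩

theorem exists_reduced_extension (hs : s.IsSemiGoodExceptLocalCharacter κ) {M N : Model L}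
    {a : ZFSet.{u}} (h : s.K3bs κ M N a) :
    ∃ M' N', s.le N N' ∧ s.nf M M' a N' ∧ s.Reduced κ M' N' a := by
  by_contra hcon
  push Not at hcon
  have hA := hs.aec
  obtain ⟨k0, k1, h01, ha, haM, hb⟩ := h
  set Λ := (Order.succ κ).ord with hΛ
  have hΛlim : Order.IsSuccLimit Λ :=
    Cardinal.isSuccLimit_ord (hs.infinite.trans (Order.le_succ κ))
  obtain ⟨P, -, hP0, -, hinc, hJ, hΦ, -⟩ := hA.exists_chain (μ := Bool) (ι := Empty) Λ
    (fun k _ => k.elim) (fun k => k.elim)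
    (fun _ P _ => s.KCard κ (P false) ∧ s.KCard κ (P true) ∧ s.le N (P true) ∧
      s.nf M (P false) a (P true))
    (fun _ P _ P' _ => ∃ x ∈ (P true).carrier, x ∈ (P' false).carrier ∧ x ∉ (P false).carrier)
    (fun b => bif b then N else M) (fun k => k.elim)
    (by rintro (_ | _); exacts [k0.1, k1.1])
    ⟨k0, k1, hA.refl_left (hA.refl_right h01), hs.nf_refl k0 hb⟩ (by
      rintro i P f hi ⟨j1, j2, j3, j4⟩
      have h1 := hcon _ _ j3 j4
      rw [Reduced, not_and_or] at h1
      rcases h1 with h1 | h1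
      · exact absurd (hs.K3bs_of_nf j4 j2) h1
      · push Not at h1
        obtain ⟨M', N', n1, n2, n3, x, x1, x2, x3⟩ := h1
        obtain ⟨-, m1, -, m2, -⟩ := hs.nf_sub _ _ _ _ n3
        refine ⟨fun b => bif b then N' else M', f, ?_, fun k => k.elim, ⟨x, x2, x1, x3⟩, m1, n1,
          hA.trans j3 n2, hs.nf_trans (hs.nf_up j4 n2) n3⟩
        rintro (_ | _)
        exacts [m2, n2]) (by
      intro δ P f hδ hδΛ hP0 hJ hΦ _ hinc
      have k1' := hA.kcard_union hs.infinite hδ hδΛ (hinc false) fun i hi => (hJ i hi).1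
      have k2' := hA.kcard_union hs.infinite hδ hδΛ (hinc true) fun i hi => (hJ i hi).2.1
      have hle : ∀ i < δ, s.le (P i true) (P δ true) := fun i hi =>
        (hinc true).1 i hi.le δ self_mem_Iic hi.le
      have hle0 := hle 0 hδ.bot_lt
      refine ⟨k1', k2', hA.trans (hJ 0 hδ.bot_lt).2.2.1 hle0, ?_⟩
      have h2 : ∀ i < δ, s.nf M (P i false) a (P δ true) := fun i hi =>
        hs.nf_up (hJ i hi).2.2.2 (hle i hi)
      have hPM : P 0 false = M := by rw [hP0]; rfl
      have h3 := hs.nf_cont δ (fun i => P i false) (P δ true) a hδ (fun i hi => ?_) (hinc false) ?_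
        (hA.subset hle0 (hA.subset (hJ 0 hδ.bot_lt).2.2.1 ha)) (by simpa only [hPM] using h2)
      · simpa only [hPM] using h3
      · rcases hi.lt_or_eq with hi | rfl
        exacts [(hJ i hi).1, k1']
      · exact hA.le_of_forall_le hδ (hinc false) fun i hi =>
          (hs.nf_sub _ _ _ _ (h2 i hi)).2.2.2.2.1)
  obtain ⟨i, hi, hcatch⟩ := exists_catch_up hs.infinite (S := fun i => (P i false).carrier)
    (T := fun i => (P i true).carrier) hΛ
    (fun i j hij hj => hA.subset ((hinc false).1 i (hij.trans_lt hj) j hj hij))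
    (fun i j hij hj => hA.subset ((hinc true).1 i (hij.trans_lt hj) j hj hij))
    (fun i hi hl x hx => ((hinc true).2 i hi hl).mem_iff.1 hx)
    (fun i hi => (hJ i hi).2.1.2.le) (fun i _ => (P i true).small)
  obtain ⟨x, x1, x2, x3⟩ := hΦ i (hΛlim.succ_lt hi)
  exact x3 (hcatch x x1 _ (hΛlim.succ_lt hi) x2)

theorem exists_reduced (hs : s.IsSemiGoodExceptLocalCharacter κ) (hconj : s.HasConjugation κ)
    {M N : Model L} {a : ZFSet.{u}} (h : s.K3bs κ M N a) :
    ∃ N' a', s.tp a' M N' = s.tp a M N ∧ s.Reduced κ M N' a' := by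
  have hA := hs.aec
  obtain ⟨M₁, N₁, h1, h2, h3⟩ := hs.exists_reduced_extension h
  obtain ⟨k0, k1, -, h01, h1N, haN₁, -⟩ := hs.nf_sub _ _ _ _ h2
  have kN₁ := h3.1.2.1
  obtain ⟨a₀, P₀, a₁, P₁, f, t0, t1, i1, i2, fa⟩ := hconj.2 M M₁ a N₁ k0 k1 h2
  have hE := e_of_tp_eq hA t1 h1N haN₁
  obtain ⟨hM₁P₁, ha₁⟩ := E.left_mem hE
  have hE₀ := e_of_tp_eq hA t0 (hA.trans h01 h1N) haN₁
  obtain ⟨hMP₀, ha₀⟩ := E.left_mem hE₀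
  simp only at hM₁P₁ ha₁ hMP₀ ha₀
  obtain ⟨Q₁, q1, q2, q3, q4⟩ := hs.shrink_insert k1 hM₁P₁ ha₁
  obtain ⟨R, k, r1, r2, r3, r4, r5⟩ := hs.amalg_of_tp_eq k1 kN₁ q1 h1N q3 haN₁ q4
    (t1.symm.trans (tp_le hA q3 q4 q2))
  obtain ⟨hf, rfl⟩ := Model.isIso_iff.1 i1
  obtain ⟨hf', rfl⟩ := Model.isIso_iff.1 i2
  have hinv : ∀ x ∈ P₀.carrier, Function.invFunOn f P₀.carrier (f x) = x :=
    fun x hx => hf.leftInvOn_invFunOn hx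
  have hi : InjOn (Function.invFunOn f P₀.carrier) Q₁.carrier := by
    intro x hx y hy hxy
    obtain ⟨x, hx', rfl⟩ := hA.subset q2 hx
    obtain ⟨y, hy', rfl⟩ := hA.subset q2 hy
    rw [hinv x hx', hinv y hy'] at hxy
    rw [hxy]
  obtain ⟨g, hgQ, hg, -⟩ := exists_fresh_injective hi ∅ small_empty
  have hgf : ∀ x ∈ P₀.carrier, f x ∈ Q₁.carrier → g (f x) = x := fun x hx hxQ => by
    rw [hgQ hxQ, hinv x hx]
  have hgM : Model.map g (Model.map f M) = M := Model.map_map_of_leftInv fun x hx =>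
    hgf x (hA.subset hMP₀ hx) (hA.subset q3 ⟨x, hx, rfl⟩)
  have hred := hs.reduced_map h3 r3.injOn
  rw [r5, Model.map_of_eqOn_id r4] at hred
  have hred' := hs.reduced_map hred hg.injOn
  rw [hgM, ← fa, hgf a₀ ha₀ (fa ▸ q4)] at hred'
  refine ⟨_, a₀, ?_, hred'⟩
  have hgQ₁ : s.le (Model.map g Q₁) P₀ := by
    have e1 : Model.map (Function.invFunOn f P₀.carrier) (Model.map f P₀) = P₀ :=
      Model.map_map_of_leftInv hinv
    have e2 : Model.map g Q₁ = Model.map (Function.invFunOn f P₀.carrier) Q₁ :=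
      (Model.map_congr hi fun x hx => (hgQ hx).symm).symm
    rw [e2]
    conv_rhs => rw [← e1]
    refine hA.map_le q2 ?_
    rintro _ ⟨x, hx, rfl⟩ _ ⟨y, hy, rfl⟩ hxy
    rw [hinv x hx, hinv y hy] at hxy
    rw [hxy]
  have hMQ : s.le M (Model.map g Q₁) := by
    have := hA.map_le q3 (hg.injOn (s := Q₁.carrier))
    rwa [hgM] at this
  have ha₀Q : a₀ ∈ (Model.map g Q₁).carrier := ⟨f a₀, fa ▸ q4, hgf a₀ ha₀ (fa ▸ q4)⟩
  have hkN : s.le (Model.map g (Model.map k N₁)) (Model.map g R) := hA.map_le r3.le hg.injOn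
  calc s.tp a₀ M (Model.map g (Model.map k N₁))
      = s.tp a₀ M (Model.map g R) := (tp_le hA hred'.1.2.2.1 hred'.1.2.2.2.1 hkN).symm
    _ = s.tp a₀ M (Model.map g Q₁) := tp_le hA hMQ ha₀Q (hA.map_le r2 hg.injOn)
    _ = s.tp a₀ M P₀ := (tp_le hA hMQ ha₀Q hgQ₁).symm
    _ = s.tp a M N₁ := t0
    _ = s.tp a M N := tp_le hA h.2.2.1 h.2.2.2.1 h1

end IsSemiGoodExceptLocalCharacter

end FrameData

namespace ModelClass

variable {L : FirstOrder.Language.{u, u}} {C : ModelClass L}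

theorem IncCont.le {M : Ordinal.{u} → Model L} {α i j : Ordinal.{u}} (h : C.IncCont M (Iic α))
    (hij : i ≤ j) (hj : j ≤ α) : C.le (M i) (M j) := h.1 i (hij.trans hj) j hj hij

theorem IncCont.of_succ {M : Ordinal.{u} → Model L} {α : Ordinal.{u}}
    (h : C.IncCont M (Iio (Order.succ α))) : C.IncCont M (Iic α) :=
  h.mono fun _ (hi : _ ≤ α) => Order.lt_succ_iff.2 hi

theorem IncCont.to_succ {M : Ordinal.{u} → Model L} {α : Ordinal.{u}}
    (h : C.IncCont M (Iic α)) : C.IncCont M (Iio (Order.succ α)) :=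
  h.mono fun _ (hi : _ < Order.succ α) => Order.lt_succ_iff.1 hi

theorem IncCont.iic_mono {M : Ordinal.{u} → Model L} {α β : Ordinal.{u}}
    (h : C.IncCont M (Iic α)) (hβ : β ≤ α) : C.IncCont M (Iic β) :=
  h.mono (Iic_subset_Iic.2 hβ)

/-- Simultaneous renaming which makes two pieces of a model literal, provided they meet only where
they should. -/
theorem exists_rename₂ {Y X' P : Model L} {X : Set ZFSet.{u}}
    {f : ZFSet.{u} → ZFSet.{u}} (hf : C.IsEmb f X' P) (hX : X ⊆ X'.carrier)
    (hid : ∀ x ∈ X, f x = x) (hfY : ∀ x ∈ X'.carrier, f x ∈ Y.carrier → f x ∈ X)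
    (hYX : ∀ x ∈ X'.carrier, x ∈ Y.carrier → x ∈ X) (Z : Set ZFSet.{u}) (hZ : Small.{u} Z) :
    ∃ g : ZFSet.{u} → ZFSet.{u}, Function.Injective g ∧ (∀ x ∈ Y.carrier, g x = x) ∧
      (∀ x ∈ X'.carrier, g (f x) = x) ∧
      ∀ z ∈ (Model.map g P).carrier, z ∈ Z → z ∈ Y.carrier ∨ z ∈ X'.carrier := by
  classical
  have hinv : ∀ x ∈ X'.carrier, Function.invFunOn f X'.carrier (f x) = x :=
    fun x hx => hf.injOn.leftInvOn_invFunOn hx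
  let k : ZFSet.{u} → ZFSet.{u} := fun z =>
    if z ∈ Y.carrier then z else Function.invFunOn f X'.carrier z
  have hkY : ∀ z ∈ Y.carrier, k z = z := fun z hz => if_pos hz
  have hkf : ∀ x ∈ X'.carrier, k (f x) = x := by
    intro x hx
    by_cases hxY : f x ∈ Y.carrier
    · have h1 := hfY x hx hxY
      rw [hkY _ hxY]
      exact hf.injOn (hX h1) hx (hid _ h1)
    · exact (if_neg hxY).trans (hinv x hx)
  have hmix : ∀ x ∈ X'.carrier, ∀ y ∈ Y.carrier, k (f x) = k y → f x = y := by
    intro x hx y hy hxy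
    rw [hkf x hx, hkY y hy] at hxy
    subst hxy
    exact hid x (hYX x hx hy)
  have hinj : InjOn k (Y.carrier ∪ f '' X'.carrier) := by
    rintro y (hy | ⟨x, hx, rfl⟩) y' (hy' | ⟨x', hx', rfl⟩) hyy
    · rwa [hkY y hy, hkY y' hy'] at hyy
    · exact (hmix x' hx' y hy hyy.symm).symm
    · exact hmix x hx y' hy' hyy
    · rw [hkf x hx, hkf x' hx'] at hyy
      rw [hyy]
  have hsm : Small.{u} ↥(Y.carrier ∪ f '' X'.carrier) := by
    have := Y.small
    have := X'.small
    exact small_union _ _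
  obtain ⟨g, hg, hginj, hfresh⟩ := exists_fresh_extension hinj hsm hZ
  refine ⟨g, hginj, fun x hx => (hg (Or.inl hx)).trans (hkY x hx),
    fun x hx => (hg (Or.inr ⟨x, hx, rfl⟩)).trans (hkf x hx), ?_⟩
  rintro _ ⟨z, hz, rfl⟩ hgz
  by_cases hzD : z ∈ Y.carrier ∪ f '' X'.carrier
  · rcases hzD with hzY | ⟨x, hx, rfl⟩
    · left
      rwa [hg (Or.inl hzY), hkY z hzY]
    · right
      rwa [hg (Or.inr ⟨x, hx, rfl⟩), hkf x hx]
  · exact absurd hgz (hfresh z hzD)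

end ModelClass

namespace FrameData

variable {L : FirstOrder.Language.{u, u}} {s : FrameData L} {κ : Cardinal.{u}}

open ModelClass

/-- A class of reduced triples, closed under isomorphisms, realizing every basic type. -/
structure AdmissibleClass (s : FrameData L) (κ : Cardinal.{u})
    (Q : Model L → Model L → ZFSet.{u} → Prop) : Prop where
  reduced : ∀ M N a, Q M N a → s.Reduced κ M N a
  exists_mem : ∀ M N a, s.K3bs κ M N a → ∃ N' a', s.tp a' M N' = s.tp a M N ∧ Q M N' a'
  map_mem : ∀ M N a f, Q M N a → InjOn f N.carrier → Q (Model.map f M) (Model.map f N) (f a)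

variable {Q : Model L → Model L → ZFSet.{u} → Prop}

namespace IsSemiGoodExceptLocalCharacter

/-- Every basic triple embeds into one whose inner model starts with a triple in `Q`. -/
theorem exists_step (hs : s.IsSemiGoodExceptLocalCharacter κ) (hQ : s.AdmissibleClass κ Q)
    {M N : Model L} {a : ZFSet.{u}} (h : s.K3bs κ M N a) :
    ∃ M' N', s.KCard κ N' ∧ s.le N N' ∧ s.le M' N' ∧ Q M M' a := by
  obtain ⟨X, b, h1, h2⟩ := hQ.exists_mem _ _ _ h
  have h3 := (hQ.reduced _ _ _ h2).1
  obtain ⟨P, f, p1, p2, p3, p4, p5⟩ := hs.amalg_of_tp_eq h.1 h3.2.1 h.2.1 h3.2.2.1 h.2.2.1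
    h3.2.2.2.1 h.2.2.2.1 h1
  refine ⟨Model.map f X, P, p1, p2, p3.le, ?_⟩
  have := hQ.map_mem _ _ _ f h2 p3.injOn
  rwa [Model.map_of_eqOn_id p4, p5] at this

theorem exists_decomp (hs : s.IsSemiGoodExceptLocalCharacter κ) (hQ : s.AdmissibleClass κ Q)
    {M N : Model L} (hM : s.KCard κ M) (hN : s.KCard κ N) (hMN : s.le M N) (a : ZFSet.{u}) :
    ∃ α A d, s.Decomp κ Q A d α ∧ A 0 = M ∧ s.le N (A α) ∧
      (s.K3bs κ M N a → 0 < α ∧ d 0 = a) := by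
  classical
  have hA := hs.aec
  set Λ := (Order.succ κ).ord with hΛ
  have hΛlim : Order.IsSuccLimit Λ :=
    Cardinal.isSuccLimit_ord (hs.infinite.trans (Order.le_succ κ))
  obtain ⟨P, -, hP0, -, hinc, hJ, hΦ, -⟩ := hA.exists_chain (μ := Bool) (ι := Empty) Λ
    (fun k _ => k.elim) (fun k => k.elim)
    (fun i P _ => s.KCard κ (P false) ∧ s.KCard κ (P true) ∧ s.le (P false) (P true) ∧
      (i = 0 → P false = M ∧ P true = N))
    (fun i P _ P' _ => P false ≠ P true → ∃ d ∈ (P true).carrier, Q (P false) (P' false) d ∧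
      (i = 0 → s.K3bs κ M N a → d = a))
    (fun b => bif b then N else M) (fun k => k.elim)
    (by rintro (_ | _); exacts [hM.1, hN.1])
    ⟨hM, hN, hMN, fun _ => ⟨rfl, rfl⟩⟩ (by
      rintro i P f hi ⟨j1, j2, j3, j4⟩
      by_cases heq : P false = P true
      · exact ⟨P, f, fun m => by cases m; exacts [hA.refl_left j3, hA.refl_right j3],
          fun k => k.elim, fun hne => absurd heq hne, j1, j2, j3,
          fun h => absurd h (Order.succ_ne_bot i)⟩
      · have hb : ∃ b, s.K3bs κ (P false) (P true) b ∧ (i = 0 → s.K3bs κ M N a → b = a) := by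
          by_cases hi0 : i = 0 ∧ s.K3bs κ M N a
          · refine ⟨a, ?_, fun _ _ => rfl⟩
            rw [(j4 hi0.1).1, (j4 hi0.1).2]
            exact hi0.2
          · obtain ⟨b, b1, b2, b3⟩ := hs.basic_density _ _ j1 j2 ⟨j3, heq⟩
            exact ⟨b, ⟨j1, j2, j3, b1, b2, b3⟩, fun h h' => absurd ⟨h, h'⟩ hi0⟩
        obtain ⟨b, b1, b2⟩ := hb
        obtain ⟨M', N', n1, n2, n3, n4⟩ := hs.exists_step hQ b1
        have n5 := (hQ.reduced _ _ _ n4).1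
        refine ⟨fun b => bif b then N' else M', f, ?_, fun k => k.elim,
          fun _ => ⟨b, b1.2.2.2.1, n4, b2⟩, n5.2.1, n1, n3,
          fun h => absurd h (Order.succ_ne_bot i)⟩
        rintro (_ | _)
        exacts [n5.2.2.1, n2]) (by
      intro δ P f hδ hδΛ hP0 hJ hΦ _ hinc
      refine ⟨hA.kcard_union hs.infinite hδ hδΛ (hinc false) fun i hi => (hJ i hi).1,
        hA.kcard_union hs.infinite hδ hδΛ (hinc true) fun i hi => (hJ i hi).2.1,
        hA.le_of_forall_le hδ (hinc false) fun i hi => ?_, fun h => absurd h hδ.ne_bot⟩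
      exact hA.trans (hJ i hi).2.2.1 ((hinc true).le hi.le le_rfl))
  obtain ⟨i, hi, hcatch⟩ := exists_catch_up hs.infinite (S := fun i => (P i false).carrier)
    (T := fun i => (P i true).carrier) hΛ
    (fun i j hij hj => hA.subset ((hinc false).1 i (hij.trans_lt hj) j hj hij))
    (fun i j hij hj => hA.subset ((hinc true).1 i (hij.trans_lt hj) j hj hij))
    (fun i hi hl x hx => ((hinc true).2 i hi hl).mem_iff.1 hx)
    (fun i hi => (hJ i hi).2.1.2.le) (fun i _ => (P i true).small)
  have hex : ∃ i, i < Λ ∧ P i false = P i true := by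
    refine ⟨i, hi, ?_⟩
    by_contra hne
    obtain ⟨x, x1, x2, -⟩ := hΦ i (hΛlim.succ_lt hi) hne
    obtain ⟨-, -, -, x3, x4, -⟩ := (hQ.reduced _ _ _ x2).1
    exact x4 (hcatch x x1 _ (hΛlim.succ_lt hi) x3)
  obtain ⟨α, ⟨hα, hαe⟩, hmin⟩ := WellFounded.has_min (wellFounded_lt (α := Ordinal.{u}))
    {i | i < Λ ∧ P i false = P i true} hex
  have hd : ∀ i < α, ∃ d, Q (P i false) (P (Order.succ i) false) d ∧
      (i = 0 → s.K3bs κ M N a → d = a) := by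
    intro i hi
    have hne : P i false ≠ P i true := fun h => hmin i ⟨hi.trans hα, h⟩ hi
    obtain ⟨d, -, h1, h2⟩ := hΦ i (hΛlim.succ_lt (hi.trans hα)) hne
    exact ⟨d, h1, h2⟩
  have hP0f : P 0 false = M := by rw [hP0]; rfl
  have hP0t : P 0 true = N := by rw [hP0]; rfl
  choose! d hd using hd
  refine ⟨α, fun i => P i false, d,
    ⟨hα, (hinc false).mono fun i hi => lt_of_le_of_lt hi hα,
      fun i hi => (hJ i (hi.trans_lt hα)).1, fun i hi => (hd i hi).1⟩, hP0f, ?_, fun hb => ?_⟩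
  · have := (hinc true).1 0 (zero_le.trans_lt hα) α hα zero_le
    simp only at this ⊢
    rwa [hαe, ← hP0t]
  · have h0 : 0 < α := by
      refine pos_iff_ne_zero.2 fun h => hb.2.2.2.2.1 ?_
      rw [h, hP0f, hP0t] at hαe
      rw [hαe]
      exact hb.2.2.2.1
    exact ⟨h0, (hd 0 h0).2 rfl hb⟩

theorem exists_lift_step (hs : s.IsSemiGoodExceptLocalCharacter κ) {X X' Y : Model L}
    {d : ZFSet.{u}} (h : s.Reduced κ X X' d) (hY : s.KCard κ Y) (hXY : s.le X Y)
    (hdisj : ∀ x ∈ X'.carrier, x ∈ Y.carrier → x ∈ X.carrier) (Z : Set ZFSet.{u})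
    (hZ : Small.{u} Z) :
    ∃ Y', s.KCard κ Y' ∧ s.le Y Y' ∧ s.le X' Y' ∧ s.nf X Y d Y' ∧
      ∀ z ∈ Y'.carrier, z ∈ Z → z ∈ Y.carrier ∨ z ∈ X'.carrier := by
  have hA := hs.aec
  obtain ⟨kX, kX', hXX', hd, -, hb⟩ := h.1
  obtain ⟨P, f, p1, p2, p3, p4, p5⟩ := hs.nf_extend (hs.nf_refl kX hb) kX' hXY hY
  have h1 := hs.reduced_map h p3.injOn
  rw [Model.map_of_eqOn_id p4] at h1
  obtain ⟨g, hg, g1, g2, g3⟩ := exists_rename₂ p3 (hA.subset hXX') p4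
    (fun x hx hxY => h1.2 _ _ p1 p3.le p5 _ hxY ⟨x, hx, rfl⟩) hdisj Z hZ
  refine ⟨Model.map g P, hA.map_kcard p1 hg.injOn, hA.le_map_of_id p2 hg.injOn g1, ?_, ?_, g3⟩
  · have := hA.map_le p3.le (hg.injOn (s := P.carrier))
    rwa [Model.map_map_of_leftInv g2] at this
  · have := hs.nf_map p5 (hg.injOn (s := P.carrier))
    rwa [g2 d hd, Model.map_of_eqOn_id g1,
      Model.map_of_eqOn_id fun x hx => g1 x (hA.subset hXY hx)] at this

theorem exists_lift (hs : s.IsSemiGoodExceptLocalCharacter κ)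
    (hQ : ∀ M N a, Q M N a → s.Reduced κ M N a) {A : Ordinal.{u} → Model L}
    {d : Ordinal.{u} → ZFSet.{u}} {α : Ordinal.{u}} (hdec : s.Decomp κ Q A d α) {B₀ : Model L}
    (hB₀ : s.KCard κ B₀) (hle : s.le (A 0) B₀)
    (hdisj : ∀ x ∈ (A α).carrier, x ∈ B₀.carrier → x ∈ (A 0).carrier)
    (Z : Set ZFSet.{u}) (hZ : Small.{u} Z) :
    ∃ B, s.Lift κ A d α B ∧ B 0 = B₀ ∧
      ∀ z ∈ (B α).carrier, z ∈ Z → z ∈ B₀.carrier ∨ z ∈ (A α).carrier := by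
  have hA := hs.aec
  obtain ⟨hα, hinc, hcard, hstep⟩ := hdec
  have hsm : Small.{u} ↥(Z ∪ (A α).carrier) := by
    have := (A α).small
    exact small_union _ _
  obtain ⟨P, -, hP0, -, hincP, hJ, hΦ, -⟩ := hA.exists_chain (μ := Unit) (ι := Empty)
    (Order.succ α) (fun k _ => k.elim) (fun k => k.elim)
    (fun i P _ => s.KCard κ (P ()) ∧ s.le (A i) (P ()) ∧
      ∀ z ∈ (P ()).carrier, z ∈ Z ∪ (A α).carrier → z ∈ B₀.carrier ∨ z ∈ (A i).carrier)
    (fun i P _ P' _ => s.nf (A i) (P ()) (d i) (P' ()))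
    (fun _ => B₀) (fun k => k.elim) (fun _ => hB₀.1) ⟨hB₀, hle, fun z hz _ => Or.inl hz⟩ (by
      rintro i P f hi ⟨j1, j2, j3⟩
      have hi : i < α := Order.succ_lt_succ_iff.1 hi
      have hs1 : s.le (A (Order.succ i)) (A α) := hinc.le (Order.succ_le_of_lt hi) le_rfl
      obtain ⟨Y, y1, y2, y3, y4, y5⟩ := hs.exists_lift_step (hQ _ _ _ (hstep i hi)) j1 j2
        (fun x hx hxP => (j3 x hxP (Or.inr (hA.subset hs1 hx))).elim
          (fun h => hA.subset (hinc.le zero_le hi.le) (hdisj x (hA.subset hs1 hx) h)) id)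
        (Z ∪ (A α).carrier) hsm
      refine ⟨fun _ => Y, f, fun _ => y2, fun k => k.elim, y4, y1, y3, fun z hz hzZ => ?_⟩
      rcases y5 z hz hzZ with h1 | h1
      · exact (j3 z h1 hzZ).imp id fun h =>
          hA.subset (hinc.le (Order.le_succ i) (Order.succ_le_of_lt hi)) h
      · exact Or.inr h1) (by
      intro δ P f hδ hδα hP0 hJ hΦ _ hincP
      have hδα := Order.lt_succ_iff.1 hδα
      refine ⟨hA.kcard_union hs.infinite hδ (hδα.trans_lt hα) (hincP ()) fun i hi => (hJ i hi).1,
        hA.le_of_forall_le hδ (hinc.iic_mono hδα) fun i hi =>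
          hA.trans (hJ i hi).2.1 ((hincP ()).le hi.le le_rfl), fun z hz hzZ => ?_⟩
      obtain ⟨i, hi, hz⟩ := ((hincP ()).2 δ self_mem_Iic hδ).mem_iff.1 hz
      exact ((hJ i hi).2.2 z hz hzZ).imp id fun h => hA.subset (hinc.le hi.le hδα) h)
  refine ⟨fun i => P i (), ⟨(hincP ()).of_succ, fun i hi => (hJ i (Order.lt_succ_iff.2 hi)).1,
    fun i hi => (hJ i (Order.lt_succ_iff.2 hi)).2.1,
    fun i hi => hΦ i (Order.succ_lt_succ_iff.2 hi)⟩, by simp only [hP0], fun z hz hzZ => ?_⟩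
  exact (hJ α (Order.lt_succ α)).2.2 z hz (Or.inl hzZ)

theorem lift_disjoint (hs : s.IsSemiGoodExceptLocalCharacter κ)
    (hQ : ∀ M N a, Q M N a → s.Reduced κ M N a) {A B : Ordinal.{u} → Model L}
    {d : Ordinal.{u} → ZFSet.{u}} {α : Ordinal.{u}} (hdec : s.Decomp κ Q A d α)
    (hB : s.Lift κ A d α B) : ∀ x ∈ (A α).carrier, x ∈ (B 0).carrier → x ∈ (A 0).carrier := by
  have hA := hs.aec
  obtain ⟨hα, hinc, hcard, hstep⟩ := hdec
  obtain ⟨hincB, hcardB, hle, hnf⟩ := hB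
  have key : ∀ i, i ≤ α → ∀ x ∈ (A i).carrier, x ∈ (B 0).carrier → x ∈ (A 0).carrier := by
    intro i
    induction i using Ordinal.limitRecOn with
    | zero => exact fun _ x hx _ => hx
    | add_one i ih =>
      rw [← Order.succ_eq_add_one]
      intro hi x hx hxB
      have hi' := Order.succ_le_iff.1 hi
      refine ih hi'.le x ?_ hxB
      exact (hQ _ _ _ (hstep i hi')).2 _ _ (hcardB _ hi) (hle _ hi) (hnf i hi') x
        (hA.subset (hincB.le zero_le hi'.le) hxB) hx
    | limit i hl ih =>
      intro hi x hx hxB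
      obtain ⟨j, hj, hx⟩ := (hinc.2 i hi hl).mem_iff.1 hx
      exact ih j hj (hj.le.trans hi) x hx hxB
  exact key α le_rfl

theorem reduced_admissible (hs : s.IsSemiGoodExceptLocalCharacter κ) (hconj : s.HasConjugation κ) :
    s.AdmissibleClass κ (s.Reduced κ) :=
  ⟨fun _ _ _ h => h, fun _ _ _ h => hs.exists_reduced hconj h, fun _ _ _ _ h hf =>
    hs.reduced_map h hf⟩

theorem k3uq_reduced (hs : s.IsSemiGoodExceptLocalCharacter κ) (hconj : s.HasConjugation κ)
    {M₀ M₁ : Model L} {a : ZFSet.{u}} (h : s.K3uq κ M₀ M₁ a) : s.Reduced κ M₀ M₁ a := by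
  have hA := hs.aec
  refine ⟨h.1, fun M' N' kN' hle hnf x hxM' hxM₁ => ?_⟩
  obtain ⟨k0, k1, h01, ha, -, hb⟩ := h.1
  obtain ⟨-, kM', -, h0M', hM'N', -⟩ := hs.nf_sub _ _ _ _ hnf
  have hQ := hs.reduced_admissible hconj
  obtain ⟨α, A, d, hdec, hA0, hM₁, hpos⟩ := hs.exists_decomp hQ k0 k1 h01 a
  obtain ⟨hα0, hd0⟩ := hpos h.1
  obtain ⟨g, hgid, hg, hfresh⟩ := exists_fresh_injective (f := id) (M := M₀)
    (injOn_id _) (A α).carrier (A α).small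
  have hgid : ∀ x ∈ M₀.carrier, g x = x := fun x hx => hgid hx
  have hM₀g : s.le M₀ (Model.map g M') := hA.le_map_of_id h0M' hg.injOn hgid
  have hdisj : ∀ x ∈ (A α).carrier, x ∈ (Model.map g M').carrier → x ∈ M₀.carrier := by
    rintro _ hx ⟨x, -, rfl⟩
    by_cases hx0 : x ∈ M₀.carrier
    · rwa [hgid x hx0]
    · exact absurd hx (hfresh x hx0)
  obtain ⟨B, hB, hB0, -⟩ := hs.exists_lift hQ.reduced hdec (hA.map_kcard kM' hg.injOn)
    (hA0 ▸ hM₀g) (by rwa [hA0]) ∅ small_empty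
  have hB1 : s.le (B (Order.succ 0)) (B α) := hB.1.le (Order.succ_le_of_lt hα0) le_rfl
  have hnfB : s.nf M₀ (Model.map g M') a (B α) := by
    have := hs.nf_up (hB.2.2.2 0 hα0) hB1
    rwa [hA0, hB0, hd0] at this
  have hM₁B : s.le M₁ (B α) := hA.trans hM₁ (hB.2.2.1 α le_rfl)
  have hM'B : s.le (Model.map g M') (B α) := hB0 ▸ hB.1.le zero_le le_rfl
  obtain ⟨u, v, P, hP, hu, hv, e1, e2⟩ := (h.2 M' kM' h0M').2 id g (B α) id id N'
    ⟨⟨hB.2.1 α le_rfl, ⟨isEmb_of_le hM₁B fun _ _ => rfl, fun _ _ => rfl⟩,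
      ⟨isEmb_iff.2 ⟨hg.injOn, hM'B⟩, hgid⟩⟩, _, Model.isIso_map hg.injOn, hnfB⟩
    ⟨⟨kN', ⟨isEmb_of_le hle fun _ _ => rfl, fun _ _ => rfl⟩,
      ⟨isEmb_of_le hM'N' fun _ _ => rfl, fun _ _ => rfl⟩⟩, M',
      Model.isIso_of_eqOn_id fun _ _ => rfl, hnf⟩
  have h3 : u x = u (g x) := (e1 x hxM₁).trans (e2 x hxM').symm
  have h4 : x = g x := hu.injOn (hA.subset hM₁B hxM₁) (hA.subset hM'B ⟨x, hxM', rfl⟩) h3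
  exact hdisj x (hA.subset hM₁ hxM₁) ⟨x, hxM', h4.symm⟩

theorem k3uq_map (hs : s.IsSemiGoodExceptLocalCharacter κ) {M₀ M₁ : Model L} {a : ZFSet.{u}}
    {f : ZFSet.{u} → ZFSet.{u}} (h : s.K3uq κ M₀ M₁ a) (hf : InjOn f M₁.carrier) :
    s.K3uq κ (Model.map f M₀) (Model.map f M₁) (f a) := by
  have hA := hs.aec
  obtain ⟨k0, k1, h01, ha, -, hb⟩ := h.1
  have hf0 := hf.mono (hA.subset h01)
  obtain ⟨F, hF, hFinj, -⟩ := exists_fresh_injective hf ∅ small_empty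
  have hF0 : EqOn f F M₀.carrier := fun x hx => (hF (hA.subset h01 hx)).symm
  have hK3 := hs.K3bs_map h.1 hf
  rw [Model.map_congr hf hF.symm, Model.map_congr hf0 hF0, ← hF ha] at hK3 ⊢
  refine ⟨hK3, ?_⟩
  obtain ⟨k, hk, hkF, -⟩ := hA.exists_rename
    (hA.isEmb_map k1.1 (hFinj.injOn (s := M₁.carrier))) ∅ small_empty
  have hkF0 : ∀ x ∈ M₀.carrier, k (F x) = x := fun x hx => hkF x (hA.subset h01 hx)
  have hkM₀ : Model.map k (Model.map F M₀) = M₀ := Model.map_map_of_leftInv hkF0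
  let k' : ZFSet.{u} → ZFSet.{u} := Function.invFun k
  have hk' : ∀ x, k' (k x) = x := Function.leftInverse_invFun hk
  intro M₂ kM₂ hM₂
  have kM₂' : s.KCard κ (Model.map k M₂) := hA.map_kcard kM₂ hk.injOn
  have hM₂' : s.le M₀ (Model.map k M₂) := by
    have := hA.map_le hM₂ (hk.injOn (s := M₂.carrier))
    rwa [hkM₀] at this
  obtain ⟨hex, huniq⟩ := h.2 _ kM₂' hM₂'
  constructor
  · obtain ⟨f₁, f₂, M₃, ⟨k3, ⟨e1, i1⟩, ⟨e2, i2⟩⟩, M₂'', iso, hnf⟩ := hex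
    obtain ⟨-, rfl⟩ := Model.isIso_iff.1 iso
    have hFM₃ := hA.isEmb_map k3.1 (hFinj.injOn (s := M₃.carrier))
    have hkM₁ : s.IsEmb k (Model.map F M₁) M₁ := by
      refine isEmb_iff.2 ⟨hk.injOn, ?_⟩
      rw [Model.map_map_of_leftInv hkF]
      exact hA.refl_right h01
    have hkM₂ := hA.isEmb_map kM₂.1 (hk.injOn (s := M₂.carrier))
    have hcomp : Model.map f₂ (Model.map k M₂) = Model.map (f₂ ∘ k) M₂ :=
      Model.map_map hk.injOn e2.injOn
    have e2k := hA.emb_comp hkM₂ e2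
    refine ⟨F ∘ (f₁ ∘ k), F ∘ (f₂ ∘ k), Model.map F M₃, ⟨hA.map_kcard k3 hFinj.injOn,
      ⟨hA.emb_comp (hA.emb_comp hkM₁ e1) hFM₃, ?_⟩, ⟨hA.emb_comp e2k hFM₃, ?_⟩⟩,
      Model.map F (Model.map f₂ (Model.map k M₂)), ?_, ?_⟩
    · rintro _ ⟨x, hx, rfl⟩
      simp only [Function.comp, hkF0 x hx, i1 x hx]
    · rintro _ ⟨x, hx, rfl⟩
      simp only [Function.comp, hkF0 x hx, i2 x hx]
    · rw [hcomp]
      exact (Model.isIso_map e2k.injOn).comp (Model.isIso_map hFinj.injOn)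
    · have := hs.nf_map hnf (hFinj.injOn (s := M₃.carrier))
      simpa only [Function.comp, hkF a ha] using this
  · have pull : ∀ f₁ f₂ M₃, s.IsNFAmalgam κ (Model.map F M₀) (Model.map F M₁) (F a) M₂ f₁ f₂ M₃ →
        s.IsNFAmalgam κ M₀ M₁ a (Model.map k M₂) (k ∘ (f₁ ∘ F)) (k ∘ (f₂ ∘ k')) (Model.map k M₃) := by
      rintro f₁ f₂ M₃ ⟨⟨k3, ⟨e1, i1⟩, ⟨e2, i2⟩⟩, M₂'', iso, hnf⟩
      obtain ⟨-, rfl⟩ := Model.isIso_iff.1 iso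
      have hkM₃ := hA.isEmb_map k3.1 (hk.injOn (s := M₃.carrier))
      have hFM₁ := hA.isEmb_map k1.1 (hFinj.injOn (s := M₁.carrier))
      have hk'M₂ : Model.map k' (Model.map k M₂) = M₂ := Model.map_map_of_leftInv fun x _ => hk' x
      have hk'e : s.IsEmb k' (Model.map k M₂) M₂ := by
        refine isEmb_iff.2 ⟨?_, ?_⟩
        · rintro _ ⟨x, hx, rfl⟩ _ ⟨y, hy, rfl⟩ hxy
          rw [hk', hk'] at hxy
          rw [hxy]
        · rw [hk'M₂]
          exact hA.refl_right hM₂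
      have e2k := hA.emb_comp hk'e e2
      refine ⟨⟨hA.map_kcard k3 hk.injOn, ⟨hA.emb_comp (hA.emb_comp hFM₁ e1) hkM₃, fun x hx => ?_⟩,
        ⟨hA.emb_comp e2k hkM₃, fun x hx => ?_⟩⟩, Model.map k (Model.map f₂ M₂), ?_, ?_⟩
      · simp only [Function.comp, i1 (F x) ⟨x, hx, rfl⟩, hkF0 x hx]
      · have h1 : k' x = F x := by
          conv_lhs => rw [← hkF0 x hx]
          exact hk' _
        simp only [Function.comp, h1, i2 (F x) ⟨x, hx, rfl⟩, hkF0 x hx]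
      · have : Model.map f₂ M₂ = Model.map (f₂ ∘ k') (Model.map k M₂) := by
          rw [← Model.map_map hk'e.injOn, hk'M₂]
          have h2 : k' '' (Model.map k M₂).carrier = M₂.carrier := congrArg Model.carrier hk'M₂
          rw [h2]
          exact e2.injOn
        rw [this]
        exact (Model.isIso_map e2k.injOn).comp (Model.isIso_map hk.injOn)
      · have := hs.nf_map hnf (hk.injOn (s := M₃.carrier))
        rwa [hkM₀] at this
    intro f₁ f₂ M₃ g₁ g₂ N₃ h1 h2
    obtain ⟨u, v, P, hP, hu, hv, e1, e2⟩ := huniq _ _ _ _ _ _ (pull _ _ _ h1) (pull _ _ _ h2)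
    refine ⟨u ∘ k, v ∘ k, P, hP, hA.emb_comp (hA.isEmb_map h1.1.1.1 hk.injOn) hu,
      hA.emb_comp (hA.isEmb_map h2.1.1.1 hk.injOn) hv, ?_, ?_⟩
    · rintro _ ⟨x, hx, rfl⟩
      exact e1 x hx
    · intro x hx
      have := e2 (k x) ⟨x, hx, rfl⟩
      simpa only [Function.comp, hk'] using this

theorem k3uq_admissible (hs : s.IsSemiGoodExceptLocalCharacter κ) (hconj : s.HasConjugation κ)
    (hws : s.WeaklySuccessful κ) : s.AdmissibleClass κ (s.K3uq κ) :=
  ⟨fun _ _ _ h => hs.k3uq_reduced hconj h, hws, fun _ _ _ _ h hf => hs.k3uq_map h hf⟩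

theorem decomp_map (hs : s.IsSemiGoodExceptLocalCharacter κ)
    {Q : Model L → Model L → ZFSet.{u} → Prop} (hQ : s.AdmissibleClass κ Q)
    {A : Ordinal.{u} → Model L} {d : Ordinal.{u} → ZFSet.{u}} {α : Ordinal.{u}}
    (h : s.Decomp κ Q A d α) {f : ZFSet.{u} → ZFSet.{u}} (hf : Function.Injective f) :
    s.Decomp κ Q (fun i => Model.map f (A i)) (fun i => f (d i)) α :=
  ⟨h.1, (h.2.1.to_succ.map hs.aec fun _ _ => hf.injOn).of_succ,
    fun i hi => hs.aec.map_kcard (h.2.2.1 i hi) hf.injOn,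
    fun i hi => hQ.map_mem _ _ _ f (h.2.2.2 i hi) hf.injOn⟩

theorem lift_map (hs : s.IsSemiGoodExceptLocalCharacter κ)
    {A B : Ordinal.{u} → Model L} {d : Ordinal.{u} → ZFSet.{u}} {α : Ordinal.{u}}
    (h : s.Lift κ A d α B) {f : ZFSet.{u} → ZFSet.{u}} (hf : Function.Injective f) :
    s.Lift κ (fun i => Model.map f (A i)) (fun i => f (d i)) α (fun i => Model.map f (B i)) :=
  ⟨(h.1.to_succ.map hs.aec fun _ _ => hf.injOn).of_succ,
    fun i hi => hs.aec.map_kcard (h.2.1 i hi) hf.injOn,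
    fun i hi => hs.aec.map_le (h.2.2.1 i hi) hf.injOn,
    fun i hi => hs.nf_map (h.2.2.2 i hi) hf.injOn⟩

/-- Renaming the new elements of an extension away from a small set. -/
theorem exists_fresh_copy (hs : s.IsSemiGoodExceptLocalCharacter κ) {M N : Model L}
    (hN : s.KCard κ N) (hMN : s.le M N) (Y : Set ZFSet.{u}) (hY : Small.{u} Y) :
    ∃ g : ZFSet.{u} → ZFSet.{u}, Function.Injective g ∧ (∀ x ∈ M.carrier, g x = x) ∧
      s.KCard κ (Model.map g N) ∧ s.le M (Model.map g N) ∧ s.IsEmb g N (Model.map g N) ∧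
      ∀ x ∈ (Model.map g N).carrier, x ∈ Y → x ∈ M.carrier := by
  obtain ⟨g, h1, h2, h3, h4⟩ := hs.aec.exists_rename
    (isEmb_of_le (f := id) hMN fun _ _ => rfl) Y hY
  exact ⟨g, h1, h2, hs.aec.map_kcard hN h1.injOn, h3, hs.aec.isEmb_map hN.1 h1.injOn, h4⟩

theorem k3uq_amalg (hs : s.IsSemiGoodExceptLocalCharacter κ) {X X' Y Y' Y'' : Model L}
    {d : ZFSet.{u}} (h : s.K3uq κ X X' d) (hY' : s.KCard κ Y') (hY'' : s.KCard κ Y'')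
    (hX' : s.le X' Y') (hX'' : s.le X' Y'') (h' : s.nf X Y d Y') (h'' : s.nf X Y d Y'') :
    ∃ P g, s.KCard κ P ∧ s.le Y' P ∧ s.IsEmb g Y'' P ∧ (∀ x ∈ X'.carrier, g x = x) ∧
      ∀ x ∈ Y.carrier, g x = x := by
  have hA := hs.aec
  obtain ⟨-, kY, -, hXY, hYY', -⟩ := hs.nf_sub _ _ _ _ h'
  obtain ⟨-, -, -, -, hYY'', -⟩ := hs.nf_sub _ _ _ _ h''
  have am : ∀ Z, s.KCard κ Z → s.le X' Z → s.le Y Z → s.nf X Y d Z →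
      s.IsNFAmalgam κ X X' d Y id id Z := fun Z h1 h2 h3 h4 =>
    ⟨⟨h1, ⟨isEmb_of_le h2 fun _ _ => rfl, fun _ _ => rfl⟩,
      ⟨isEmb_of_le h3 fun _ _ => rfl, fun _ _ => rfl⟩⟩, Y,
      Model.isIso_of_eqOn_id fun _ _ => rfl, h4⟩
  obtain ⟨u, v, P, hP, hu, hv, e1, e2⟩ := (h.2 Y kY hXY).2 _ _ _ _ _ _
    (am _ hY' hX' hYY' h') (am _ hY'' hX'' hYY'' h'')
  obtain ⟨g, hg, hgu, hle, -⟩ := hA.exists_rename hu ∅ small_empty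
  refine ⟨Model.map g P, g ∘ v, hA.map_kcard hP hg.injOn, hle,
    hA.emb_comp hv (hA.isEmb_map hP.1 hg.injOn), fun x hx => ?_, fun x hx => ?_⟩
  · exact (congrArg g (e1 x hx).symm).trans (hgu x (hA.subset hX' hx))
  · exact (congrArg g (e2 x hx).symm).trans (hgu x (hA.subset hYY' hx))

/-- One step of a lift extends along an embedding of its base. -/
theorem lift_step_extend (hs : s.IsSemiGoodExceptLocalCharacter κ) {X X' B B' P : Model L}
    {d : ZFSet.{u}} {v : ZFSet.{u} → ZFSet.{u}} (h : s.Reduced κ X X' d) (hP : s.KCard κ P)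
    (hXP : s.le X P) (hv : s.IsEmb v B P) (hid : ∀ x ∈ X.carrier, v x = x) (hnf : s.nf X B d B')
    (hB' : s.KCard κ B') (hX'B' : s.le X' B')
    (hdisj : ∀ x ∈ X'.carrier, x ∈ P.carrier → x ∈ X.carrier) (Z : Set ZFSet.{u})
    (hZ : Small.{u} Z) :
    ∃ R w, s.KCard κ R ∧ s.le P R ∧ s.le X' R ∧ s.IsEmb w B' R ∧ EqOn w v B.carrier ∧
      (∀ x ∈ X'.carrier, w x = x) ∧ s.nf X P d R ∧
      ∀ z ∈ R.carrier, z ∈ Z → z ∈ P.carrier ∨ z ∈ X'.carrier := by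
  have hA := hs.aec
  have hXX' := h.1.2.2.1
  have hd := h.1.2.2.2.1
  obtain ⟨-, kB, -, hXB, hBB', -⟩ := hs.nf_sub _ _ _ _ hnf
  obtain ⟨F, hF, hFinj, -⟩ := exists_fresh_injective hv.injOn ∅ small_empty
  have hFid : ∀ x ∈ X.carrier, F x = x := fun x hx => (hF (hA.subset hXB hx)).trans (hid x hx)
  have hFB : Model.map F B = Model.map v B := Model.map_congr hFinj.injOn hF
  have h1 := hs.nf_map hnf (hFinj.injOn (s := B'.carrier))
  rw [Model.map_of_eqOn_id hFid, hFB] at h1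
  obtain ⟨R, k, r1, r2, r3, r4, r5⟩ := hs.nf_extend h1 (hA.map_kcard hB' hFinj.injOn) hv.le hP
  have hw := hA.emb_comp (hA.isEmb_map hB'.1 (hFinj.injOn (s := B'.carrier))) r3
  have hwB : EqOn (k ∘ F) v B.carrier := fun x hx => by
    rw [Function.comp, hF hx]
    exact r4 _ ⟨x, hx, rfl⟩
  have hwid : ∀ x ∈ X.carrier, (k ∘ F) x = x := fun x hx =>
    (hwB (hA.subset hXB hx)).trans (hid x hx)
  have hwX' := hA.emb_of_le hw hX'B'
  have hred := hs.reduced_map h hwX'.injOn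
  rw [Model.map_of_eqOn_id hwid] at hred
  obtain ⟨g, hg, g1, g2, g3⟩ := exists_rename₂ hwX' (hA.subset hXX') hwid
    (fun x hx hxP => hred.2 _ _ r1 hwX'.le r5 _ hxP ⟨x, hx, rfl⟩) hdisj Z hZ
  refine ⟨Model.map g R, g ∘ (k ∘ F), hA.map_kcard r1 hg.injOn, hA.le_map_of_id r2 hg.injOn g1,
    ?_, hA.emb_comp hw (hA.isEmb_map r1.1 hg.injOn), fun x hx => ?_, g2, ?_, g3⟩
  · have := hA.map_le hwX'.le (hg.injOn (s := R.carrier))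
    rwa [Model.map_map_of_leftInv g2] at this
  · rw [Function.comp, hwB hx]
    exact g1 _ (hA.emb_mem hv hx)
  · have := hs.nf_map r5 (hg.injOn (s := R.carrier))
    rwa [show g (k (F d)) = d from g2 d hd, Model.map_of_eqOn_id g1,
      Model.map_of_eqOn_id fun x hx => g1 x (hA.subset hXP hx)] at this

/-- Two lifts of the same decomposition by uniqueness triples can be jointly embedded. -/
theorem lift_unique (hs : s.IsSemiGoodExceptLocalCharacter κ)
    (hQ : s.AdmissibleClass κ (s.K3uq κ)) {A B B' : Ordinal.{u} → Model L}
    {d : Ordinal.{u} → ZFSet.{u}} {α : Ordinal.{u}} (hdec : s.Decomp κ (s.K3uq κ) A d α)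
    (hB : s.Lift κ A d α B) (hB' : s.Lift κ A d α B') {M : Model L} (hM : s.KCard κ M)
    (hAM : s.le (A 0) M) (hMB : s.le M (B 0)) (hMB' : s.le M (B' 0)) :
    ∃ P g, s.KCard κ P ∧ s.le (B α) P ∧ s.IsEmb g (B' α) P ∧ (∀ x ∈ (A α).carrier, g x = x) ∧
      ∀ x ∈ M.carrier, g x = x := by
  have hA := hs.aec
  have hdisjB := hs.lift_disjoint hQ.reduced hdec hB
  obtain ⟨hα, hinc, hcard, hstep⟩ := hdec
  obtain ⟨P₁, v₁, p1, p2, p3, p4⟩ := hs.amalg hM (hB.2.1 0 zero_le) (hB'.2.1 0 zero_le)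
    (isEmb_of_le (f := id) hMB fun _ _ => rfl) hMB'
  obtain ⟨g₀, hg₀, q1, q2, q3, q4, q5⟩ := hs.exists_fresh_copy p1 p2 (A α).carrier (A α).small
  set P₀ := Model.map g₀ P₁ with hP₀
  have hA0 : s.le (A 0) P₀ := hA.trans (hA.trans hAM hMB) q3
  have hv0 : s.IsEmb (g₀ ∘ v₁) (B' 0) P₀ := hA.emb_comp p3 q4
  have hvM : ∀ x ∈ M.carrier, g₀ (v₁ x) = x := fun x hx => by
    rw [p4 hx]
    exact q1 x (hA.subset hMB hx)
  obtain ⟨P, f, hP0, hf0, hincP, hJ, -, hcoh⟩ := hA.exists_chain (μ := Unit) (ι := Bool)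
    (Order.succ α) (fun k i => bif k then (B' i).carrier else (B i).carrier) (by
      rintro (_ | _) i j hij hj
      · exact hA.subset (hB.1.le hij (Order.lt_succ_iff.1 hj))
      · exact hA.subset (hB'.1.le hij (Order.lt_succ_iff.1 hj)))
    (fun i P f => s.KCard κ (P ()) ∧ s.le (A i) (P ()) ∧ s.IsEmb (f false) (B i) (P ()) ∧
      s.IsEmb (f true) (B' i) (P ()) ∧ (∀ k, ∀ x ∈ (A i).carrier, f k x = x) ∧
      ∀ x ∈ (A α).carrier, x ∈ (P ()).carrier → x ∈ (A i).carrier)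
    (fun _ _ _ _ _ => True)
    (fun _ => P₀) (fun k => bif k then g₀ ∘ v₁ else id) (fun _ => q2.1)
    ⟨q2, hA0, isEmb_of_le q3 fun _ _ => rfl, hv0, by
      rintro (_ | _) x hx
      · rfl
      · exact hvM x (hA.subset hAM hx),
      fun x hx hxP => hdisjB x hx (q5 x hxP hx)⟩ (by
      rintro i P f hi ⟨j1, j2, j3, j4, j5, j6⟩
      have hi : i < α := Order.succ_lt_succ_iff.1 hi
      have hi' := Order.succ_le_of_lt hi
      have hsub : (A (Order.succ i)).carrier ⊆ (A α).carrier := hA.subset (hinc.le hi' le_rfl)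
      have hred := hQ.reduced _ _ _ (hstep i hi)
      obtain ⟨R, u, r1, r2, r3, r4, r5, r6, r7, r8⟩ := hs.lift_step_extend hred j1 j2 j3 (j5 false)
        (hB.2.2.2 i hi) (hB.2.1 _ hi') (hB.2.2.1 _ hi') (fun x hx => j6 x (hsub hx))
        (A α).carrier (A α).small
      obtain ⟨R', v, t1, t2, t3, t4, t5, t6, t7, t8⟩ := hs.lift_step_extend hred j1 j2 j4 (j5 true)
        (hB'.2.2.2 i hi) (hB'.2.1 _ hi') (hB'.2.2.1 _ hi') (fun x hx => j6 x (hsub hx))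
        (A α).carrier (A α).small
      obtain ⟨S, g, s1, s2, s3, s4, s5⟩ := hs.k3uq_amalg (hstep i hi) r1 t1 r3 t3 r7 t7
      obtain ⟨k, hk, w1, w2, w3, w4, w5⟩ := hs.exists_fresh_copy s1 s2 (A α).carrier (A α).small
      have hcomp := hA.emb_comp (hA.emb_comp t4 s3) w4
      refine ⟨fun _ => Model.map k S, fun b => bif b then k ∘ (g ∘ v) else u,
        fun _ => hA.trans r2 w3, ?_, trivial, w2, hA.trans r3 w3, hA.emb_trans_le r4 w3,
        hcomp, ?_, fun x hx hxS => ?_⟩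
      · rintro (_ | _) x hx
        · exact (r5 hx).symm
        · change f true x = k (g (v x))
          rw [t5 hx, s5 _ (hA.emb_mem j4 hx), w1 _ (hA.subset r2 (hA.emb_mem j4 hx))]
      · rintro (_ | _) x hx
        · exact r6 x hx
        · change k (g (v x)) = x
          rw [t6 x hx, s4 x hx, w1 x (hA.subset r3 hx)]
      · rcases r8 x (w5 x hxS hx) hx with h1 | h1
        · exact hA.subset (hinc.le (Order.le_succ i) hi') (j6 x hx h1)
        · exact h1) (by
      intro δ P f hδ hδα hP0 hJ _ hcoh hincP
      have hδα := Order.lt_succ_iff.1 hδα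
      have hPle : ∀ i < δ, s.le (P i ()) (P δ ()) := fun i hi => (hincP ()).le hi.le le_rfl
      refine ⟨hA.kcard_union hs.infinite hδ (hδα.trans_lt hα) (hincP ()) fun i hi => (hJ i hi).1,
        hA.le_of_forall_le hδ (hinc.iic_mono hδα) fun i hi => hA.trans (hJ i hi).2.1 (hPle i hi),
        hA.isEmb_limit hδ (hB.1.iic_mono hδα) fun i hi =>
          hA.emb_trans_le ((hJ i hi).2.2.1.congr (hcoh false i hi.le)) (hPle i hi),
        hA.isEmb_limit hδ (hB'.1.iic_mono hδα) fun i hi =>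
          hA.emb_trans_le ((hJ i hi).2.2.2.1.congr (hcoh true i hi.le)) (hPle i hi),
        fun k x hx => ?_, fun x hx hxP => ?_⟩
      · obtain ⟨i, hi, hx⟩ := (hinc.2 δ hδα hδ).mem_iff.1 hx
        rw [← hcoh k i hi.le, (hJ i hi).2.2.2.2.1 k x hx]
        cases k
        exacts [hA.subset (hB.2.2.1 i (hi.le.trans hδα)) hx,
          hA.subset (hB'.2.2.1 i (hi.le.trans hδα)) hx]
      · obtain ⟨i, hi, hxP⟩ := ((hincP ()).2 δ self_mem_Iic hδ).mem_iff.1 hxP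
        exact hA.subset (hinc.le hi.le hδα) ((hJ i hi).2.2.2.2.2 x hx hxP))
  obtain ⟨j1, -, j3, j4, j5, -⟩ := hJ α (Order.lt_succ α)
  obtain ⟨g, hg, g1, g2, -⟩ := hA.exists_rename j3 ∅ small_empty
  refine ⟨Model.map g (P α ()), g ∘ f α true, hA.map_kcard j1 hg.injOn, g2,
    hA.emb_comp j4 (hA.isEmb_map j1.1 hg.injOn), fun x hx => ?_, fun x hx => ?_⟩
  · have := g1 x (hA.subset (hB.2.2.1 α le_rfl) hx)
    rw [j5 false x hx] at this
    rw [Function.comp, j5 true x hx, this]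
  · have h1 : f α false x = x := by
      rw [← hcoh false 0 α zero_le (Order.lt_succ α) (hA.subset hMB hx), hf0]
      rfl
    have h2 : f α true x = x := by
      rw [← hcoh true 0 α zero_le (Order.lt_succ α) (hA.subset hMB' hx), hf0]
      exact hvM x hx
    have := g1 x (hA.subset (hA.trans hMB (hB.1.le zero_le le_rfl)) hx)
    rw [h1] at this
    rw [Function.comp, h2, this]

end IsSemiGoodExceptLocalCharacter

end FrameData

theorem exists_injective_piecewise {f : ZFSet.{u} → ZFSet.{u}} {S Y : Set ZFSet.{u}}
    (hS : Small.{u} S) (hY : Small.{u} Y) (hf : InjOn f S) (h1 : ∀ x ∈ S, x ∈ Y → f x = x)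
    (h2 : ∀ x ∈ S, f x ∈ Y → f x = x) :
    ∃ k : ZFSet.{u} → ZFSet.{u}, Function.Injective k ∧ EqOn k f S ∧ ∀ x ∈ Y, k x = x := by
  classical
  let p : ZFSet.{u} → ZFSet.{u} := fun x => if x ∈ Y then x else f x
  have hpY : ∀ x ∈ Y, p x = x := fun x hx => if_pos hx
  have hpS : ∀ x ∈ S, p x = f x := by
    intro x hx
    by_cases hxY : x ∈ Y
    · rw [hpY x hxY, h1 x hx hxY]
    · exact if_neg hxY
  have hmix : ∀ x ∈ S, ∀ y ∈ Y, p x = p y → x = y := by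
    intro x hx y hy hxy
    rw [hpS x hx, hpY y hy] at hxy
    rw [← hxy, h2 x hx (hxy ▸ hy)]
  obtain ⟨k, hk, hinj, -⟩ := exists_fresh_extension (f := p) (D := S ∪ Y) (Y := ∅) (by
    rintro x (hx | hx) y (hy | hy) hxy
    · rw [hpS x hx, hpS y hy] at hxy
      exact hf hx hy hxy
    · exact hmix x hx y hy hxy
    · exact (hmix y hy x hx hxy.symm).symm
    · rwa [hpY x hx, hpY y hy] at hxy) (small_union _ _) small_empty
  exact ⟨k, hinj, fun x hx => (hk (Or.inl hx)).trans (hpS x hx),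
    fun x hx => (hk (Or.inr hx)).trans (hpY x hx)⟩

namespace FrameData

variable {L : FirstOrder.Language.{u, u}} {s : FrameData L} {κ : Cardinal.{u}}

open ModelClass

namespace IsSemiGoodExceptLocalCharacter

/-- A sequence whose successive steps realize basic types extends, over a given basic extension
of its first term, to a sequence which is independent of it. -/
theorem exists_row (hs : s.IsSemiGoodExceptLocalCharacter κ) {R : Ordinal.{u} → Model L}
    {d : Ordinal.{u} → ZFSet.{u}} {α : Ordinal.{u}} (hα : α < (Order.succ κ).ord)
    (hinc : s.IncCont R (Iic α)) (hcard : ∀ i ≤ α, s.KCard κ (R i))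
    (hstep : ∀ i < α, s.K3bs κ (R i) (R (Order.succ i)) (d i)) {X : Model L} {e : ZFSet.{u}}
    (hX : s.K3bs κ (R 0) X e) :
    ∃ R' g, s.IncCont R' (Iic α) ∧ (∀ i ≤ α, s.KCard κ (R' i)) ∧ (∀ i ≤ α, s.le (R i) (R' i)) ∧
      (∀ i < α, s.nf (R i) (R' i) (d i) (R' (Order.succ i))) ∧ Function.Injective g ∧
      Model.map g X = R' 0 ∧ (∀ x ∈ (R 0).carrier, g x = x) ∧
      ∀ i ≤ α, s.nf (R 0) (R i) (g e) (R' i) := by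
  have hA := hs.aec
  obtain ⟨k0, kX, h0X, he, -, hb⟩ := hX
  obtain ⟨P, f, hP0, hf0, hincP, hJ, hΦ, hcoh⟩ := hA.exists_chain (μ := Unit) (ι := Unit)
    (Order.succ α) (fun _ i => (R i).carrier)
    (fun _ i j hij hj => hA.subset (hinc.le hij (Order.lt_succ_iff.1 hj)))
    (fun i P f => s.KCard κ (P ()) ∧ s.IsEmb (f ()) (R i) (P ()) ∧
      (∀ x ∈ (R 0).carrier, f () x = x) ∧ s.nf (R 0) (Model.map (f ()) (R i)) e (P ()))
    (fun i P f P' f' => s.nf (Model.map (f ()) (R i)) (P ()) (f' () (d i)) (P' ()))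
    (fun _ => X) (fun _ => id) (fun _ => kX.1)
    ⟨kX, isEmb_of_le h0X fun _ _ => rfl, fun _ _ => rfl, by
      rw [Model.map_of_eqOn_id (f := (fun _ => id) ()) fun _ _ => rfl]
      exact hs.nf_refl k0 hb⟩ (by
      rintro i P f hi ⟨j1, j2, j3, j4⟩
      have hi : i < α := Order.succ_lt_succ_iff.1 hi
      obtain ⟨F, hF, hFinj, -⟩ := exists_fresh_injective j2.injOn ∅ small_empty
      have hFR : Model.map F (R i) = Model.map (f ()) (R i) := Model.map_congr hFinj.injOn hF
      have hK := hs.K3bs_map (hstep i hi) (hFinj.injOn (s := (R (Order.succ i)).carrier))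
      rw [hFR] at hK
      obtain ⟨P', k, p1, p2, p3, p4, p5, p6⟩ := hs.symmetric_amalg (hs.K3bs_of_nf j4 j1) hK
      have hmm := Model.map_map (hFinj.injOn (s := (R (Order.succ i)).carrier)) p3.injOn
      have hkF : EqOn (f ()) (k ∘ F) (R i).carrier := fun x hx => by
        rw [Function.comp, hF hx]
        exact (p4 _ ⟨x, hx, rfl⟩).symm
      refine ⟨fun _ => P', fun _ => k ∘ F, fun _ => p2, fun _ => hkF, p6, p1,
        hA.emb_comp (hA.isEmb_map (hcard _ (Order.succ_le_of_lt hi)).1 hFinj.injOn) p3,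
        fun x hx => (hkF (hA.subset (hinc.le zero_le hi.le) hx)).symm.trans (j3 x hx), ?_⟩
      rw [← hmm]
      exact hs.nf_trans (hs.nf_up j4 p2) p5) (by
      intro δ P f hδ hδα hP0 hJ hΦ hcoh hincP
      have hδα := Order.lt_succ_iff.1 hδα
      have hPle : ∀ i < δ, s.le (P i ()) (P δ ()) := fun i hi => (hincP ()).le hi.le le_rfl
      have hinc' := hinc.iic_mono hδα
      have hemb : s.IsEmb (f δ ()) (R δ) (P δ ()) := hA.isEmb_limit hδ hinc' fun i hi =>
        hA.emb_trans_le ((hJ i hi).2.1.congr (hcoh () i hi.le)) (hPle i hi)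
      have h0δ : 0 < δ := hδ.bot_lt
      have hid : ∀ x ∈ (R 0).carrier, f δ () x = x := fun x hx =>
        (hcoh () 0 zero_le hx).symm.trans ((hJ 0 h0δ).2.2.1 x hx)
      have hinj : ∀ i ≤ δ, InjOn (f δ ()) (R i).carrier := fun i hi =>
        hemb.injOn.mono (hA.subset (hinc'.le hi le_rfl))
      have hmc : s.IncCont (fun i => Model.map (f δ ()) (R i)) (Iic δ) :=
        (hinc'.to_succ.map hA fun i hi => hinj i (Order.lt_succ_iff.1 hi)).of_succ
      have hcont := hs.nf_cont δ (fun i => Model.map (f δ ()) (R i)) (P δ ()) e hδ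
        (fun i hi => hA.map_kcard (hcard i (hi.trans hδα)) (hinj i hi)) hmc hemb.le
        (hA.subset (hPle 0 h0δ) (by simpa only [hP0] using he)) fun i hi => by
          have := hs.nf_up (hJ i hi).2.2.2 (hPle i hi)
          rwa [Model.map_congr (hJ i hi).2.1.injOn (hcoh () i hi.le), ← Model.map_of_eqOn_id hid]
            at this
      refine ⟨hA.kcard_union hs.infinite hδ (hδα.trans_lt hα) (hincP ()) fun i hi => (hJ i hi).1,
        hemb, hid, ?_⟩
      rwa [Model.map_of_eqOn_id hid] at hcont)
  have hJ := fun i (hi : i ≤ α) => hJ i (Order.lt_succ_iff.2 hi)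
  have hcoh := fun i (hi : i ≤ α) => hcoh () i α hi (Order.lt_succ α)
  obtain ⟨-, j2, j3, -⟩ := hJ α le_rfl
  obtain ⟨g, hg, g1, -, -⟩ := hA.exists_rename j2 ∅ small_empty
  have hg1 : ∀ i ≤ α, ∀ x ∈ (R i).carrier, g (f i () x) = x := fun i hi x hx => by
    rw [hcoh i hi hx]
    exact g1 x (hA.subset (hinc.le hi le_rfl) hx)
  have hgR : ∀ i ≤ α, Model.map g (Model.map (f i ()) (R i)) = R i := fun i hi =>
    Model.map_map_of_leftInv (hg1 i hi)
  have hg0 : ∀ x ∈ (R 0).carrier, g x = x := fun x hx => by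
    have := hg1 0 zero_le x hx
    rwa [(hJ 0 zero_le).2.2.1 x hx] at this
  refine ⟨fun i => Model.map g (P i ()), g, ((hincP ()).map hA fun _ _ => hg.injOn).of_succ,
    fun i hi => hA.map_kcard (hJ i hi).1 hg.injOn, fun i hi => ?_, fun i hi => ?_, hg,
    by simp only [hP0], hg0, fun i hi => ?_⟩
  · have := hA.map_le (hJ i hi).2.1.le (hg.injOn (s := (P i ()).carrier))
    rwa [hgR i hi] at this
  · have hi' := Order.succ_le_of_lt hi
    have := hs.nf_map (hΦ i (Order.succ_lt_succ_iff.2 hi))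
      (hg.injOn (s := (P (Order.succ i) ()).carrier))
    have hd := (hstep i hi).2.2.2.1
    rwa [hgR i hi.le, hg1 _ hi' _ hd] at this
  · have := hs.nf_map (hJ i hi).2.2.2 (hg.injOn (s := (P i ()).carrier))
    rwa [hgR i hi, Model.map_of_eqOn_id hg0] at this

theorem exists_grid (hs : s.IsSemiGoodExceptLocalCharacter κ)
    {A E : Ordinal.{u} → Model L} {d e : Ordinal.{u} → ZFSet.{u}} {α β : Ordinal.{u}}
    (hdec : s.Decomp κ (s.K3bs κ) A d α) (hdec' : s.Decomp κ (s.K3bs κ) E e β) (h0 : A 0 = E 0) :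
    ∃ G₁ G₂ g, Function.Injective g ∧ (∀ x ∈ (E 0).carrier, g x = x) ∧ s.Lift κ A d α G₁ ∧
      s.Lift κ (fun j => Model.map g (E j)) (fun j => g (e j)) β G₂ ∧
      G₁ 0 = Model.map g (E β) ∧ G₂ 0 = A α ∧ G₁ α = G₂ β := by
  have hA := hs.aec
  obtain ⟨hα, hinc, hcard, hstep⟩ := hdec
  obtain ⟨hβ, hinc', hcard', hstep'⟩ := hdec'
  have hE0 : ∀ j ≤ β, (E 0).carrier ⊆ (E j).carrier := fun j hj =>
    hA.subset (hinc'.le zero_le hj)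
  obtain ⟨P, f, hP0, hf0, hincP, hJ, hΦ, hcoh⟩ := hA.exists_chain (μ := Ordinal.{u}) (ι := Unit)
    (Order.succ β) (fun _ i => (E i).carrier)
    (fun _ i j hij hj => hA.subset (hinc'.le hij (Order.lt_succ_iff.1 hj)))
    (fun j P f => s.IncCont P (Iic α) ∧ (∀ i ≤ α, s.KCard κ (P i)) ∧
      (∀ i ≤ α, s.le (A i) (P i)) ∧ (∀ i < α, s.nf (A i) (P i) (d i) (P (Order.succ i))) ∧
      (InjOn (f ()) (E j).carrier ∧ Model.map (f ()) (E j) = P 0 ∧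
      ∀ x ∈ (E 0).carrier, f () x = x) ∧ ∀ i, s.K (P i))
    (fun j P _ P' f' => s.nf (P 0) (P α) (f' () (e j)) (P' α))
    (fun i => A (min i α)) (fun _ => id) (fun i => (hcard _ (min_le_right _ _)).1)
    (by
      have hmin : ∀ i ≤ α, A (min i α) = A i := fun i hi => by rw [min_eq_left hi]
      refine ⟨(hinc.to_succ.congr fun i hi => (hmin i (Order.lt_succ_iff.1 hi)).symm).of_succ,
        fun i _ => hcard _ (min_le_right _ _), fun i hi => ?_, fun i hi => ?_,
        ⟨injOn_id _, ?_, fun _ _ => rfl⟩, fun i => (hcard _ (min_le_right _ _)).1⟩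
      · simp only [hmin i hi]
        exact hA.le_refl _ (hcard i hi).1
      · simp only [hmin i hi.le, hmin _ (Order.succ_le_of_lt hi)]
        exact hs.nf_refl (hcard i hi.le) (hstep i hi).2.2.2.2.2
      · rw [Model.map_of_eqOn_id (f := (fun _ => id) ()) fun _ _ => rfl, ← h0]
        exact (hmin 0 zero_le).symm) (by
      rintro j P f hj ⟨j1, j2, j3, j4, ⟨j5, j6, j7⟩, j8⟩
      have hj : j < β := Order.succ_lt_succ_iff.1 hj
      obtain ⟨F, hF, hFinj, -⟩ := exists_fresh_injective j5 ∅ small_empty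
      have hFE : Model.map F (E j) = P 0 := (Model.map_congr hFinj.injOn hF).trans j6
      have hK := hs.K3bs_map (hstep' j hj) (hFinj.injOn (s := (E (Order.succ j)).carrier))
      rw [hFE] at hK
      obtain ⟨R, g, r1, r2, r3, r4, r5, r6, r7, r8⟩ := hs.exists_row hα j1 j2
        (fun i hi => hs.K3bs_of_nf (j4 i hi) (j2 _ (Order.succ_le_of_lt hi))) hK
      have hgF : EqOn (f ()) (g ∘ F) (E j).carrier := fun x hx => by
        rw [Function.comp, r7 _ (by rw [← hFE]; exact ⟨x, hx, rfl⟩), hF hx]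
      have hmin : ∀ i ≤ α, (fun i => if i ≤ α then R i else P i) i = R i := fun i hi => if_pos hi
      refine ⟨fun i => if i ≤ α then R i else P i, fun _ => g ∘ F, fun i => ?_, fun _ => hgF, ?_,
        (r1.to_succ.congr fun i hi => (hmin i (Order.lt_succ_iff.1 hi)).symm).of_succ,
        fun i hi => ?_, fun i hi => ?_, fun i hi => ?_, ⟨(r5.comp hFinj).injOn, ?_,
          fun x hx => ?_⟩, fun i => ?_⟩
      · by_cases hi : i ≤ α
        · simp only [hi, if_true, r3]
        · simp only [hi, if_false]
          exact hA.le_refl _ (j8 i)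
      · simp only [le_refl, if_true]
        exact r8 α le_rfl
      · simp only [hi, if_true, r2]
      · simp only [hi, if_true]
        exact hA.trans (j3 i hi) (r3 i hi)
      · simp only [hi.le, Order.succ_le_of_lt hi, if_true]
        exact hs.nf_trans (hs.nf_up (j4 i hi) (r3 _ (Order.succ_le_of_lt hi))) (r4 i hi)
      · simp only [zero_le, if_true]
        rw [← Model.map_map hFinj.injOn r5.injOn, r6]
      · exact (hgF (hE0 j hj.le hx)).symm.trans (j7 x hx)
      · by_cases hi : i ≤ α
        · simp only [hi, if_true, (r2 i hi).1]
        · simp only [hi, if_false, j8]) (by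
      intro δ P f hδ hδβ hP0 hJ hΦ hcoh hincP
      have hδβ := Order.lt_succ_iff.1 hδβ
      have hPle : ∀ i, ∀ j < δ, s.le (P j i) (P δ i) := fun i j hj => (hincP i).le hj.le le_rfl
      have hinc'' := hinc'.iic_mono hδβ
      have h0δ : 0 < δ := hδ.bot_lt
      have hemb : s.IsEmb (f δ ()) (E δ) (P δ 0) := hA.isEmb_limit hδ hinc'' fun j hj => by
        obtain ⟨i1, i2, -⟩ := (hJ j hj).2.2.2.2.1
        refine (isEmb_iff.2 ⟨i1, ?_⟩ : s.IsEmb (f j ()) _ _).congr (hcoh () j hj.le)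
        rw [i2]
        exact hPle 0 j hj
      have hmono : ∀ i ≤ α, ∀ i' ≤ i, s.le (P δ i') (P δ i) := fun i hi i' hi' =>
        hA.le_of_forall_le (M := fun j => P j i') hδ (hincP i') fun j hj =>
          hA.trans ((hJ j hj).1.le hi' hi) (hPle i j hj)
      refine ⟨⟨fun i _ i' hi' hii => hmono i' hi' i hii, fun i hi hil => ⟨?_, fun i' hi' =>
          hA.le_sub _ _ (hmono i hi i' hi'.le)⟩⟩,
        fun i hi => hA.kcard_union (M := fun j => P j i) hs.infinite hδ (hδβ.trans_lt hβ) (hincP i)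
          fun j hj => (hJ j hj).2.1 i hi,
        fun i hi => hA.trans ((hJ 0 h0δ).2.2.1 i hi) (hPle i 0 h0δ), fun i hi => ?_,
        ⟨hemb.injOn, ?_, fun x hx => ?_⟩, fun i => hA.right_mem (hPle i 0 h0δ)⟩
      · refine Subset.antisymm (fun x hx => ?_) (iUnion₂_subset fun i' hi' =>
          hA.subset (hmono i hi i' (le_of_lt hi')))
        obtain ⟨j, hj, hx⟩ := ((hincP i).2 δ self_mem_Iic hδ).mem_iff.1 hx
        obtain ⟨i', hi', hx⟩ := ((hJ j hj).1.2 i hi hil).mem_iff.1 hx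
        exact mem_iUnion₂.2 ⟨i', hi', hA.subset (hPle i' j hj) hx⟩
      · have hi' := Order.succ_le_of_lt hi
        have hnf : ∀ j < δ, s.nf (A i) (P j i) (d i) (P δ (Order.succ i)) := fun j hj =>
          hs.nf_up ((hJ j hj).2.2.2.1 i hi) (hPle _ j hj)
        have h00 : s.nf (P 0 i) (P δ i) (d i) (P δ (Order.succ i)) := by
          refine hs.nf_cont δ (fun j => P j i) _ _ hδ (fun j hj => ?_) (hincP i)
            (hmono _ hi' _ (Order.le_succ i)) (hs.nf_sub _ _ _ _ (hnf 0 h0δ)).2.2.2.2.2.1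
            fun j hj => hs.nf_base (hnf j hj) ((hJ 0 h0δ).2.2.1 i hi.le)
              ((hincP i).le zero_le hj.le) (hA.refl_left (hPle i j hj))
          rcases hj.lt_or_eq with hj | hj
          · exact (hJ j hj).2.1 i hi.le
          · rw [hj]
            exact hA.kcard_union (M := fun j => P j i) hs.infinite hδ (hδβ.trans_lt hβ) (hincP i)
              fun j hj => (hJ j hj).2.1 i hi.le
        exact hs.nf_trans (hnf 0 h0δ) h00
      · refine hA.eq_of_subset hemb.le fun x hx => ?_
        obtain ⟨j, hj, hx⟩ := ((hincP 0).2 δ self_mem_Iic hδ).mem_iff.1 hx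
        obtain ⟨i1, i2, -⟩ := (hJ j hj).2.2.2.2.1
        simp only [← i2] at hx
        obtain ⟨y, hy, rfl⟩ := hx
        exact ⟨y, hA.subset (hinc''.le hj.le le_rfl) hy, (hcoh () j hj.le hy).symm⟩
      · exact (hcoh () 0 zero_le hx).symm.trans ((hJ 0 h0δ).2.2.2.2.1.2.2 x hx))
  have hJ := fun i (hi : i ≤ β) => hJ i (Order.lt_succ_iff.2 hi)
  have hcoh := fun i (hi : i ≤ β) => hcoh () i β hi (Order.lt_succ β)
  obtain ⟨j1, j2, j3, j4, ⟨j5, j6, j7⟩, -⟩ := hJ β le_rfl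
  obtain ⟨g, hgf, hg, -⟩ := exists_fresh_injective j5 ∅ small_empty
  have hgj : ∀ j ≤ β, EqOn g (f j ()) (E j).carrier := fun j hj x hx =>
    (hgf (hA.subset (hinc'.le hj le_rfl) hx)).trans (hcoh j hj hx).symm
  have hgE : ∀ j ≤ β, Model.map g (E j) = P j 0 := fun j hj =>
    (Model.map_congr hg.injOn (hgj j hj)).trans (hJ j hj).2.2.2.2.1.2.1
  refine ⟨P β, fun j => P j α, g, hg, fun x hx => (hgf (hE0 β le_rfl hx)).trans (j7 x hx),
    ⟨j1, j2, j3, j4⟩, ⟨(hincP α).of_succ, fun j hj => (hJ j hj).2.1 α le_rfl, fun j hj => ?_,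
      fun j hj => ?_⟩, (hgE β le_rfl).symm, by simp only [hP0, min_self], rfl⟩
  · simp only [hgE j hj]
    exact (hJ j hj).1.le zero_le le_rfl
  · have hj' := Order.succ_le_of_lt hj
    simp only [hgE j hj.le]
    rw [hgj _ hj' (hstep' j hj).2.2.2.1]
    exact hΦ j (Order.succ_lt_succ_iff.2 hj)

/-- Lifts of decompositions of the two sides of an amalgamation problem can be jointly embedded
over both sides. -/
theorem opposite_unique (hs : s.IsSemiGoodExceptLocalCharacter κ)
    (hQ : s.AdmissibleClass κ (s.K3uq κ)) {A B E F : Ordinal.{u} → Model L}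
    {d e : Ordinal.{u} → ZFSet.{u}} {α β : Ordinal.{u}}
    (hdec : s.Decomp κ (s.K3uq κ) A d α) (hdec' : s.Decomp κ (s.K3uq κ) E e β)
    (hB : s.Lift κ A d α B) (hF : s.Lift κ E e β F) (h0 : A 0 = E 0) {M₁ M₂ : Model L}
    (h1 : s.KCard κ M₁) (h2 : s.KCard κ M₂) (h01 : s.le (A 0) M₁) (h02 : s.le (A 0) M₂)
    (h1A : s.le M₁ (A α)) (h2E : s.le M₂ (E β)) (h2B : s.le M₂ (B 0)) (h1F : s.le M₁ (F 0)) :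
    ∃ P g, s.KCard κ P ∧ s.le (B α) P ∧ s.IsEmb g (F β) P ∧
      ∀ x ∈ M₁.carrier ∪ M₂.carrier, g x = x := by
  have hA := hs.aec
  have hbs : ∀ {A : Ordinal.{u} → Model L} {d : Ordinal.{u} → ZFSet.{u}} {α : Ordinal.{u}},
      s.Decomp κ (s.K3uq κ) A d α → s.Decomp κ (s.K3bs κ) A d α := fun h =>
    ⟨h.1, h.2.1, h.2.2.1, fun i hi => (h.2.2.2 i hi).1⟩
  obtain ⟨G₁, G₂, f, hf, f0, l1, l2, b1, b2, htop⟩ := hs.exists_grid (hbs hdec) (hbs hdec') h0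
  have hdisj : ∀ x, f x ∈ (A α).carrier → x ∈ (E β).carrier → f x = x := by
    intro x hxA hxE
    have h3 := hs.lift_disjoint hQ.reduced hdec l1 _ hxA (by rw [b1]; exact ⟨x, hxE, rfl⟩)
    rw [h0] at h3
    exact hf (f0 _ h3)
  have hdisjB := hs.lift_disjoint hQ.reduced hdec hB
  have hdisjF := hs.lift_disjoint hQ.reduced hdec' hF
  obtain ⟨k, hk, hkE, hk1⟩ := exists_injective_piecewise (f := f) (E β).small M₁.small hf.injOn
    (fun x hx hx1 => f0 x (hdisjF x hx (hA.subset h1F hx1)))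
    (fun x hx hx1 => hdisj x (hA.subset h1A hx1) hx)
  obtain ⟨k', hk', hk'2, hk'A⟩ := exists_injective_piecewise (f := f) M₂.small (A α).small
    hf.injOn (fun x hx hxA => f0 x (h0 ▸ hdisjB x hxA (hA.subset h2B hx)))
    (fun x hx hxA => hdisj x hxA (hA.subset h2E hx))
  have decf := hs.decomp_map hQ hdec' hf
  have hkEj : ∀ j ≤ β, EqOn k f (E j).carrier := fun j hj x hx =>
    hkE (hA.subset (hdec'.2.1.le hj le_rfl) hx)
  have liftk := hs.lift_map hF hk
  have liftk : s.Lift κ (fun j => Model.map f (E j)) (fun j => f (e j)) β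
      (fun j => Model.map k (F j)) := by
    refine ⟨liftk.1, liftk.2.1, fun j hj => ?_, fun j hj => ?_⟩
    · have := liftk.2.2.1 j hj
      simp only [Model.map_congr hk.injOn (hkEj j hj)] at this
      exact this
    · have := liftk.2.2.2 j hj
      simp only [Model.map_congr hk.injOn (hkEj j hj.le),
        hkEj _ (Order.succ_le_of_lt hj) (hdec'.2.2.2 j hj).1.2.2.2.1] at this
      exact this
  have hk'Ai : ∀ i ≤ α, Model.map k' (A i) = A i := fun i hi =>
    Model.map_of_eqOn_id fun x hx => hk'A x (hA.subset (hdec.2.1.le hi le_rfl) hx)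
  have liftk' := hs.lift_map hB hk'
  have liftk' : s.Lift κ A d α (fun i => Model.map k' (B i)) := by
    refine ⟨liftk'.1, liftk'.2.1, fun j hj => ?_, fun j hj => ?_⟩
    · have := liftk'.2.2.1 j hj
      simp only [hk'Ai j hj] at this
      exact this
    · have := liftk'.2.2.2 j hj
      have hd := (hA.subset (hdec.2.1.le (Order.succ_le_of_lt hj) le_rfl)
        (hdec.2.2.2 j hj).1.2.2.2.1)
      simp only [hk'Ai j hj.le, hk'A _ hd] at this
      exact this
  have hfM₀ : Model.map f (E 0) = E 0 := Model.map_of_eqOn_id f0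
  obtain ⟨P₁, g₁, p1, p2, p3, p4, p5⟩ := hs.lift_unique hQ decf l2 liftk h1
    (by simp only [hfM₀]; exact h0 ▸ h01) (by rw [b2]; exact h1A)
    (by
      have := hA.map_le h1F (hk.injOn (s := (F 0).carrier))
      rwa [Model.map_of_eqOn_id hk1] at this)
  have hfk' : Model.map k' M₂ = Model.map f M₂ := Model.map_congr hk'.injOn hk'2
  obtain ⟨P₂, g₂, q1, q2, q3, q4, q5⟩ := hs.lift_unique hQ hdec l1 liftk'
    (hA.map_kcard h2 (hf.injOn (s := M₂.carrier)))
    (hA.le_map_of_id h02 hf.injOn (h0 ▸ f0))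
    (by rw [b1]; exact hA.map_le h2E hf.injOn)
    (by
      have := hA.map_le h2B (hk'.injOn (s := (B 0).carrier))
      rwa [hfk'] at this)
  obtain ⟨P, u, r1, r2, r3, r4⟩ := hs.amalg (l1.2.1 α le_rfl) q1 p1
    (isEmb_of_le (f := id) q2 fun _ _ => rfl) (htop ▸ p2)
  have hBα : s.IsEmb (g₂ ∘ k') (B α) P := hA.emb_comp
    (hA.isEmb_map (hB.2.1 α le_rfl).1 hk'.injOn) (hA.emb_trans_le q3 r2)
  have hFβ : s.IsEmb (u ∘ (g₁ ∘ k)) (F β) P := hA.emb_comp (hA.emb_comp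
    (hA.isEmb_map (hF.2.1 β le_rfl).1 hk.injOn) p3) r3
  obtain ⟨g, hg, g1, g2, -⟩ := hA.exists_rename hBα ∅ small_empty
  refine ⟨Model.map g P, g ∘ (u ∘ (g₁ ∘ k)), hA.map_kcard r1 hg.injOn, g2,
    hA.emb_comp hFβ (hA.isEmb_map r1.1 hg.injOn), ?_⟩
  have hG1 : (A α).carrier ⊆ (G₁ α).carrier := hA.subset (l1.2.2.1 α le_rfl)
  rintro x (hx | hx)
  · have h3 := g1 x (hA.subset (hB.2.2.1 α le_rfl) (hA.subset h1A hx))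
    have h4 : g₂ (k' x) = x := by
      rw [hk'A x (hA.subset h1A hx)]
      exact q4 x (hA.subset h1A hx)
    have h5 : u (g₁ (k x)) = x := by
      rw [hk1 x hx, p5 x hx]
      exact r4 (hG1 (hA.subset h1A hx))
    rw [Function.comp, h4] at h3
    exact (congrArg g h5).trans h3
  · have h3 := g1 x (hA.subset (hB.1.le zero_le le_rfl) (hA.subset h2B hx))
    have h4 : g₂ (k' x) = f x := by
      rw [hk'2 hx]
      exact q5 _ ⟨x, hx, rfl⟩
    have h5 : u (g₁ (k x)) = f x := by
      have h6 : f x ∈ (G₁ 0).carrier := by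
        rw [b1]
        exact ⟨x, hA.subset h2E hx, rfl⟩
      rw [hkE (hA.subset h2E hx), p4 _ ⟨x, hA.subset h2E hx, rfl⟩]
      exact r4 (hA.subset (l1.1.le zero_le le_rfl) h6)
    rw [Function.comp, h4] at h3
    exact (congrArg g h5).trans h3

end IsSemiGoodExceptLocalCharacter

end FrameData

namespace ModelClass

variable {L : FirstOrder.Language.{u, u}} {C : ModelClass L}

theorem IncCont.append {M : Ordinal.{u} → Model L} {α : Ordinal.{u}} {X : Model L}
    (hA : C.IsAEC) (h : C.IncCont M (Iic α)) (hX : C.le (M α) X) :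
    C.IncCont (Function.update M (Order.succ α) X) (Iic (Order.succ α)) := by
  have hlow : ∀ i ≤ α, Function.update M (Order.succ α) X i = M i := fun i hi =>
    Function.update_of_ne (Order.lt_succ_iff.2 hi).ne _ _
  refine ⟨fun i (hi : i ≤ _) j (hj : j ≤ _) hij => ?_, fun i (hi : i ≤ _) hl => ?_⟩
  · rcases hj.lt_or_eq with hj | rfl
    · have hj := Order.lt_succ_iff.1 hj
      rw [hlow j hj, hlow i (hij.trans hj)]
      exact h.le hij hj
    · rw [Function.update_self]
      rcases hi.lt_or_eq with hi | rfl
      · have hi := Order.lt_succ_iff.1 hi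
        rw [hlow i hi]
        exact hA.trans (h.le hi le_rfl) hX
      · rw [Function.update_self]
        exact hA.refl_right hX
  · have hi : i ≤ α := Order.lt_succ_iff.1 (hi.lt_of_ne fun he =>
      Order.not_isSuccLimit_succ _ (he ▸ hl))
    rw [hlow i hi]
    exact (h.2 i hi hl).congr fun j hj => (hlow j (hj.le.trans hi)).symm

end ModelClass

namespace FrameData

variable {L : FirstOrder.Language.{u, u}} {s : FrameData L} {κ : Cardinal.{u}}

open ModelClass

namespace IsSemiGoodExceptLocalCharacter

theorem isSuccLimit_ord_succ (hs : s.IsSemiGoodExceptLocalCharacter κ) :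
    Order.IsSuccLimit (Order.succ κ).ord :=
  Cardinal.isSuccLimit_ord (hs.infinite.trans (Order.le_succ κ))

theorem nfStar_of_lift (hs : s.IsSemiGoodExceptLocalCharacter κ)
    {A B : Ordinal.{u} → Model L} {d : Ordinal.{u} → ZFSet.{u}} {α : Ordinal.{u}}
    (hdec : s.Decomp κ (s.K3uq κ) A d α) (hB : s.Lift κ A d α B) :
    s.NFStar κ (A 0) (A α) (B 0) (B α) := by
  have hA := hs.aec
  obtain ⟨hα, hinc, hcard, hstep⟩ := hdec
  obtain ⟨hincB, hcardB, hle, hnf⟩ := hB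
  exact ⟨hcard 0 zero_le, hcard α le_rfl, hcardB 0 zero_le, hcardB α le_rfl,
    hinc.le zero_le le_rfl, hle α le_rfl, hle 0 zero_le, hincB.le zero_le le_rfl, α, hα, A, B, d,
    fun i hi => ⟨hcard i hi, hcardB i hi⟩, hinc, hincB, rfl, rfl, rfl, rfl, hle,
    fun i hi => ⟨(hstep i hi).1.2.2.2.1, (hstep i hi).1.2.2.2.2.1⟩, hstep, hnf⟩

theorem exists_lift_of_nfStar {N₀ N₁ N₂ N₃ : Model L} (h : s.NFStar κ N₀ N₁ N₂ N₃) :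
    ∃ α A B d, s.Decomp κ (s.K3uq κ) A d α ∧ s.Lift κ A d α B ∧ A 0 = N₀ ∧ A α = N₁ ∧
      B 0 = N₂ ∧ B α = N₃ := by
  obtain ⟨-, -, -, -, -, -, -, -, α, hα, A, B, d, h1, h2, h3, h4, h5, h6, h7, h8, -, h9, h10⟩ := h
  exact ⟨α, A, B, d, ⟨hα, h2, fun i hi => (h1 i hi).1, h9⟩,
    ⟨h3, fun i hi => (h1 i hi).2, h8, h10⟩, h4, h5, h6, h7⟩

theorem decomp_append (hs : s.IsSemiGoodExceptLocalCharacter κ)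
    {A : Ordinal.{u} → Model L} {d : Ordinal.{u} → ZFSet.{u}} {α : Ordinal.{u}}
    (hdec : s.Decomp κ (s.K3uq κ) A d α) {X : Model L} {a : ZFSet.{u}}
    (hX : s.K3uq κ (A α) X a) :
    s.Decomp κ (s.K3uq κ) (Function.update A (Order.succ α) X) (Function.update d α a)
      (Order.succ α) := by
  obtain ⟨hα, hinc, hcard, hstep⟩ := hdec
  have hlow : ∀ i ≤ α, Function.update A (Order.succ α) X i = A i := fun i hi =>
    Function.update_of_ne (Order.lt_succ_iff.2 hi).ne _ _
  refine ⟨hs.isSuccLimit_ord_succ.succ_lt hα, hinc.append hs.aec hX.1.2.2.1, fun i hi => ?_,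
    fun i hi => ?_⟩
  · rcases hi.lt_or_eq with hi | rfl
    · rw [hlow i (Order.lt_succ_iff.1 hi)]
      exact hcard i (Order.lt_succ_iff.1 hi)
    · rw [Function.update_self]
      exact hX.1.2.1
  · rcases (Order.lt_succ_iff.1 hi).lt_or_eq with hi | rfl
    · rw [hlow i hi.le, hlow _ (Order.succ_le_of_lt hi), Function.update_of_ne hi.ne]
      exact hstep i hi
    · rw [hlow i le_rfl, Function.update_self, Function.update_self]
      exact hX

theorem lift_append (hs : s.IsSemiGoodExceptLocalCharacter κ)
    {A B : Ordinal.{u} → Model L} {d : Ordinal.{u} → ZFSet.{u}} {α : Ordinal.{u}}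
    (hB : s.Lift κ A d α B) {X Y : Model L} {a : ZFSet.{u}} (hXY : s.le X Y)
    (hY : s.KCard κ Y) (hnf : s.nf (A α) (B α) a Y) :
    s.Lift κ (Function.update A (Order.succ α) X) (Function.update d α a) (Order.succ α)
      (Function.update B (Order.succ α) Y) := by
  obtain ⟨hinc, hcard, hle, hstep⟩ := hB
  have hlow : ∀ (A : Ordinal.{u} → Model L) X, ∀ i ≤ α,
      Function.update A (Order.succ α) X i = A i := fun A X i hi =>
    Function.update_of_ne (Order.lt_succ_iff.2 hi).ne _ _
  refine ⟨hinc.append hs.aec (hs.nf_sub _ _ _ _ hnf).2.2.2.2.1, fun i hi => ?_, fun i hi => ?_,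
    fun i hi => ?_⟩
  · rcases hi.lt_or_eq with hi | rfl
    · rw [hlow _ _ i (Order.lt_succ_iff.1 hi)]
      exact hcard i (Order.lt_succ_iff.1 hi)
    · rwa [Function.update_self]
  · rcases hi.lt_or_eq with hi | rfl
    · rw [hlow _ _ i (Order.lt_succ_iff.1 hi), hlow _ _ i (Order.lt_succ_iff.1 hi)]
      exact hle i (Order.lt_succ_iff.1 hi)
    · rwa [Function.update_self, Function.update_self]
  · rcases (Order.lt_succ_iff.1 hi).lt_or_eq with hi | rfl
    · rw [hlow _ _ i hi.le, hlow _ _ i hi.le, hlow _ _ _ (Order.succ_le_of_lt hi),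
        Function.update_of_ne hi.ne]
      exact hstep i hi
    · rwa [hlow _ _ i le_rfl, hlow _ _ i le_rfl, Function.update_self, Function.update_self]

/-- Uniqueness triples over a given model, away from a small set. -/
theorem exists_fresh_k3uq (hs : s.IsSemiGoodExceptLocalCharacter κ)
    (hQ : s.AdmissibleClass κ (s.K3uq κ)) {M : Model L} (hM : s.KCard κ M) (Z : Set ZFSet.{u})
    (hZ : Small.{u} Z) :
    ∃ X a, s.K3uq κ M X a ∧ ∀ x ∈ X.carrier, x ∈ Z → x ∈ M.carrier := by
  obtain ⟨N, kN, hlt⟩ := hs.exists_lt hM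
  obtain ⟨b, b1, b2, b3⟩ := hs.basic_density _ _ hM kN hlt
  obtain ⟨X, a, -, h1⟩ := hQ.exists_mem M N b ⟨hM, kN, hlt.1, b1, b2, b3⟩
  obtain ⟨g, hg, g1, -, -, -, g2⟩ := hs.exists_fresh_copy h1.1.2.1 h1.1.2.2.1 Z hZ
  have := hQ.map_mem _ _ _ g h1 hg.injOn
  rw [Model.map_of_eqOn_id g1] at this
  exact ⟨_, _, this, g2⟩

/-- For `NF` it suffices that `M₃` is compatible with the top of a lift. -/
theorem NF_of_lift (hs : s.IsSemiGoodExceptLocalCharacter κ)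
    (hQ : s.AdmissibleClass κ (s.K3uq κ)) {A B : Ordinal.{u} → Model L}
    {d : Ordinal.{u} → ZFSet.{u}} {α : Ordinal.{u}} (hdec : s.Decomp κ (s.K3uq κ) A d α)
    (hB : s.Lift κ A d α B) {M₁ M₂ M₃ Z : Model L} (k1 : s.KCard κ M₁) (k2 : s.KCard κ M₂)
    (k3 : s.KCard κ M₃) (h01 : s.le (A 0) M₁) (h02 : s.le (A 0) M₂) (h13 : s.le M₁ M₃)
    (h23 : s.le M₂ M₃) (h1 : s.le M₁ (A α)) (h2 : s.le M₂ (B 0)) (h3 : s.le M₃ Z)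
    (hBZ : s.le (B α) Z) : s.NF κ (A 0) M₁ M₂ M₃ := by
  have hA := hs.aec
  obtain ⟨Z, kZ, -, h3, hBZ⟩ := hs.shrink_pair k3 (hB.2.1 α le_rfl) h3 hBZ
  obtain ⟨X, a, hX, hXZ⟩ := hs.exists_fresh_k3uq hQ (hdec.2.2.1 α le_rfl) Z.carrier Z.small
  have hAZ : s.le (A α) Z := hA.trans (hB.2.2.1 α le_rfl) hBZ
  obtain ⟨Y, kY, hZY, hXY, hnf, -⟩ := hs.exists_lift_step (hQ.reduced _ _ _ hX) kZ hAZ hXZ ∅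
    small_empty
  have hB' := hs.lift_append hB hXY kY
    (hs.nf_base hnf (hA.refl_left hAZ) (hB.2.2.1 α le_rfl) hBZ)
  have hst := hs.nfStar_of_lift (hs.decomp_append hdec hX) hB'
  have hne : (0 : Ordinal.{u}) ≠ Order.succ α := (Order.succ_ne_bot α).symm
  rw [Function.update_of_ne hne, Function.update_self, Function.update_of_ne hne,
    Function.update_self] at hst
  exact ⟨⟨hdec.2.2.1 0 zero_le, k1, k2, k3⟩, h01, h13, h02, h23, _, _, _, _, rfl,
    hA.refl_left h01, hA.trans h1 hX.1.2.2.1, h2, hA.trans h3 hZY, hst⟩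

theorem exists_lift_of_NF {M₀ M₁ M₂ M₃ : Model L} (h : s.NF κ M₀ M₁ M₂ M₃) :
    ∃ α A B d, s.Decomp κ (s.K3uq κ) A d α ∧ s.Lift κ A d α B ∧ A 0 = M₀ ∧ s.le M₁ (A α) ∧
      s.le M₂ (B 0) ∧ s.le M₃ (B α) := by
  obtain ⟨-, -, -, -, -, N₀, N₁, N₂, N₃, rfl, -, h1, h2, h3, h⟩ := h
  obtain ⟨α, A, B, d, hdec, hB, rfl, rfl, rfl, rfl⟩ := exists_lift_of_nfStar h
  exact ⟨α, A, B, d, hdec, hB, rfl, h1, h2, h3⟩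

theorem NF_transfer (hs : s.IsSemiGoodExceptLocalCharacter κ)
    (hQ : s.AdmissibleClass κ (s.K3uq κ)) {A B : Ordinal.{u} → Model L}
    {d : Ordinal.{u} → ZFSet.{u}} {α : Ordinal.{u}} (hdec : s.Decomp κ (s.K3uq κ) A d α)
    (hB : s.Lift κ A d α B) {M₁ M₂ N P : Model L} {g : ZFSet.{u} → ZFSet.{u}}
    (k1 : s.KCard κ M₁) (k2 : s.KCard κ M₂) (kN : s.KCard κ N) (h01 : s.le (A 0) M₁)
    (h02 : s.le (A 0) M₂) (h1N : s.le M₁ N) (h2N : s.le M₂ N) (h1 : s.le M₁ (A α))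
    (h2 : s.le M₂ (B 0)) (hg : s.IsEmb g N P) (hid : ∀ x ∈ M₁.carrier ∪ M₂.carrier, g x = x)
    (hBP : s.le (B α) P) : s.NF κ (A 0) M₁ M₂ N := by
  have hA := hs.aec
  obtain ⟨k, hk, k1', k2', -⟩ := hA.exists_rename hg ∅ small_empty
  have hkid : ∀ x ∈ M₁.carrier ∪ M₂.carrier, k x = x := fun x hx => by
    have := k1' x (hx.elim (fun h => hA.subset h1N h) fun h => hA.subset h2N h)
    rwa [hid x hx] at this
  have hM₁ : Model.map k M₁ = M₁ := Model.map_of_eqOn_id fun x hx => hkid x (Or.inl hx)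
  have hM₂ : Model.map k M₂ = M₂ := Model.map_of_eqOn_id fun x hx => hkid x (Or.inr hx)
  have hM₀ : Model.map k (A 0) = A 0 :=
    Model.map_of_eqOn_id fun x hx => hkid x (Or.inl (hA.subset h01 hx))
  have := hs.NF_of_lift hQ (hs.decomp_map hQ hdec hk) (hs.lift_map hB hk) k1 k2 kN
    (hM₀.symm ▸ h01) (hM₀.symm ▸ h02) h1N h2N
    (by have := hA.map_le h1 (hk.injOn (s := (A α).carrier)); rwa [hM₁] at this)
    (by have := hA.map_le h2 (hk.injOn (s := (B 0).carrier)); rwa [hM₂] at this) k2'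
    (hA.map_le hBP hk.injOn)
  rwa [hM₀] at this

theorem NF_isoClosed (hs : s.IsSemiGoodExceptLocalCharacter κ)
    (hQ : s.AdmissibleClass κ (s.K3uq κ)) : IsoClosed (s.NF κ) := by
  intro f M₀ M₁ M₂ M₃ M₀' M₁' M₂' M₃' h i3 i0 i1 i2
  have hA := hs.aec
  obtain ⟨hf, rfl⟩ := Model.isIso_iff.1 i3
  obtain ⟨-, rfl⟩ := Model.isIso_iff.1 i0
  obtain ⟨-, rfl⟩ := Model.isIso_iff.1 i1
  obtain ⟨-, rfl⟩ := Model.isIso_iff.1 i2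
  obtain ⟨⟨k0, k1, k2, k3⟩, h01, h13, h02, h23, -⟩ := id h
  obtain ⟨α, A, B, d, hdec, hB, rfl, h1, h2, h3⟩ := exists_lift_of_NF h
  obtain ⟨F, hF, hFi, -⟩ := exists_fresh_injective hf ∅ small_empty
  have hmap : ∀ M, s.le M M₃ → Model.map f M = Model.map F M := fun M hM =>
    (Model.map_congr hFi.injOn (hF.mono (hA.subset hM))).symm
  rw [hmap _ (hA.trans h01 h13), hmap _ h13, hmap _ h23, hmap _ (hA.refl_right h13)]
  exact hs.NF_of_lift hQ (hs.decomp_map hQ hdec hFi) (hs.lift_map hB hFi)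
    (hA.map_kcard k1 hFi.injOn) (hA.map_kcard k2 hFi.injOn) (hA.map_kcard k3 hFi.injOn)
    (hA.map_le h01 hFi.injOn) (hA.map_le h02 hFi.injOn) (hA.map_le h13 hFi.injOn)
    (hA.map_le h23 hFi.injOn) (hA.map_le h1 hFi.injOn) (hA.map_le h2 hFi.injOn)
    (hA.map_le h3 hFi.injOn) (hA.le_refl _ (hA.map_mem (hB.2.1 α le_rfl).1 hFi.injOn))

theorem NF_mono (hs : s.IsSemiGoodExceptLocalCharacter κ)
    (hQ : s.AdmissibleClass κ (s.K3uq κ)) {M₀ M₁ M₂ M₃ N₁ N₂ N₃ P : Model L}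
    (h : s.NF κ M₀ M₁ M₂ M₃) (k1 : s.KCard κ N₁) (k2 : s.KCard κ N₂) (k3 : s.KCard κ N₃)
    (h1 : s.le N₁ M₁) (h2 : s.le N₂ M₂) (h01 : s.le M₀ N₁) (h13 : s.le N₁ N₃)
    (h02 : s.le M₀ N₂) (h23 : s.le N₂ N₃) (hM₃ : s.le M₃ P) (hN₃ : s.le N₃ P) :
    s.NF κ M₀ N₁ N₂ N₃ := by
  have hA := hs.aec
  obtain ⟨⟨-, -, -, k3'⟩, -, h13', -, h23', -⟩ := id h
  obtain ⟨α, A, B, d, hdec, hB, rfl, h1', h2', h3'⟩ := exists_lift_of_NF h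
  obtain ⟨P, kP, -, hM₃, hN₃⟩ := hs.shrink_pair k3' k3 hM₃ hN₃
  obtain ⟨Q, f, q1, q2, q3, q4⟩ := hs.amalg k3' (hB.2.1 α le_rfl) kP
    (isEmb_of_le (f := id) h3' fun _ _ => rfl) hM₃
  exact hs.NF_transfer hQ hdec hB k1 k2 k3 h01 h02 h13 h23 (hA.trans h1 h1') (hA.trans h2 h2')
    (hA.emb_of_le q3 hN₃) (fun x hx => q4 (hx.elim
      (fun h => hA.subset (hA.trans h1 h13') h) fun h => hA.subset (hA.trans h2 h23') h)) q2

theorem NF_disjoint (hs : s.IsSemiGoodExceptLocalCharacter κ)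
    (hQ : s.AdmissibleClass κ (s.K3uq κ)) {M₀ M₁ M₂ M₃ : Model L}
    (h : s.NF κ M₀ M₁ M₂ M₃) : ∀ x ∈ M₁.carrier, x ∈ M₂.carrier → x ∈ M₀.carrier := by
  obtain ⟨α, A, B, d, hdec, hB, rfl, h1, h2, -⟩ := exists_lift_of_NF h
  exact fun x hx1 hx2 => hs.lift_disjoint hQ.reduced hdec hB x (hs.aec.subset h1 hx1)
    (hs.aec.subset h2 hx2)

theorem exists_lift_over (hs : s.IsSemiGoodExceptLocalCharacter κ)
    (hQ : s.AdmissibleClass κ (s.K3uq κ)) {M₀ M₁ M₂ : Model L} (k0 : s.KCard κ M₀)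
    (k1 : s.KCard κ M₁) (k2 : s.KCard κ M₂) (h01 : s.le M₀ M₁) (h02 : s.le M₀ M₂)
    (hdisj : ∀ x ∈ M₁.carrier, x ∈ M₂.carrier → x ∈ M₀.carrier) (Z : Set ZFSet.{u})
    (hZ : Small.{u} Z) (a : ZFSet.{u}) :
    ∃ α A B d, s.Decomp κ (s.K3uq κ) A d α ∧ s.Lift κ A d α B ∧ A 0 = M₀ ∧ s.le M₁ (A α) ∧
      B 0 = M₂ ∧ (∀ z ∈ (B α).carrier, z ∈ Z → z ∈ M₁.carrier ∨ z ∈ M₂.carrier) ∧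
      (s.K3bs κ M₀ M₁ a → 0 < α ∧ d 0 = a) := by
  have hA := hs.aec
  have hsm : Small.{u} ↥(Z ∪ M₂.carrier) := by
    have := M₂.small
    exact small_union _ _
  obtain ⟨α, A, d, hdec, rfl, h1, hd⟩ := hs.exists_decomp hQ k0 k1 h01 a
  obtain ⟨g, hg, g1, g2, g3, g4, g5⟩ := hs.exists_fresh_copy (hdec.2.2.1 α le_rfl) h1 _ hsm
  have hg0 : Model.map g (A 0) = A 0 :=
    Model.map_of_eqOn_id fun x hx => g1 x (hA.subset h01 hx)
  obtain ⟨B, hB, rfl, hfresh⟩ := hs.exists_lift hQ.reduced (hs.decomp_map hQ hdec hg) k2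
    (by simp only [hg0]; exact h02) (fun x hx hx2 => by
      simp only [hg0]
      exact hdisj x (g5 x hx (Or.inr hx2)) hx2) Z hZ
  refine ⟨α, _, B, _, hs.decomp_map hQ hdec hg, hB, hg0, g3, rfl, fun z hz hzZ => ?_,
    fun h => ⟨(hd h).1, ?_⟩⟩
  · exact (hfresh z hz hzZ).elim Or.inr fun h => Or.inl (g5 z h (Or.inl hzZ))
  · simp only [(hd h).2]
    exact g1 a h.2.2.2.1

theorem exists_NF (hs : s.IsSemiGoodExceptLocalCharacter κ)
    (hQ : s.AdmissibleClass κ (s.K3uq κ)) {M₀ M₁ M₂ : Model L} (k0 : s.KCard κ M₀)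
    (k1 : s.KCard κ M₁) (k2 : s.KCard κ M₂) (h01 : s.le M₀ M₁) (h02 : s.le M₀ M₂)
    (hdisj : ∀ x ∈ M₁.carrier, x ∈ M₂.carrier → x ∈ M₀.carrier) (Z : Set ZFSet.{u})
    (hZ : Small.{u} Z) :
    ∃ M₃, s.NF κ M₀ M₁ M₂ M₃ ∧ ∀ z ∈ M₃.carrier, z ∈ Z → z ∈ M₁.carrier ∨ z ∈ M₂.carrier := by
  have hA := hs.aec
  obtain ⟨α, A, B, d, hdec, hB, rfl, h1, rfl, hfresh, -⟩ :=
    hs.exists_lift_over hQ k0 k1 k2 h01 h02 hdisj Z hZ ∅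
  exact ⟨B α, hs.NF_of_lift hQ hdec hB k1 k2 (hB.2.1 α le_rfl) h01 h02
    (hA.trans h1 (hB.2.2.1 α le_rfl)) (hB.1.le zero_le le_rfl) h1 (hA.refl_right h02)
    (hA.refl_right (hB.2.2.1 α le_rfl)) (hA.refl_right (hB.2.2.1 α le_rfl)), hfresh⟩

/-- A lift of a decomposition of the second side embeds over an `NF`-amalgam. -/
theorem exists_opposite (hs : s.IsSemiGoodExceptLocalCharacter κ)
    (hQ : s.AdmissibleClass κ (s.K3uq κ)) {M₀ M₁ M₂ M₃ : Model L} (h : s.NF κ M₀ M₁ M₂ M₃)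
    {E F : Ordinal.{u} → Model L} {e : Ordinal.{u} → ZFSet.{u}} {β : Ordinal.{u}}
    (hdec : s.Decomp κ (s.K3uq κ) E e β) (hF : s.Lift κ E e β F) (hE0 : E 0 = M₀)
    (h2E : s.le M₂ (E β)) (h1F : s.le M₁ (F 0)) :
    ∃ P g, s.KCard κ P ∧ s.le (F β) P ∧ s.IsEmb g M₃ P ∧
      ∀ x ∈ M₁.carrier ∪ M₂.carrier, g x = x := by
  have hA := hs.aec
  obtain ⟨⟨-, k1, k2, k3⟩, h01, h13, h02, h23, -⟩ := id h
  obtain ⟨α, A, B, d, hdec', hB, rfl, h1, h2, h3⟩ := exists_lift_of_NF h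
  obtain ⟨P, g, p1, p2, p3, p4⟩ := hs.opposite_unique hQ hdec' hdec hB hF hE0.symm k1 k2 h01 h02
    h1 h2E h2 h1F
  obtain ⟨k, hk, hk1, hk2, -⟩ := hA.exists_rename p3 ∅ small_empty
  refine ⟨Model.map k P, k, hA.map_kcard p1 hk.injOn, hk2,
    hA.emb_of_le (hA.isEmb_map p1.1 hk.injOn) (hA.trans h3 p2), fun x hx => ?_⟩
  have := hk1 x (hx.elim (fun h => hA.subset (hA.trans h1F (hF.1.le zero_le le_rfl)) h)
    fun h => hA.subset (hA.trans h2E (hF.2.2.1 β le_rfl)) h)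
  rwa [p4 x hx] at this

theorem NF_unique (hs : s.IsSemiGoodExceptLocalCharacter κ)
    (hQ : s.AdmissibleClass κ (s.K3uq κ)) {M₀ M₁ M₂ M₃ N₃ : Model L}
    (h : s.NF κ M₀ M₁ M₂ M₃) (h' : s.NF κ M₀ M₁ M₂ N₃) :
    ∃ P g, s.KCard κ P ∧ s.le M₃ P ∧ s.IsEmb g N₃ P ∧
      ∀ x ∈ M₁.carrier ∪ M₂.carrier, g x = x := by
  have hA := hs.aec
  obtain ⟨⟨k0, k1, k2, -⟩, h01, h13, h02, h23, -⟩ := id h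
  obtain ⟨β, E, F, e, hdec, hF, hE0, h2E, hF0, -, -⟩ := hs.exists_lift_over hQ k0 k2 k1 h02 h01
    (fun x hx2 hx1 => hs.NF_disjoint hQ h x hx1 hx2) ∅ small_empty ∅
  have h1F : s.le M₁ (F 0) := by
    rw [hF0]
    exact hA.refl_right h01
  obtain ⟨P, g, p1, p2, p3, p4⟩ := hs.exists_opposite hQ h hdec hF hE0 h2E h1F
  obtain ⟨P', g', p1', p2', p3', p4'⟩ := hs.exists_opposite hQ h' hdec hF hE0 h2E h1F
  obtain ⟨Q, f, q1, q2, q3, q4⟩ := hs.amalg (hF.2.1 β le_rfl) p1 p1'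
    (isEmb_of_le (f := id) p2 fun _ _ => rfl) p2'
  obtain ⟨k, hk, hk1, hk2, -⟩ := hA.exists_rename (hA.emb_trans_le p3 q2) ∅ small_empty
  refine ⟨Model.map k Q, k ∘ (f ∘ g'), hA.map_kcard q1 hk.injOn, hk2,
    hA.emb_comp (hA.emb_comp p3' q3) (hA.isEmb_map q1.1 hk.injOn), fun x hx => ?_⟩
  have h3 : x ∈ (F β).carrier := hx.elim
    (fun h => hA.subset (hA.trans h1F (hF.1.le zero_le le_rfl)) h)
    fun h => hA.subset (hA.trans h2E (hF.2.2.1 β le_rfl)) h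
  have h4 := hk1 x (hx.elim (fun h => hA.subset h13 h) fun h => hA.subset h23 h)
  rw [p4 x hx] at h4
  rw [Function.comp, Function.comp, p4' x hx, q4 h3]
  exact h4

theorem NF_symm (hs : s.IsSemiGoodExceptLocalCharacter κ)
    (hQ : s.AdmissibleClass κ (s.K3uq κ)) {M₀ M₁ M₂ M₃ : Model L}
    (h : s.NF κ M₀ M₁ M₂ M₃) : s.NF κ M₀ M₂ M₁ M₃ := by
  have hA := hs.aec
  obtain ⟨⟨k0, k1, k2, k3⟩, h01, h13, h02, h23, -⟩ := id h
  obtain ⟨β, E, F, e, hdec, hF, rfl, h2E, hF0, -, -⟩ := hs.exists_lift_over hQ k0 k2 k1 h02 h01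
    (fun x hx2 hx1 => hs.NF_disjoint hQ h x hx1 hx2) ∅ small_empty ∅
  have h1F : s.le M₁ (F 0) := by
    rw [hF0]
    exact hA.refl_right h01
  obtain ⟨P, g, p1, p2, p3, p4⟩ := hs.exists_opposite hQ h hdec hF rfl h2E h1F
  exact hs.NF_transfer hQ hdec hF k2 k1 k3 h02 h01 h23 h13 h2E h1F p3
    (fun x hx => p4 x hx.symm) p2

theorem NF_respects (hs : s.IsSemiGoodExceptLocalCharacter κ)
    (hQ : s.AdmissibleClass κ (s.K3uq κ)) : s.Respects (s.NF κ) := by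
  intro M₀ M₁ M₂ M₃ a h ha
  have hA := hs.aec
  obtain ⟨⟨k0, k1, k2, k3⟩, h01, h13, h02, h23, -⟩ := id h
  have hbs := hs.K3bs_of_tp_eq k0 k1 ha
  obtain ⟨α, A, B, d, hdec, hB, rfl, h1, rfl, -, hd⟩ := hs.exists_lift_over hQ k0 k1 k2 h01 h02
    (hs.NF_disjoint hQ h) ∅ small_empty a
  obtain ⟨hα, rfl⟩ := hd hbs
  have hBα := hA.refl_right (hB.2.2.1 α le_rfl)
  have hNF := hs.NF_of_lift hQ hdec hB k1 k2 (hB.2.1 α le_rfl) h01 h02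
    (hA.trans h1 (hB.2.2.1 α le_rfl)) (hB.1.le zero_le le_rfl) h1 (hA.refl_right h02) hBα hBα
  have hnf := hs.nf_up (hB.2.2.2 0 hα) (hB.1.le (Order.succ_le_of_lt hα) le_rfl)
  obtain ⟨P, g, p1, p2, p3, p4⟩ := hs.NF_unique hQ h hNF
  have := hs.nf_emb_over hnf p3 fun x hx => p4 x (Or.inr hx)
  rw [p4 _ (Or.inl hbs.2.2.2.1)] at this
  exact hs.nf_down this p2 h23 (hA.subset h13 hbs.2.2.2.1)

end IsSemiGoodExceptLocalCharacter

end FrameData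

/-- `𝒞` is a set of points between `a` and `b`, closed under suprema of chains, every point of which
other than `b` lies strictly below a point of `𝒞` to which it is related by `r`. -/
structure Climb {X : Type*} [CompleteLattice X] (r : X → X → Prop) (a b : X) (𝒞 : Set X) :
    Prop where
  left_mem : a ∈ 𝒞
  right_mem : b ∈ 𝒞
  left_le : ∀ x ∈ 𝒞, a ≤ x
  le_right : ∀ x ∈ 𝒞, x ≤ b
  step : ∀ x ∈ 𝒞, x ≠ b → ∃ y ∈ 𝒞, x < y ∧ r x y
  sup : ∀ T ⊆ 𝒞, T.Nonempty → IsChain (· ≤ ·) T → sSup T ∈ 𝒞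

namespace Climb

variable {X : Type*} [CompleteLattice X] {r : X → X → Prop} {a b : X}

theorem refl (a : X) : Climb r a a {a} := by
  refine ⟨rfl, rfl, fun x hx => (eq_of_mem_singleton hx).ge, fun x hx => (eq_of_mem_singleton hx).le,
    fun x hx h => absurd hx h, fun T hT hne _ => ?_⟩
  rw [hne.subset_singleton_iff.1 hT, sSup_singleton]
  rfl

theorem single (hab : a < b) (hr : r a b) : Climb r a b {a, b} := by
  have hle : ∀ x ∈ ({a, b} : Set X), x ≤ b := by
    rintro x (rfl | rfl)
    exacts [hab.le, le_rfl]
  refine ⟨Or.inl rfl, Or.inr rfl, ?_, hle, ?_, fun T hT hne _ => ?_⟩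
  · rintro x (rfl | rfl)
    exacts [le_rfl, hab.le]
  · rintro x (rfl | rfl) hx
    exacts [⟨b, Or.inr rfl, hab, hr⟩, absurd rfl hx]
  · by_cases hb : b ∈ T
    · exact Or.inr (le_antisymm (sSup_le fun x hx => hle x (hT hx)) (le_sSup hb))
    · have : T ⊆ {a} := fun x hx => (hT hx).resolve_right fun h => hb (h ▸ hx)
      rw [hne.subset_singleton_iff.1 this, sSup_singleton]
      exact Or.inl rfl

/-- Climbs along the steps of a continuous sequence compose. -/
theorem concat {y : Ordinal.{u} → X} {α : Ordinal.{u}}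
    (hmono : ∀ i j, i ≤ j → j ≤ α → y i ≤ y j)
    (hcont : ∀ δ ≤ α, Order.IsSuccLimit δ → ∀ z, (∀ i < δ, y i ≤ z) → y δ ≤ z)
    (hstep : ∀ i < α, ∃ 𝒞, Climb r (y i) (y (Order.succ i)) 𝒞) : ∃ 𝒞, Climb r (y 0) (y α) 𝒞 := by
  choose! 𝒟 hD using hstep
  have hup : ∀ i < α, ∀ x ∈ 𝒟 i, x ≤ y (Order.succ i) := fun i hi => (hD i hi).le_right
  have hlow : ∀ i < α, ∀ x ∈ 𝒟 i, y i ≤ x := fun i hi => (hD i hi).left_le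
  have hmem : ∀ i ≤ α, y i = y α ∨ ∃ j < α, y i ∈ 𝒟 j := fun i hi =>
    hi.eq_or_lt.imp (congrArg y) fun h => ⟨i, h, (hD i h).left_mem⟩
  have hle : ∀ x, (x = y α ∨ ∃ i < α, x ∈ 𝒟 i) → x ≤ y α := by
    rintro x (rfl | ⟨i, hi, hx⟩)
    exacts [le_rfl, (hup i hi x hx).trans (hmono _ _ (Order.succ_le_of_lt hi) le_rfl)]
  refine ⟨{x | x = y α ∨ ∃ i < α, x ∈ 𝒟 i}, hmem 0 zero_le, Or.inl rfl, ?_, hle, ?_,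
    fun T hT hne hchain => ?_⟩
  · rintro x (rfl | ⟨i, hi, hx⟩)
    exacts [hmono _ _ zero_le le_rfl, (hmono _ _ zero_le hi.le).trans (hlow i hi x hx)]
  · rintro x (rfl | ⟨i, hi, hx⟩) hxα
    · exact absurd rfl hxα
    by_cases hxi : x = y (Order.succ i)
    · obtain ⟨k, ⟨hk, hkα, hkx⟩, hmin⟩ := WellFounded.has_min (wellFounded_lt (α := Ordinal.{u}))
        {k | Order.succ i ≤ k ∧ k ≤ α ∧ y k ≠ x} ⟨α, Order.succ_le_of_lt hi, le_rfl, hxα.symm⟩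
      have heq : ∀ j, Order.succ i ≤ j → j < k → y j = x := fun j h1 h2 => by
        by_contra hne
        exact hmin j ⟨h1, h2.le.trans hkα, hne⟩ h2
      rcases Ordinal.zero_or_succ_or_isSuccLimit k with rfl | ⟨j, rfl⟩ | hlim
      · exact absurd (nonpos_iff_eq_zero.1 hk) (Order.succ_ne_bot i)
      · have hj : j < α := Order.succ_le_iff.1 hkα
        have hij : Order.succ i ≤ j := by
          rcases hk.eq_or_lt with h | h
          · exact absurd (h ▸ hxi.symm) hkx
          · exact Order.lt_succ_iff.1 h
        have hjx := heq j hij (Order.lt_succ j)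
        obtain ⟨z, hz, h1, h2⟩ := (hD j hj).step x (hjx ▸ (hD j hj).left_mem) hkx.symm
        exact ⟨z, Or.inr ⟨j, hj, hz⟩, h1, h2⟩
      · refine absurd (le_antisymm (hcont k hkα hlim x fun j hj => ?_) ?_) hkx
        · rcases le_total j (Order.succ i) with h | h
          · rw [hxi]
            exact hmono _ _ h (Order.succ_le_of_lt hi)
          · exact (heq j h hj).le
        · rw [hxi]
          exact hmono _ _ hk hkα
    · obtain ⟨z, hz, h1, h2⟩ := (hD i hi).step x hx hxi
      exact ⟨z, Or.inr ⟨i, hi, hz⟩, h1, h2⟩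
  · obtain ⟨i, ⟨hi, hiT⟩, hmin⟩ := WellFounded.has_min (wellFounded_lt (α := Ordinal.{u}))
      {i | i ≤ α ∧ ∀ x ∈ T, x ≤ y i} ⟨α, le_rfl, fun x hx => hle x (hT hx)⟩
    have hbig : ∀ j < i, ∃ x ∈ T, ¬ x ≤ y j := fun j hj => by
      by_contra hcon
      push Not at hcon
      exact hmin j ⟨hj.le.trans hi, hcon⟩ hj
    have hge : ∀ j < i, ∀ x ∈ T, ¬ x ≤ y j → y j ≤ x := by
      intro j hj x hx hxj
      rcases hT hx with rfl | ⟨k, hk, hxk⟩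
      · exact hmono _ _ (hj.le.trans hi) le_rfl
      · rcases le_or_gt j k with h | h
        · exact (hmono _ _ h hk.le).trans (hlow k hk x hxk)
        · exact absurd ((hup k hk x hxk).trans (hmono _ _ (Order.succ_le_of_lt h)
            (hj.le.trans hi))) hxj
    have hsup := sSup_le hiT
    rcases Ordinal.zero_or_succ_or_isSuccLimit i with rfl | ⟨j, rfl⟩ | hlim
    · obtain ⟨x, hx⟩ := hne
      have : sSup T = y 0 := le_antisymm hsup (le_sSup_of_le hx (by
        rcases hT hx with rfl | ⟨k, hk, hxk⟩
        exacts [hmono _ _ zero_le le_rfl, (hmono _ _ zero_le hk.le).trans (hlow k hk x hxk)]))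
      rw [this]
      exact hmem 0 zero_le
    · have hj : j < α := Order.succ_le_iff.1 hi
      obtain ⟨x₀, hx₀, hx₀j⟩ := hbig j (Order.lt_succ j)
      have hT' : {x ∈ T | ¬ x ≤ y j} ⊆ 𝒟 j := by
        rintro x ⟨hx, hxj⟩
        have hxj' := hiT x hx
        have htop : y (Order.succ j) ≤ x → x ∈ 𝒟 j := fun h => by
          rw [le_antisymm hxj' h]
          exact (hD j hj).right_mem
        rcases hT hx with rfl | ⟨k, hk, hxk⟩
        · exact htop (hmono _ _ hi le_rfl)
        · rcases lt_trichotomy k j with h | rfl | h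
          · exact absurd ((hup k hk x hxk).trans (hmono _ _ (Order.succ_le_of_lt h) hj.le)) hxj
          · exact hxk
          · exact htop ((hmono _ _ (Order.succ_le_of_lt h) hk.le).trans (hlow k hk x hxk))
      have hsup' : sSup T = sSup {x ∈ T | ¬ x ≤ y j} := by
        refine le_antisymm (sSup_le fun x hx => ?_) (sSup_le_sSup fun x hx => hx.1)
        by_cases hxj : x ≤ y j
        · refine le_sSup_of_le ⟨hx₀, hx₀j⟩ ((hchain.total hx hx₀).resolve_right fun h => ?_)
          exact hx₀j (h.trans hxj)
        · exact le_sSup ⟨hx, hxj⟩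
      rw [hsup']
      exact Or.inr ⟨j, hj, (hD j hj).sup _ hT' ⟨x₀, hx₀, hx₀j⟩ (hchain.mono fun x hx => hx.1)⟩
    · have : sSup T = y i := le_antisymm hsup (hcont i hi hlim _ fun j hj => by
        obtain ⟨x, hx, hxj⟩ := hbig j hj
        exact le_sSup_of_le hx (hge j hj x hx hxj))
      rw [this]
      exact hmem i hi

/-- A climb can be enumerated by an ordinal whose cardinality is bounded by the size of its top. -/
theorem exists_sequence {X : Type (u + 1)} [CompleteLattice X] {r : X → X → Prop} {a b : X}
    {𝒞 : Set X} (h : Climb r a b 𝒞) {κ : Cardinal.{u}} (φ : X → Set ZFSet.{u}) (hφ : Monotone φ)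
    (hr : ∀ x y, r x y → ¬ φ y ⊆ φ x) (hb : Cardinal.mk (φ b) ≤ Cardinal.lift.{u + 1} κ) :
    ∃ α < (Order.succ κ).ord, ∃ x : Ordinal.{u} → X, x 0 = a ∧ x α = b ∧
      (∀ i < α, r (x i) (x (Order.succ i))) ∧ Monotone x ∧
      ∀ δ, Order.IsSuccLimit δ → x δ = sSup (x '' Iio δ) := by
  classical
  obtain ⟨x, x0, xs, xl⟩ := exists_transfinite_sequence.{u} a
    (fun _ z => if hy : ∃ y ∈ 𝒞, z < y ∧ r z y then hy.choose else z)
    (fun δ g => sSup (g '' Iio δ))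
  have hl : ∀ δ, Order.IsSuccLimit δ → x δ = sSup (x '' Iio δ) := fun δ hδ => by
    rw [xl δ hδ]
    congr 1
    exact image_congr fun i hi => if_pos hi
  have hs : ∀ i, x i ∈ 𝒞 → x (Order.succ i) ∈ 𝒞 ∧ x i ≤ x (Order.succ i) ∧
      (x i ≠ b → r (x i) (x (Order.succ i))) := by
    intro i hi
    rw [xs]
    split_ifs with hy
    · exact ⟨hy.choose_spec.1, hy.choose_spec.2.1.le, fun _ => hy.choose_spec.2.2⟩
    · refine ⟨hi, le_rfl, fun hne => absurd ?_ hy⟩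
      obtain ⟨y, h1, h2⟩ := h.step _ hi hne
      exact ⟨y, h1, h2⟩
  have hinv : ∀ i, x i ∈ 𝒞 ∧ ∀ j ≤ i, x j ≤ x i := by
    intro i
    induction i using Ordinal.limitRecOn with
    | zero =>
      refine ⟨x0 ▸ h.left_mem, fun j hj => ?_⟩
      rw [nonpos_iff_eq_zero.1 hj]
    | add_one i ih =>
      rw [← Order.succ_eq_add_one]
      refine ⟨(hs i ih.1).1, fun j hj => ?_⟩
      rcases hj.eq_or_lt with rfl | hj
      · exact le_rfl
      · exact (ih.2 j (Order.lt_succ_iff.1 hj)).trans (hs i ih.1).2.1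
    | limit δ hδ ih =>
      rw [hl δ hδ]
      refine ⟨h.sup _ ?_ ⟨x 0, 0, hδ.bot_lt, rfl⟩ ?_, fun j hj => ?_⟩
      · rintro _ ⟨i, hi, rfl⟩
        exact (ih i hi).1
      · rintro _ ⟨i, hi, rfl⟩ _ ⟨j, hj, rfl⟩ -
        exact (le_total i j).imp ((ih j hj).2 i) ((ih i hi).2 j)
      · rcases hj.eq_or_lt with rfl | hj
        · exact (hl j hδ).le
        · exact le_sSup ⟨j, hj, rfl⟩
  have hmono : Monotone x := fun i j hij => (hinv j).2 i hij
  have hex : ∃ i < (Order.succ κ).ord, x i = b := by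
    by_contra hcon
    push Not at hcon
    have hd : ∀ i < (Order.succ κ).ord, ∃ d ∈ φ (x (Order.succ i)), d ∉ φ (x i) := fun i hi =>
      not_subset.1 (hr _ _ ((hs i (hinv i).1).2.2 (hcon i hi)))
    choose! d hd1 hd2 using hd
    have hlt : ∀ i j, i < j → j < (Order.succ κ).ord → d i ≠ d j := fun i j hij hj he =>
      hd2 j hj (he ▸ hφ (hmono (Order.succ_le_of_lt hij)) (hd1 i (hij.trans hj)))
    have hinj : Function.Injective fun i : Iio (Order.succ κ).ord =>
        (⟨d i, hφ (h.le_right _ (hinv _).1) (hd1 i i.2)⟩ : φ b) := by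
      rintro ⟨i, hi⟩ ⟨j, hj⟩ he
      have he : d i = d j := congrArg Subtype.val he
      rcases lt_trichotomy i j with h1 | h1 | h1
      · exact absurd he (hlt i j h1 hj)
      · exact Subtype.ext h1
      · exact absurd he.symm (hlt j i h1 hi)
    have h1 := (Cardinal.mk_le_of_injective hinj).trans hb
    rw [Cardinal.mk_Iio_ordinal, Cardinal.card_ord, Cardinal.lift_le] at h1
    exact absurd h1 (Order.lt_succ κ).not_ge
  obtain ⟨α, ⟨hα, hαb⟩, hmin⟩ := WellFounded.has_min (wellFounded_lt (α := Ordinal.{u}))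
    {i | i < (Order.succ κ).ord ∧ x i = b} hex
  exact ⟨α, hα, x, x0, hαb, fun i hi => (hs i (hinv i).1).2.2 fun he =>
    hmin i ⟨hi.trans hα, he⟩ hi, hmono, hl⟩

end Climb

theorem Climb.trans {X : Type*} [CompleteLattice X] {r : X → X → Prop} {a b c : X} {𝒞 𝒟 : Set X}
    (h : Climb r a b 𝒞) (h' : Climb r b c 𝒟) : ∃ ℰ, Climb r a c ℰ := by
  have hab := h.le_right _ h.left_mem
  have hbc := h'.le_right _ h'.left_mem
  let y : Ordinal.{0} → X := fun i => if i = 0 then a else if i = 1 then b else c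
  have y0 : y 0 = a := if_pos rfl
  have y1 : y 1 = b := (if_neg one_ne_zero).trans (if_pos rfl)
  have y2 : y 2 = c := (if_neg two_ne_zero).trans (if_neg (by norm_num))
  have hs0 : Order.succ (0 : Ordinal.{0}) = 1 := by rw [Order.succ_eq_add_one, zero_add]
  have hs1 : Order.succ (1 : Ordinal.{0}) = 2 := by rw [Order.succ_eq_add_one, one_add_one_eq_two]
  have hcases : ∀ i : Ordinal.{0}, i ≤ 2 → i = 0 ∨ i = 1 ∨ i = 2 := fun i hi => by
    rcases hi.eq_or_lt with rfl | hi
    · exact Or.inr (Or.inr rfl)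
    · rw [← hs1, Order.lt_succ_iff] at hi
      rcases hi.eq_or_lt with rfl | hi
      · exact Or.inr (Or.inl rfl)
      · rw [← hs0, Order.lt_succ_iff] at hi
        exact Or.inl (nonpos_iff_eq_zero.1 hi)
  have := Climb.concat (r := r) (y := y) (α := 2) (fun i j hij hj => ?_) (fun δ hδ hl => ?_)
    (fun i hi => ?_)
  · rwa [y0, y2] at this
  · rcases hcases j hj with rfl | rfl | rfl
    · rw [nonpos_iff_eq_zero.1 hij]
    · rcases hcases i (hij.trans hj) with rfl | rfl | rfl
      · rwa [y0, y1]
      · exact le_rfl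
      · exact absurd hij (by norm_num)
    · rw [y2]
      rcases hcases i hij with rfl | rfl | rfl
      exacts [y0 ▸ hab.trans hbc, y1 ▸ hbc, y2.le]
  · rcases hcases δ hδ with rfl | rfl | rfl
    · exact absurd rfl hl.ne_bot
    · exact absurd (hs0 ▸ hl) (Order.not_isSuccLimit_succ _)
    · exact absurd (hs1 ▸ hl) (Order.not_isSuccLimit_succ _)
  · rcases hcases i hi.le with rfl | rfl | rfl
    · rw [hs0, y0, y1]
      exact ⟨_, h⟩
    · rw [hs1, y1, y2]
      exact ⟨_, h'⟩
    · exact absurd hi (lt_irrefl _)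

namespace ModelClass

variable {L : FirstOrder.Language.{u, u}} {C : ModelClass L}

theorem IsAEC.eq_of_carrier_eq (h : C.IsAEC) {M N Z : Model L} (hM : C.le M Z) (hN : C.le N Z)
    (he : M.carrier = N.carrier) : M = N :=
  h.eq_of_subset (h.le_of_subset hM hN he.subset) he.superset

theorem IsAEC.incCont_of_subset (h : C.IsAEC) {M : Ordinal.{u} → Model L} {α : Ordinal.{u}}
    {Z : Model L} (hZ : ∀ i ≤ α, C.le (M i) Z)
    (hmono : ∀ i j, i ≤ j → j ≤ α → (M i).carrier ⊆ (M j).carrier)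
    (hcont : ∀ δ ≤ α, Order.IsSuccLimit δ → ∀ x ∈ (M δ).carrier, ∃ i < δ, x ∈ (M i).carrier) :
    C.IncCont M (Iic α) := by
  have hle : ∀ i j, i ≤ j → j ≤ α → C.le (M i) (M j) := fun i j hij hj =>
    h.le_of_subset (hZ i (hij.trans hj)) (hZ j hj) (hmono i j hij hj)
  refine ⟨fun i _ j hj hij => hle i j hij hj, fun δ hδ hl => ⟨Subset.antisymm (fun x hx => ?_)
    (iUnion₂_subset fun i hi => hmono i δ (le_of_lt hi) hδ), fun i hi =>
      h.le_sub _ _ (hle i δ hi.le hδ)⟩⟩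
  obtain ⟨i, hi, hx⟩ := hcont δ hδ hl x hx
  exact mem_iUnion₂.2 ⟨i, hi, hx⟩

end ModelClass

namespace FrameData

variable {L : FirstOrder.Language.{u, u}} {s : FrameData L} {κ : Cardinal.{u}}

open ModelClass

/-- The pairs of universes of two consecutive terms of a lift, inside `Z`. -/
def LiftStep (s : FrameData L) (κ : Cardinal.{u}) (Z : Model L)
    (x y : Set ZFSet.{u} × Set ZFSet.{u}) : Prop :=
  ∃ X X' Y Y' d, x = (X.carrier, Y.carrier) ∧ y = (X'.carrier, Y'.carrier) ∧ s.K3uq κ X X' d ∧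
    s.nf X Y d Y' ∧ s.le X' Y' ∧ s.KCard κ Y' ∧ s.le Y' Z

/-- A non-trivial decomposition from `X` to `Y`, of successor length. -/
def SuccDecomp (s : FrameData L) (κ : Cardinal.{u}) (X Y : Model L) : Prop :=
  ∃ α A d, s.Decomp κ (s.K3uq κ) A d (Order.succ α) ∧ A 0 = X ∧ A (Order.succ α) = Y

/-- An isomorphism-closed, monotone relation depends only on the amalgam up to joint
embeddability. -/
theorem transfer {C : ModelClass L} (hA : C.IsAEC) {R : Model L → Model L → Model L → Model L → Prop}
    (hiso : IsoClosed R)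
    (hmono : ∀ M₀ M₁ M₂ M₃ N₃ P, R M₀ M₁ M₂ M₃ → C.KCard κ N₃ → C.le M₁ N₃ → C.le M₂ N₃ →
      C.le M₃ P → C.le N₃ P → R M₀ M₁ M₂ N₃) {M₀ M₁ M₂ M₃ N P : Model L}
    {g : ZFSet.{u} → ZFSet.{u}} (h : R M₀ M₁ M₂ M₃) (h01 : C.le M₀ M₁) (kN : C.KCard κ N)
    (h1 : C.le M₁ N) (h2 : C.le M₂ N) (h3 : C.le M₃ P) (hg : C.IsEmb g N P)
    (hid : ∀ x ∈ M₁.carrier ∪ M₂.carrier, g x = x) : R M₀ M₁ M₂ N := by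
  obtain ⟨k, hk, hk1, -⟩ := hA.exists_rename hg ∅ small_empty
  have hkid : ∀ x ∈ M₁.carrier ∪ M₂.carrier, k x = x := fun x hx => by
    have := hk1 x (hx.elim (fun h => hA.subset h1 h) fun h => hA.subset h2 h)
    rwa [hid x hx] at this
  have hR := hmono _ _ _ _ (Model.map g N) P h (hA.map_kcard kN hg.injOn)
    (hA.le_map_of_id h1 hg.injOn fun x hx => hid x (Or.inl hx))
    (hA.le_map_of_id h2 hg.injOn fun x hx => hid x (Or.inr hx)) h3 hg.le
  refine hiso k _ _ _ _ _ _ _ _ hR (Model.isIso_iff.2 ⟨hk.injOn, Model.map_map_of_leftInv hk1⟩)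
    (Model.isIso_of_eqOn_id fun x hx => hkid x (Or.inl (hA.subset h01 hx)))
    (Model.isIso_of_eqOn_id fun x hx => hkid x (Or.inl hx))
    (Model.isIso_of_eqOn_id fun x hx => hkid x (Or.inr hx))

theorem Lift.mono {A B : Ordinal.{u} → Model L}
    {d : Ordinal.{u} → ZFSet.{u}} {α β : Ordinal.{u}} (h : s.Lift κ A d α B) (hβ : β ≤ α) :
    s.Lift κ A d β B :=
  ⟨h.1.iic_mono hβ, fun i hi => h.2.1 i (hi.trans hβ), fun i hi => h.2.2.1 i (hi.trans hβ),
    fun i hi => h.2.2.2 i (hi.trans_le hβ)⟩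

namespace IsSemiGoodExceptLocalCharacter

theorem exists_climb (hs : s.IsSemiGoodExceptLocalCharacter κ)
    {A B : Ordinal.{u} → Model L} {d : Ordinal.{u} → ZFSet.{u}} {α : Ordinal.{u}} {Z : Model L}
    (hdec : s.Decomp κ (s.K3uq κ) A d α) (hB : s.Lift κ A d α B) (hZ : s.le (B α) Z) :
    ∃ 𝒞, Climb (s.LiftStep κ Z) ((A 0).carrier, (B 0).carrier) ((A α).carrier, (B α).carrier) 𝒞 := by
  have hA := hs.aec
  refine Climb.concat (y := fun i => ((A i).carrier, (B i).carrier)) (fun i j hij hj =>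
    ⟨hA.subset (hdec.2.1.le hij hj), hA.subset (hB.1.le hij hj)⟩) (fun δ hδ hl z hz => ?_)
    fun i hi => ⟨_, Climb.single ?_ ?_⟩
  · constructor
    · intro x hx
      obtain ⟨i, hi, hx⟩ := (hdec.2.1.2 δ hδ hl).mem_iff.1 hx
      exact (hz i hi).1 hx
    · intro x hx
      obtain ⟨i, hi, hx⟩ := (hB.1.2 δ hδ hl).mem_iff.1 hx
      exact (hz i hi).2 hx
  · have hi' := Order.succ_le_of_lt hi
    obtain ⟨-, -, -, h1, h2, -⟩ := (hdec.2.2.2 i hi).1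
    exact lt_of_le_not_ge ⟨hA.subset (hdec.2.1.le (Order.le_succ i) hi'),
      hA.subset (hB.1.le (Order.le_succ i) hi')⟩ fun h => h2 (h.1 h1)
  · have hi' := Order.succ_le_of_lt hi
    exact ⟨_, _, _, _, _, rfl, rfl, hdec.2.2.2 i hi, hB.2.2.2 i hi, hB.2.2.1 _ hi', hB.2.1 _ hi',
      hA.trans (hB.1.le hi' le_rfl) hZ⟩

theorem nfStar_of_climb (hs : s.IsSemiGoodExceptLocalCharacter κ) {N₀ N₁ N₂ N₃ : Model L}
    {𝒞 : Set (Set ZFSet.{u} × Set ZFSet.{u})} (k1 : s.KCard κ N₁) (k3 : s.KCard κ N₃)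
    (h02 : s.le N₀ N₂) (h23 : s.le N₂ N₃) (h13 : s.le N₁ N₃)
    (h : Climb (s.LiftStep κ N₃) (N₀.carrier, N₂.carrier) (N₁.carrier, N₃.carrier) 𝒞) :
    s.NFStar κ N₀ N₁ N₂ N₃ := by
  have hA := hs.aec
  obtain ⟨α, hα, x, x0, xα, hstep, hmono, hlim⟩ := h.exists_sequence (κ := κ) Prod.fst
    (fun x y hxy => hxy.1) (by
      rintro x y ⟨X, X', Y, Y', d, rfl, rfl, h1, -⟩ hsub
      exact h1.1.2.2.2.2.1 (hsub h1.1.2.2.2.1)) k1.2.le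
  have hpt : ∀ i ≤ α, ∃ X Y, x i = (X.carrier, Y.carrier) ∧ s.KCard κ X ∧ s.KCard κ Y ∧
      s.le X Y ∧ s.le Y N₃ := by
    intro i hi
    rcases hi.eq_or_lt with rfl | hi
    · exact ⟨N₁, N₃, xα, k1, k3, h13, hA.refl_right h13⟩
    · obtain ⟨X, X', Y, Y', d, h1, -, h2, h3, -, -, h4⟩ := hstep i hi
      obtain ⟨kX, kY, -, hXY, hYY', -⟩ := hs.nf_sub _ _ _ _ h3
      exact ⟨X, Y, h1, kX, kY, hXY, hA.trans hYY' h4⟩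
  have : Nonempty (Model L) := ⟨N₀⟩
  choose! A B hx kA kB hAB hBZ using hpt
  have hAZ : ∀ i ≤ α, s.le (A i) N₃ := fun i hi => hA.trans (hAB i hi) (hBZ i hi)
  have hA' : ∀ i ≤ α, (A i).carrier = (x i).1 := fun i hi => by rw [hx i hi]
  have hB' : ∀ i ≤ α, (B i).carrier = (x i).2 := fun i hi => by rw [hx i hi]
  have hle : ∀ i ≤ α, ∀ X Y, s.le X N₃ → s.le Y N₃ → x i = (X.carrier, Y.carrier) →
      A i = X ∧ B i = Y := fun i hi X Y hX hY h =>
    ⟨hA.eq_of_carrier_eq (hAZ i hi) hX (by rw [hA' i hi, h]),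
      hA.eq_of_carrier_eq (hBZ i hi) hY (by rw [hB' i hi, h])⟩
  have hst : ∀ i < α, ∃ d, s.K3uq κ (A i) (A (Order.succ i)) d ∧
      s.nf (A i) (B i) d (B (Order.succ i)) := by
    intro i hi
    obtain ⟨X, X', Y, Y', d, h1, h1', h2, h3, h5, -, h4⟩ := hstep i hi
    obtain ⟨-, -, -, hXY, hYY', -⟩ := hs.nf_sub _ _ _ _ h3
    have hYZ := hA.trans hYY' h4
    obtain ⟨e1, e2⟩ := hle i hi.le X Y (hA.trans hXY hYZ) hYZ h1
    obtain ⟨e3, e4⟩ := hle _ (Order.succ_le_of_lt hi) X' Y' (hA.trans h5 h4) h4 h1'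
    exact ⟨d, by rwa [e1, e3], by rwa [e1, e2, e4]⟩
  choose! d hd1 hd2 using hst
  have hlim' : ∀ δ, Order.IsSuccLimit δ → x δ = (⋃ i ∈ Iio δ, (x i).1, ⋃ i ∈ Iio δ, (x i).2) := by
    intro δ hδ
    rw [hlim δ hδ]
    refine le_antisymm (sSup_le ?_) ⟨iUnion₂_subset fun i hi => ?_, iUnion₂_subset fun i hi => ?_⟩
    · rintro _ ⟨i, hi, rfl⟩
      exact ⟨subset_biUnion_of_mem (u := fun i => (x i).1) hi,
        subset_biUnion_of_mem (u := fun i => (x i).2) hi⟩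
    · exact (le_sSup (mem_image_of_mem x hi)).1
    · exact (le_sSup (mem_image_of_mem x hi)).2
  have hdec : s.Decomp κ (s.K3uq κ) A d α := by
    refine ⟨hα, hA.incCont_of_subset hAZ (fun i j hij hj => ?_) (fun δ hδ hl z hz => ?_), kA, hd1⟩
    · rw [hA' i (hij.trans hj), hA' j hj]
      exact (hmono hij).1
    · rw [hA' δ hδ, hlim' δ hl] at hz
      obtain ⟨i, hi, hz⟩ := mem_iUnion₂.1 hz
      exact ⟨i, hi, (hA' i ((le_of_lt hi).trans hδ)).symm ▸ hz⟩
  have hlift : s.Lift κ A d α B := by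
    refine ⟨hA.incCont_of_subset hBZ (fun i j hij hj => ?_) (fun δ hδ hl z hz => ?_), kB, hAB, hd2⟩
    · rw [hB' i (hij.trans hj), hB' j hj]
      exact (hmono hij).2
    · rw [hB' δ hδ, hlim' δ hl] at hz
      obtain ⟨i, hi, hz⟩ := mem_iUnion₂.1 hz
      exact ⟨i, hi, (hB' i ((le_of_lt hi).trans hδ)).symm ▸ hz⟩
  have := hs.nfStar_of_lift hdec hlift
  obtain ⟨e1, e2⟩ := hle 0 zero_le N₀ N₂ (hA.trans h02 h23) h23 x0
  obtain ⟨e3, e4⟩ := hle α le_rfl N₁ N₃ h13 (hA.refl_right h13) xα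
  rwa [e1, e2, e3, e4] at this

theorem nfStar_concat (hs : s.IsSemiGoodExceptLocalCharacter κ) {C D : Ordinal.{u} → Model L}
    {α : Ordinal.{u}} (hC : s.IncCont C (Iic α)) (hD : s.IncCont D (Iic α))
    (hCD : ∀ i ≤ α, s.le (C i) (D i)) (kC : s.KCard κ (C α)) (kD : s.KCard κ (D α))
    (h : ∀ i < α, s.NFStar κ (C i) (C (Order.succ i)) (D i) (D (Order.succ i))) :
    s.NFStar κ (C 0) (C α) (D 0) (D α) := by
  have hA := hs.aec
  have hex : ∃ 𝒞, Climb (s.LiftStep κ (D α)) ((C 0).carrier, (D 0).carrier)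
      ((C α).carrier, (D α).carrier) 𝒞 := by
    refine Climb.concat (y := fun i => ((C i).carrier, (D i).carrier)) (fun i j hij hj =>
      ⟨hA.subset (hC.le hij hj), hA.subset (hD.le hij hj)⟩) (fun δ hδ hl z hz => ?_)
      fun i hi => ?_
    · constructor
      · intro x hx
        obtain ⟨i, hi, hx⟩ := (hC.2 δ hδ hl).mem_iff.1 hx
        exact (hz i hi).1 hx
      · intro x hx
        obtain ⟨i, hi, hx⟩ := (hD.2 δ hδ hl).mem_iff.1 hx
        exact (hz i hi).2 hx
    · obtain ⟨β, A, B, d, hdec, hB, h1, h2, h3, h4⟩ := exists_lift_of_nfStar (h i hi)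
      have := hs.exists_climb hdec hB (Z := D α) (by
        rw [h4]
        exact hD.le (Order.succ_le_of_lt hi) le_rfl)
      rwa [h1, h2, h3, h4] at this
  obtain ⟨𝒞, h𝒞⟩ := hex
  exact hs.nfStar_of_climb kC kD (hCD 0 zero_le) (hD.le zero_le le_rfl) (hCD α le_rfl) h𝒞

theorem nfStar_trans (hs : s.IsSemiGoodExceptLocalCharacter κ) {X₀ X₁ X₂ Y₀ Y₁ Y₂ : Model L}
    (h : s.NFStar κ X₀ X₁ Y₀ Y₁) (h' : s.NFStar κ X₁ X₂ Y₁ Y₂) : s.NFStar κ X₀ X₂ Y₀ Y₂ := by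
  have hA := hs.aec
  obtain ⟨-, -, -, -, -, -, h02, h01, -⟩ := id h
  obtain ⟨-, k1, -, k3, -, h13, -, h23, -⟩ := id h'
  obtain ⟨_, _, _, _, hdec, hB, rfl, rfl, rfl, rfl⟩ := exists_lift_of_nfStar h
  obtain ⟨_, _, _, _, hdec', hB', e1, rfl, e2, rfl⟩ := exists_lift_of_nfStar h'
  obtain ⟨𝒞, h𝒞⟩ := hs.exists_climb hdec hB h23
  obtain ⟨𝒟, h𝒟⟩ := hs.exists_climb hdec' hB' (hA.refl_right h13)
  rw [e1, e2] at h𝒟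
  obtain ⟨ℰ, hℰ⟩ := h𝒞.trans h𝒟
  exact hs.nfStar_of_climb k1 k3 h02 (hA.trans h01 h23) h13 hℰ

theorem lift_enlarge (hs : s.IsSemiGoodExceptLocalCharacter κ)
    {A B : Ordinal.{u} → Model L} {d : Ordinal.{u} → ZFSet.{u}} {α : Ordinal.{u}} {Z : Model L}
    (hB : s.Lift κ A d (Order.succ α) B) (kZ : s.KCard κ Z) (hZ : s.le (B (Order.succ α)) Z) :
    s.Lift κ A d (Order.succ α) (Function.update B (Order.succ α) Z) := by
  have := hs.lift_append (hB.mono (Order.le_succ α)) (hs.aec.trans (hB.2.2.1 _ le_rfl) hZ) kZ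
    (hs.nf_up (hB.2.2.2 α (Order.lt_succ α)) hZ)
  rwa [Function.update_eq_self, Function.update_eq_self] at this

theorem lift_self (hs : s.IsSemiGoodExceptLocalCharacter κ)
    {A : Ordinal.{u} → Model L} {d : Ordinal.{u} → ZFSet.{u}} {α : Ordinal.{u}}
    (hdec : s.Decomp κ (s.K3uq κ) A d α) : s.Lift κ A d α A :=
  ⟨hdec.2.1, hdec.2.2.1, fun i hi => hs.aec.le_refl _ (hdec.2.2.1 i hi).1, fun i hi =>
    hs.nf_refl (hdec.2.2.1 i hi.le) (hdec.2.2.2 i hi).1.2.2.2.2.2⟩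

theorem succDecomp_map (hs : s.IsSemiGoodExceptLocalCharacter κ)
    (hQ : s.AdmissibleClass κ (s.K3uq κ)) {X Y : Model L} (h : s.SuccDecomp κ X Y)
    {f : ZFSet.{u} → ZFSet.{u}} (hf : Function.Injective f) (hid : ∀ x ∈ X.carrier, f x = x) :
    s.SuccDecomp κ X (Model.map f Y) := by
  obtain ⟨α, A, d, hdec, rfl, rfl⟩ := h
  exact ⟨α, _, _, hs.decomp_map hQ hdec hf, Model.map_of_eqOn_id hid, rfl⟩

theorem exists_succDecomp (hs : s.IsSemiGoodExceptLocalCharacter κ)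
    (hQ : s.AdmissibleClass κ (s.K3uq κ)) {X Y : Model L} (kX : s.KCard κ X) (kY : s.KCard κ Y)
    (hXY : s.le X Y) : ∃ W, s.KCard κ W ∧ s.le Y W ∧ s.SuccDecomp κ X W := by
  obtain ⟨α, A, d, hdec, rfl, hY, -⟩ := hs.exists_decomp hQ kX kY hXY ∅
  obtain ⟨W, a, hW, -⟩ := hs.exists_fresh_k3uq hQ (hdec.2.2.1 α le_rfl) ∅ small_empty
  exact ⟨W, hW.1.2.1, hs.aec.trans hY hW.1.2.2.1, α, _, _, hs.decomp_append hdec hW,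
    Function.update_of_ne (Order.succ_ne_bot α).symm _ _, Function.update_self ..⟩

theorem exists_common_succDecomp (hs : s.IsSemiGoodExceptLocalCharacter κ)
    (hQ : s.AdmissibleClass κ (s.K3uq κ)) {X Y : Model L} (kX : s.KCard κ X) (kY : s.KCard κ Y)
    (hXY : s.le X Y) :
    ∃ W, s.KCard κ W ∧ s.le Y W ∧ s.SuccDecomp κ X W ∧ s.SuccDecomp κ Y W := by
  have hA := hs.aec
  have hω : Ordinal.omega0 < (Order.succ κ).ord := by
    rw [← Cardinal.ord_aleph0]
    exact Cardinal.ord_lt_ord.2 (hs.infinite.trans_lt (Order.lt_succ κ))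
  have hstep : ∀ X Y, s.KCard κ X → s.KCard κ Y → s.le X Y →
      ∃ W, s.KCard κ W ∧ s.le Y W ∧ s.NFStar κ X W X W := fun X Y kX kY hXY => by
    obtain ⟨α, A, d, hdec, rfl, hY, -⟩ := hs.exists_decomp hQ kX kY hXY ∅
    exact ⟨A α, hdec.2.2.1 α le_rfl, hY, hs.nfStar_of_lift hdec (hs.lift_self hdec)⟩
  obtain ⟨P, -, hP0, -, hinc, hJ, hΦ, -⟩ := hA.exists_chain (μ := Bool) (ι := Empty)
    (Order.succ Ordinal.omega0) (fun k _ => k.elim) (fun k => k.elim)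
    (fun _ P _ => (∀ b, s.KCard κ (P b)) ∧ s.le (P false) (P true))
    (fun _ P _ P' _ => (∀ b, s.NFStar κ (P b) (P' b) (P b) (P' b)) ∧ s.le (P true) (P' false))
    (fun b => bif b then Y else X) (fun k => k.elim)
    (by rintro (_ | _); exacts [kX.1, kY.1])
    ⟨by rintro (_ | _); exacts [kX, kY], hXY⟩ (by
      rintro i P f - ⟨j1, j2⟩
      obtain ⟨U, u1, u2, u3⟩ := hstep _ _ (j1 false) (j1 true) j2
      obtain ⟨V, v1, v2, v3⟩ := hstep _ _ (j1 true) u1 u2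
      refine ⟨fun b => bif b then V else U, f, ?_, fun k => k.elim, ⟨?_, u2⟩, ?_, v2⟩
      · rintro (_ | _)
        exacts [hA.trans j2 u2, hA.trans u2 v2]
      · rintro (_ | _)
        exacts [u3, v3]
      · rintro (_ | _)
        exacts [u1, v1]) (by
      intro δ P f hδ hδω hP0 hJ hΦ _ hinc
      refine ⟨fun b => hA.kcard_union hs.infinite hδ ((Order.lt_succ_iff.1 hδω).trans_lt hω)
        (hinc b) fun i hi => (hJ i hi).1 b, hA.le_of_forall_le hδ (hinc false) fun i hi => ?_⟩
      exact hA.trans (hJ i hi).2 ((hinc true).le hi.le le_rfl))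
  have hlim := Ordinal.isSuccLimit_omega0
  have hlt : ∀ i < Ordinal.omega0.{u}, Order.succ i < Order.succ Ordinal.omega0.{u} := fun i hi =>
    Order.succ_lt_succ hi
  obtain ⟨jK, jle⟩ := hJ _ (Order.lt_succ Ordinal.omega0)
  have htop : P Ordinal.omega0 false = P Ordinal.omega0 true := by
    refine hA.eq_of_subset jle fun x hx => ?_
    obtain ⟨i, hi, hx⟩ := ((hinc true).2 _ (mem_Iio.2 (Order.lt_succ _)) hlim).mem_iff.1 hx
    exact hA.subset ((hinc false).of_succ.le (Order.succ_le_of_lt hi) le_rfl)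
      (hA.subset (hΦ i (hlt i hi)).2 hx)
  have hdec : ∀ b, s.NFStar κ (P 0 b) (P Ordinal.omega0 b) (P 0 b) (P Ordinal.omega0 b) := fun b =>
    hs.nfStar_concat (hinc b).of_succ (hinc b).of_succ
      (fun i hi => hA.le_refl _ ((hJ i (Order.lt_succ_iff.2 hi)).1 b).1) (jK b) (jK b)
      fun i hi => (hΦ i (hlt i hi)).1 b
  obtain ⟨W, a, hW, -⟩ := hs.exists_fresh_k3uq hQ (jK true) ∅ small_empty
  have hsd : ∀ Z b, P 0 b = Z → P Ordinal.omega0 b = P Ordinal.omega0 true →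
      s.SuccDecomp κ Z W := by
    intro Z b hZ hb
    obtain ⟨α, A, B, d, hdec, -, h0, h1, -⟩ := exists_lift_of_nfStar (hdec b)
    refine ⟨α, _, _, hs.decomp_append hdec (X := W) (a := a) (by rwa [h1, hb]),
      (Function.update_of_ne (Order.succ_ne_bot α).symm _ _).trans (h0.trans hZ),
      Function.update_self ..⟩
  have hY0 : P 0 true = Y := by rw [hP0]; rfl
  refine ⟨W, hW.1.2.1, hA.trans ?_ hW.1.2.2.1, hsd X false (by rw [hP0]; rfl) htop,
    hsd Y true hY0 rfl⟩
  have := (hinc true).of_succ.le (zero_le : 0 ≤ Ordinal.omega0) le_rfl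
  simp only [hY0] at this
  exact this

theorem NF_transfer_emb (hs : s.IsSemiGoodExceptLocalCharacter κ)
    (hQ : s.AdmissibleClass κ (s.K3uq κ)) {M₀ M₁ M₂ M₃ N P : Model L}
    {g : ZFSet.{u} → ZFSet.{u}} (h : s.NF κ M₀ M₁ M₂ M₃) (kN : s.KCard κ N)
    (h1 : s.le M₁ N) (h2 : s.le M₂ N) (h3 : s.le M₃ P) (hg : s.IsEmb g N P)
    (hid : ∀ x ∈ M₁.carrier ∪ M₂.carrier, g x = x) : s.NF κ M₀ M₁ M₂ N :=
  transfer hs.aec (hs.NF_isoClosed hQ) (fun _ _ _ _ _ _ h k h1 h2 h3 h4 =>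
    hs.NF_mono hQ h h.1.2.1 h.1.2.2.1 k (hs.aec.refl_right h.2.1) (hs.aec.refl_right h.2.2.2.1)
      h.2.1 h1 h.2.2.2.1 h2 h3 h4) h h.2.1 kN h1 h2 h3 hg hid

theorem NF_trans_of_succDecomp (hs : s.IsSemiGoodExceptLocalCharacter κ)
    (hQ : s.AdmissibleClass κ (s.K3uq κ)) {A₀ A₁ C₀ C₁ D₀ D₁ : Model L}
    (h : s.SuccDecomp κ A₀ C₀) (h1 : s.NF κ A₀ C₀ A₁ C₁) (h2 : s.NF κ C₀ D₀ C₁ D₁) :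
    s.NF κ A₀ D₀ A₁ D₁ := by
  have hA := hs.aec
  obtain ⟨⟨-, kC₀, kA₁, kC₁⟩, hA₀C₀, hC₀C₁, hA₀A₁, hA₁C₁, -⟩ := id h1
  obtain ⟨⟨-, kD₀, -, kD₁⟩, hC₀D₀, hD₀D₁, -, hC₁D₁, -⟩ := id h2
  obtain ⟨α, A, d, hdec, rfl, rfl⟩ := h
  obtain ⟨B, hB, rfl, -⟩ := hs.exists_lift hQ.reduced hdec kA₁ hA₀A₁ (hs.NF_disjoint hQ h1) ∅
    small_empty
  have kB := hB.2.1 _ le_rfl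
  have hAB := hB.2.2.1 _ le_rfl
  have hNF := hs.NF_of_lift hQ hdec hB kC₀ kA₁ kB hA₀C₀ hA₀A₁ hAB (hB.1.le zero_le le_rfl)
    (hA.refl_right hA₀C₀) (hA.refl_right hA₀A₁) (hA.refl_right hAB) (hA.refl_right hAB)
  obtain ⟨P, g, p1, p2, p3, p4⟩ := hs.NF_unique hQ h1 hNF
  obtain ⟨k, hk, k1, kQ, hC₁Q, k3, k4⟩ := hs.exists_fresh_copy p1 p2 D₁.carrier D₁.small
  set Q := Model.map k P with hQdef
  have hkg := hA.emb_comp p3 k3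
  obtain ⟨G, hG, hGinj, -⟩ := exists_fresh_injective hkg.injOn ∅ small_empty
  have hGC : ∀ x ∈ (A (Order.succ α)).carrier, G x = x := fun x hx => by
    rw [hG (hA.subset hAB hx), Function.comp, p4 x (Or.inl hx), k1 x (hA.subset hC₀C₁ hx)]
  have hGA : ∀ x ∈ (B 0).carrier, G x = x := fun x hx => by
    rw [hG (hA.subset (hB.1.le zero_le le_rfl) hx), Function.comp, p4 x (Or.inr hx),
      k1 x (hA.subset hA₁C₁ hx)]
  have hB' := hs.lift_map hB hGinj
  have hB' : s.Lift κ A d (Order.succ α) (fun i => Model.map G (B i)) := by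
    have e1 : ∀ i ≤ Order.succ α, Model.map G (A i) = A i := fun i hi =>
      Model.map_of_eqOn_id fun x hx => hGC x (hA.subset (hdec.2.1.le hi le_rfl) hx)
    refine ⟨hB'.1, hB'.2.1, fun i hi => ?_, fun i hi => ?_⟩
    · have := hB'.2.2.1 i hi
      simp only [e1 i hi] at this
      exact this
    · have := hB'.2.2.2 i hi
      have e2 := hGC _ (hA.subset (hdec.2.1.le (Order.succ_le_of_lt hi) le_rfl)
        (hdec.2.2.2 i hi).1.2.2.2.1)
      simp only [e1 i hi.le, e2] at this
      exact this
  have htop : s.le (Model.map G (B (Order.succ α))) Q := by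
    rw [Model.map_congr hGinj.injOn hG]
    exact hkg.le
  have hst := hs.nfStar_of_lift hdec (hs.lift_enlarge hB' kQ htop)
  have hne : (0 : Ordinal.{u}) ≠ Order.succ α := (Order.succ_ne_bot α).symm
  rw [Function.update_of_ne hne, Function.update_self, Model.map_of_eqOn_id hGA] at hst
  obtain ⟨β, E, F, e, hdecE, hF, hE0, hD₀E, hF0, -⟩ := hs.exists_lift_over hQ kC₀ kD₀ kQ hC₀D₀
    (hA.trans hC₀C₁ hC₁Q) (fun x hx hxQ =>
      hs.NF_disjoint hQ h2 x hx (k4 x hxQ (hA.subset hD₀D₁ hx))) ∅ small_empty ∅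
  have hst' := hs.nfStar_of_lift hdecE hF
  rw [hE0, hF0] at hst'
  obtain ⟨γ, H, K, c, hdecH, hK, hH0, hHγ, hK0, hKγ⟩ :=
    exists_lift_of_nfStar (hs.nfStar_trans hst hst')
  have hEF := hF.2.2.1 β le_rfl
  have hQF : s.le Q (F β) := hF0 ▸ hF.1.le zero_le le_rfl
  have hNF' := hs.NF_of_lift hQ hdecE hF kD₀ kC₁ (hF.2.1 β le_rfl) (by rwa [hE0])
    (by rwa [hE0]) (hA.trans hD₀E hEF) (hA.trans hC₁Q hQF) hD₀E (by rwa [hF0])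
    (hA.refl_right hEF) (hA.refl_right hEF)
  rw [hE0] at hNF'
  obtain ⟨S, g', s1, s2, s3, s4⟩ := hs.NF_unique hQ hNF' h2
  have := hs.NF_transfer hQ hdecH hK kD₀ kA₁ kD₁ (by rw [hH0]; exact hA.trans hA₀C₀ hC₀D₀)
    (by rwa [hH0]) hD₀D₁ (hA.trans hA₁C₁ hC₁D₁) (by rwa [hHγ])
    (by rw [hK0]; exact hA.refl_right hA₀A₁) s3
    (fun x hx => s4 x (hx.imp id fun h => hA.subset hA₁C₁ h)) (by rwa [hKγ])
  rwa [hH0] at this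

theorem NF_trans (hs : s.IsSemiGoodExceptLocalCharacter κ)
    (hQ : s.AdmissibleClass κ (s.K3uq κ)) {A₀ A₁ C₀ C₁ D₀ D₁ : Model L}
    (h1 : s.NF κ A₀ C₀ A₁ C₁) (h2 : s.NF κ C₀ D₀ C₁ D₁) : s.NF κ A₀ D₀ A₁ D₁ := by
  have hA := hs.aec
  obtain ⟨⟨kA₀, kC₀, kA₁, kC₁⟩, hA₀C₀, hC₀C₁, hA₀A₁, hA₁C₁, -⟩ := id h1
  obtain ⟨⟨-, kD₀, -, kD₁⟩, hC₀D₀, hD₀D₁, -, hC₁D₁, -⟩ := id h2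
  have mono : ∀ {M₀ M₁ M₂ M₃ N₁ : Model L}, s.NF κ M₀ M₁ M₂ M₃ → s.KCard κ N₁ → s.le N₁ M₁ →
      s.le M₀ N₁ → s.NF κ M₀ N₁ M₂ M₃ := fun h k h1 h01 =>
    have hr := hA.refl_right h.2.2.1
    hs.NF_mono hQ h k h.1.2.2.1 h.1.2.2.2 h1 (hA.refl_right h.2.2.2.1) h01 (hA.trans h1 h.2.2.1)
      h.2.2.2.1 h.2.2.2.2.1 hr hr
  obtain ⟨W, kW, hC₀W, hAW, hCW⟩ := hs.exists_common_succDecomp hQ kA₀ kC₀ hA₀C₀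
  obtain ⟨k, hk, k1, kW', hC₀W', -, k2⟩ := hs.exists_fresh_copy kW hC₀W C₁.carrier C₁.small
  have hAW' := hs.succDecomp_map hQ hAW hk fun x hx => k1 x (hA.subset hA₀C₀ hx)
  have hCW' := hs.succDecomp_map hQ hCW hk k1
  obtain ⟨X, hX, -⟩ := hs.exists_NF hQ kA₀ kW' kA₁ (hA.trans hA₀C₀ hC₀W') hA₀A₁ (fun x hx hxA =>
    hs.NF_disjoint hQ h1 x (k2 x hx (hA.subset hA₁C₁ hxA)) hxA) ∅ small_empty
  obtain ⟨P, g, p1, p2, p3, p4⟩ := hs.NF_unique hQ h1 (mono hX kC₀ hC₀W' hA₀C₀)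
  obtain ⟨l, hl, l1, kQ, hC₁Q, l2, l3⟩ := hs.exists_fresh_copy p1 p2 D₁.carrier D₁.small
  set Q := Model.map l P with hQdef
  have hlg := hA.emb_comp p3 l2
  obtain ⟨G, hG, hGinj, -⟩ := exists_fresh_injective hlg.injOn ∅ small_empty
  obtain ⟨⟨-, -, -, kX⟩, -, hW'X, -, hA₁X, -⟩ := id hX
  have hGC : ∀ x ∈ C₀.carrier, G x = x := fun x hx => by
    rw [hG (hA.subset (hA.trans hC₀W' hW'X) hx), Function.comp, p4 x (Or.inl hx),
      l1 x (hA.subset hC₀C₁ hx)]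
  have hGA : ∀ x ∈ A₁.carrier, G x = x := fun x hx => by
    rw [hG (hA.subset hA₁X hx), Function.comp, p4 x (Or.inr hx), l1 x (hA.subset hA₁C₁ hx)]
  have hGA₀ : ∀ x ∈ A₀.carrier, G x = x := fun x hx => hGC x (hA.subset hA₀C₀ hx)
  have hAV := hs.succDecomp_map hQ hAW' hGinj hGA₀
  have hCV := hs.succDecomp_map hQ hCW' hGinj hGC
  have hC₀V := hA.le_map_of_id hC₀W' (hGinj.injOn (s := (Model.map k W).carrier)) hGC
  have kV := hA.map_kcard kW' (hGinj.injOn (s := (Model.map k W).carrier))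
  set V := Model.map G (Model.map k W) with hV
  have hXQ : s.le (Model.map G X) Q := by
    rw [Model.map_congr hGinj.injOn hG]
    exact hlg.le
  have hVQ : s.le V Q := hA.trans (hA.map_le hW'X hGinj.injOn) hXQ
  have hNF : s.NF κ A₀ V A₁ Q := by
    have := hs.NF_isoClosed hQ G _ _ _ _ _ _ _ _ hX (Model.isIso_map hGinj.injOn)
      (Model.isIso_of_eqOn_id hGA₀) (Model.isIso_map hGinj.injOn) (Model.isIso_of_eqOn_id hGA)
    exact hs.NF_mono hQ this kV kA₁ kQ (hA.refl_right hC₀V) (hA.refl_right hA₀A₁)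
      (hA.trans hA₀C₀ hC₀V) hVQ hA₀A₁ (hA.trans hA₁C₁ hC₁Q) hXQ (hA.refl_right hVQ)
  have hdisj : ∀ x ∈ D₀.carrier, x ∈ Q.carrier → x ∈ C₀.carrier := fun x hx hxQ =>
    hs.NF_disjoint hQ h2 x hx (l3 x hxQ (hA.subset hD₀D₁ hx))
  obtain ⟨D', hD', hfresh⟩ := hs.exists_NF hQ kC₀ kD₀ kV hC₀D₀ hC₀V
    (fun x hx hxV => hdisj x hx (hA.subset hVQ hxV)) Q.carrier Q.small
  obtain ⟨⟨-, -, -, kD'⟩, -, hD₀D', -, hVD', -⟩ := id hD'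
  obtain ⟨Y, hY, -⟩ := hs.exists_NF hQ kV kD' kQ hVD' hVQ (fun x hx hxQ =>
    (hfresh x hx hxQ).elim (fun h => hA.subset hC₀V (hdisj x h hxQ)) id) ∅ small_empty
  have t1 := mono (hs.NF_trans_of_succDecomp hQ hAV hNF hY) kD₀ hD₀D' (hA.trans hA₀C₀ hC₀D₀)
  have t2 := hs.NF_symm hQ (mono (hs.NF_trans_of_succDecomp hQ hCV (hs.NF_symm hQ hD')
    (hs.NF_symm hQ hY)) kC₁ hC₁Q hC₀C₁)
  obtain ⟨S, f, s1, s2, s3, s4⟩ := hs.NF_unique hQ t2 h2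
  exact hs.NF_transfer_emb hQ t1 kD₁ hD₀D₁ (hA.trans hA₁C₁ hC₁D₁) s2 s3 fun x hx =>
    s4 x (hx.imp id fun h => hA.subset hA₁C₁ h)

theorem le_of_NF_steps (hs : s.IsSemiGoodExceptLocalCharacter κ) {A B : Ordinal.{u} → Model L}
    {α : Ordinal.{u}} (hA : s.IncCont A (Iic α)) (hB : s.IncCont B (Iic α))
    (h0 : s.le (A 0) (B 0))
    (h : ∀ i < α, s.NF κ (A i) (A (Order.succ i)) (B i) (B (Order.succ i))) :
    s.le (A α) (B α) := by
  rcases Ordinal.zero_or_succ_or_isSuccLimit α with rfl | ⟨i, rfl⟩ | hl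
  · exact h0
  · exact (h i (Order.lt_succ i)).2.2.1
  · exact hs.aec.le_of_forall_le hl hA fun i hi =>
      hs.aec.trans (h i hi).2.2.2.1 (hB.le hi.le le_rfl)

/-- Sequences of `NF`-amalgams can be reindexed so that their length is less than `κ⁺`. -/
theorem exists_reindex (hs : s.IsSemiGoodExceptLocalCharacter κ)
    (hQ : s.AdmissibleClass κ (s.K3uq κ)) {A B : Ordinal.{u} → Model L} {α : Ordinal.{u}}
    (kB : s.KCard κ (B α)) (hA : s.IncCont A (Iic α)) (hB : s.IncCont B (Iic α))
    (h : ∀ i < α, s.NF κ (A i) (A (Order.succ i)) (B i) (B (Order.succ i))) :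
    ∃ β < (Order.succ κ).ord, ∃ A' B' : Ordinal.{u} → Model L,
      s.IncCont A' (Iic β) ∧ s.IncCont B' (Iic β) ∧
      (∀ i < β, s.NF κ (A' i) (A' (Order.succ i)) (B' i) (B' (Order.succ i))) ∧
      A' 0 = A 0 ∧ B' 0 = B 0 ∧ A' β = A α ∧ B' β = B α := by
  have hC := hs.aec
  let r : Set ZFSet.{u} × Set ZFSet.{u} → Set ZFSet.{u} × Set ZFSet.{u} → Prop := fun x y =>
    ∃ i < α, x = ((A i).carrier, (B i).carrier) ∧
      y = ((A (Order.succ i)).carrier, (B (Order.succ i)).carrier) ∧ ¬ y.2 ⊆ x.2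
  have hex : ∃ 𝒞, Climb r ((A 0).carrier, (B 0).carrier) ((A α).carrier, (B α).carrier) 𝒞 := by
    refine Climb.concat (y := fun i => ((A i).carrier, (B i).carrier)) (fun i j hij hj =>
      ⟨hC.subset (hA.le hij hj), hC.subset (hB.le hij hj)⟩) (fun δ hδ hl z hz => ?_)
      fun i hi => ?_
    · constructor
      · intro x hx
        obtain ⟨i, hi, hx⟩ := (hA.2 δ hδ hl).mem_iff.1 hx
        exact (hz i hi).1 hx
      · intro x hx
        obtain ⟨i, hi, hx⟩ := (hB.2 δ hδ hl).mem_iff.1 hx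
        exact (hz i hi).2 hx
    · have hi' := Order.succ_le_of_lt hi
      have hAi := hA.le (Order.le_succ i) hi'
      have hBi := hB.le (Order.le_succ i) hi'
      by_cases hsub : (B (Order.succ i)).carrier ⊆ (B i).carrier
      · have e2 := hC.eq_of_subset hBi hsub
        have e1 := hC.eq_of_subset hAi fun x hx => hs.NF_disjoint hQ (h i hi) x hx
          (hsub (hC.subset (h i hi).2.2.1 hx))
        simp only [← e1, ← e2]
        exact ⟨_, Climb.refl _⟩
      · exact ⟨_, Climb.single (lt_of_le_not_ge ⟨hC.subset hAi, hC.subset hBi⟩ fun h => hsub h.2)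
          ⟨i, hi, rfl, rfl, hsub⟩⟩
  obtain ⟨𝒞, h𝒞⟩ := hex
  obtain ⟨β, hβ, x, x0, xβ, hstep, hmono, hlim⟩ := h𝒞.exists_sequence (κ := κ) Prod.snd
    (fun x y hxy => hxy.2) (fun x y ⟨_, _, _, _, h⟩ => h) kB.2.le
  have hpt : ∀ i ≤ β, ∃ j ≤ α, x i = ((A j).carrier, (B j).carrier) := by
    intro i hi
    rcases hi.eq_or_lt with rfl | hi
    · exact ⟨α, le_rfl, xβ⟩
    · obtain ⟨j, hj, h1, -⟩ := hstep i hi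
      exact ⟨j, hj.le, h1⟩
  choose! j hj hx using hpt
  have heq : ∀ i ≤ β, ∀ k ≤ α, x i = ((A k).carrier, (B k).carrier) →
      A (j i) = A k ∧ B (j i) = B k := fun i hi k hk h =>
    ⟨hC.eq_of_carrier_eq (hA.le (hj i hi) le_rfl) (hA.le hk le_rfl)
      (congrArg Prod.fst ((hx i hi).symm.trans h)),
    hC.eq_of_carrier_eq (hB.le (hj i hi) le_rfl) (hB.le hk le_rfl)
      (congrArg Prod.snd ((hx i hi).symm.trans h))⟩
  have hle : ∀ i k, i ≤ k → k ≤ β → (A (j i)).carrier ⊆ (A (j k)).carrier ∧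
      (B (j i)).carrier ⊆ (B (j k)).carrier := fun i k hik hk => by
    have := hmono hik
    rw [hx i (hik.trans hk), hx k hk] at this
    exact this
  have hlim' : ∀ δ ≤ β, Order.IsSuccLimit δ → x δ ≤
      (⋃ i ∈ Iio δ, (A (j i)).carrier, ⋃ i ∈ Iio δ, (B (j i)).carrier) := by
    intro δ hδβ hδ
    rw [hlim δ hδ]
    refine sSup_le ?_
    rintro _ ⟨i, hi, rfl⟩
    rw [hx i ((le_of_lt hi).trans hδβ)]
    exact ⟨subset_biUnion_of_mem (u := fun i => (A (j i)).carrier) hi,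
      subset_biUnion_of_mem (u := fun i => (B (j i)).carrier) hi⟩
  refine ⟨β, hβ, fun i => A (j i), fun i => B (j i),
    hC.incCont_of_subset (fun i hi => hA.le (hj i hi) le_rfl) (fun i k hik hk => (hle i k hik hk).1)
      (fun δ hδ hl z hz => ?_),
    hC.incCont_of_subset (fun i hi => hB.le (hj i hi) le_rfl) (fun i k hik hk => (hle i k hik hk).2)
      (fun δ hδ hl z hz => ?_), fun i hi => ?_, (heq 0 zero_le 0 zero_le x0).1,
      (heq 0 zero_le 0 zero_le x0).2, (heq β le_rfl α le_rfl xβ).1, (heq β le_rfl α le_rfl xβ).2⟩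
  · have := hlim' δ hδ hl
    rw [hx δ hδ] at this
    obtain ⟨i, hi, hz⟩ := mem_iUnion₂.1 (this.1 hz)
    exact ⟨i, hi, hz⟩
  · have := hlim' δ hδ hl
    rw [hx δ hδ] at this
    obtain ⟨i, hi, hz⟩ := mem_iUnion₂.1 (this.2 hz)
    exact ⟨i, hi, hz⟩
  · obtain ⟨k, hk, h1, h2, -⟩ := hstep i hi
    obtain ⟨e1, e2⟩ := heq i hi.le k hk.le h1
    obtain ⟨e3, e4⟩ := heq _ (Order.succ_le_of_lt hi) _ (Order.succ_le_of_lt hk) h2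
    simp only [e1, e2, e3, e4]
    exact h k hk

/-- The successor step in the proof of long transitivity. -/
theorem exists_long_step (hs : s.IsSemiGoodExceptLocalCharacter κ)
    (hQ : s.AdmissibleClass κ (s.K3uq κ)) {A A' B B' C D : Model L} (h : s.NF κ A A' B B')
    (kC : s.KCard κ C) (kD : s.KCard κ D) (hCD : s.le C D) (hAC : s.le A C) (hBD : s.le B D)
    {Y : Set ZFSet.{u}} (hY : Small.{u} Y) (hB'Y : B'.carrier ⊆ Y)
    (hdisj : ∀ x ∈ D.carrier, x ∈ Y → x ∈ B.carrier) :
    ∃ C' D', s.NFStar κ C C' D D' ∧ s.le A' C' ∧ s.le B' D' ∧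
      ∀ x ∈ D'.carrier, x ∈ Y → x ∈ B'.carrier := by
  have hA := hs.aec
  obtain ⟨⟨kA, kA', kB, kB'⟩, hAA', hA'B', hAB, hBB', -⟩ := id h
  obtain ⟨U, hU, hUY⟩ := hs.exists_NF hQ kB kB' kD hBB' hBD
    (fun x hx hxD => hdisj x hxD (hB'Y hx)) Y hY
  have hUB' : ∀ x ∈ U.carrier, x ∈ Y → x ∈ B'.carrier := fun x hx hxY =>
    (hUY x hx hxY).elim id fun hD => hA.subset hBB' (hdisj x hD hxY)
  have hADU : s.NF κ A D A' U := hs.NF_trans hQ (hs.NF_symm hQ h) (hs.NF_symm hQ hU)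
  have hA'D : ∀ x ∈ A'.carrier, x ∈ D.carrier → x ∈ A.carrier := fun x hx hxD =>
    hs.NF_disjoint hQ h x hx (hdisj x hxD (hB'Y (hA.subset hA'B' hx)))
  obtain ⟨V, hV, hVD⟩ := hs.exists_NF hQ kA kC kA' hAC hAA'
    (fun x hx hx' => hA'D x hx' (hA.subset hCD hx)) D.carrier D.small
  have hVD : ∀ x ∈ V.carrier, x ∈ D.carrier → x ∈ C.carrier := fun x hx hxD =>
    (hVD x hx hxD).elim id fun hx' => hA.subset hAC (hA'D x hx' hxD)
  obtain ⟨⟨-, -, -, kV⟩, -, hCV, -, hA'V, -⟩ := id hV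
  obtain ⟨W₀, kW₀, hVW₀, hW₀⟩ := hs.exists_succDecomp hQ kC kV hCV
  obtain ⟨l, hl, l1, -, l2, -, l3⟩ := hs.exists_fresh_copy kW₀ hVW₀ D.carrier D.small
  obtain ⟨γ, E, e, hdec, rfl, hW⟩ := hs.succDecomp_map hQ hW₀ hl fun x hx =>
    l1 x (hA.subset hCV hx)
  rw [← hW] at l2 l3
  obtain ⟨F, hF, rfl, -⟩ := hs.exists_lift hQ.reduced hdec kD hCD
    (fun x hx hxD => hVD x (l3 x hx hxD) hxD) ∅ small_empty
  have hEF := hF.2.2.1 _ le_rfl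
  have hF0 := hF.1.le zero_le le_rfl
  have hCDV := hs.NF_of_lift hQ hdec hF kV kD (hF.2.1 _ le_rfl) hCV hCD (hA.trans l2 hEF) hF0 l2
    (hA.refl_right hCD) (hA.refl_right hEF) (hA.refl_right hEF)
  obtain ⟨P, g, p1, p2, p3, p4⟩ := hs.NF_unique hQ
    (hs.NF_trans hQ hV (hs.NF_symm hQ hCDV)) hADU
  obtain ⟨⟨-, -, -, kU⟩, -, hDU, -, hA'U, -⟩ := id hADU
  obtain ⟨k, hk, k1, k2, k3⟩ := hA.exists_rename p3 Y hY
  have hkid : ∀ x ∈ (F 0).carrier ∪ A'.carrier, k x = x := fun x hx => by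
    have := k1 x (hx.elim (fun h => hA.subset hDU h) fun h => hA.subset hA'U h)
    rwa [p4 x hx] at this
  have hst := hs.nfStar_of_lift (hs.decomp_map hQ hdec hk)
    (hs.lift_map (hs.lift_enlarge hF p1 p2) hk)
  have hne : (0 : Ordinal.{u}) ≠ Order.succ γ := (Order.succ_ne_bot γ).symm
  rw [Function.update_of_ne hne, Function.update_self,
    Model.map_of_eqOn_id fun x hx => hkid x (Or.inl hx),
    Model.map_of_eqOn_id fun x hx => hkid x (Or.inl (hA.subset hCD hx))] at hst
  refine ⟨_, _, hst, ?_, hA.trans hU.2.2.1 k2, fun x hx hxY => hUB' x (k3 x hx hxY) hxY⟩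
  exact hA.le_map_of_id (hA.trans hA'V l2) hk.injOn fun x hx => hkid x (Or.inr hx)

theorem NF_long_trans (hs : s.IsSemiGoodExceptLocalCharacter κ)
    (hQ : s.AdmissibleClass κ (s.K3uq κ)) {A B : Ordinal.{u} → Model L} {α : Ordinal.{u}}
    (kA : ∀ i ≤ α, s.KCard κ (A i)) (kB : ∀ i ≤ α, s.KCard κ (B i))
    (incA : s.IncCont A (Iic α)) (incB : s.IncCont B (Iic α)) (h0 : s.le (A 0) (B 0))
    (h : ∀ i < α, s.NF κ (A i) (A (Order.succ i)) (B i) (B (Order.succ i))) :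
    s.NF κ (A 0) (A α) (B 0) (B α) := by
  have hA := hs.aec
  have kA0 := kA 0 zero_le
  have kB0 := kB 0 zero_le
  have kAα := kA α le_rfl
  have kBα := kB α le_rfl
  obtain ⟨β, hβ, A', B', incA', incB', h', e1, e2, e3, e4⟩ := hs.exists_reindex hQ kBα incA incB h
  rw [← e1, ← e2] at h0
  rw [← e1] at kA0
  rw [← e2] at kB0
  rw [← e3] at kAα
  rw [← e4] at kBα
  rw [← e1, ← e2, ← e3, ← e4]
  obtain ⟨P, -, hP0, -, hinc, hJ, hΦ, -⟩ := hA.exists_chain (μ := Bool) (ι := Empty)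
    (Order.succ β) (fun k _ => k.elim) (fun k => k.elim)
    (fun i P _ => (∀ b, s.KCard κ (P b)) ∧ s.le (P false) (P true) ∧ s.le (A' i) (P false) ∧
      s.le (B' i) (P true) ∧ ∀ x ∈ (P true).carrier, x ∈ (B' β).carrier → x ∈ (B' i).carrier)
    (fun _ P _ P' _ => s.NFStar κ (P false) (P' false) (P true) (P' true))
    (fun b => bif b then B' 0 else A' 0) (fun k => k.elim)
    (by rintro (_ | _); exacts [kA0.1, kB0.1])
    ⟨by rintro (_ | _); exacts [kA0, kB0], h0, hA.refl_left h0, hA.refl_right h0,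
      fun _ hx _ => hx⟩ (by
      rintro i P f hi ⟨j1, j2, j3, j4, j5⟩
      have hi : i < β := Order.succ_lt_succ_iff.1 hi
      obtain ⟨C, D, c1, c2, c3, c4⟩ := hs.exists_long_step hQ (h' i hi) (j1 false) (j1 true) j2 j3
        j4 (B' β).small (hA.subset (incB'.le (Order.succ_le_of_lt hi) le_rfl)) j5
      obtain ⟨-, kC, -, kD, hC, hCD, -, hD, -⟩ := id c1
      refine ⟨fun b => bif b then D else C, f, ?_, fun k => k.elim, c1, ?_, hCD, c2, c3, c4⟩
      · rintro (_ | _)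
        exacts [hC, hD]
      · rintro (_ | _)
        exacts [kC, kD]) (by
      intro δ P f hδ hδβ hP0 hJ hΦ _ hinc
      have hδβ := Order.lt_succ_iff.1 hδβ
      have hle : ∀ b, ∀ i < δ, s.le (P i b) (P δ b) := fun b i hi => (hinc b).le hi.le le_rfl
      refine ⟨fun b => hA.kcard_union hs.infinite hδ (hδβ.trans_lt hβ) (hinc b) fun i hi =>
        (hJ i hi).1 b, hA.le_of_forall_le hδ (hinc false) fun i hi =>
          hA.trans (hJ i hi).2.1 (hle true i hi),
        hA.le_of_forall_le hδ (incA'.iic_mono hδβ) fun i hi =>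
          hA.trans (hJ i hi).2.2.1 (hle false i hi),
        hA.le_of_forall_le hδ (incB'.iic_mono hδβ) fun i hi =>
          hA.trans (hJ i hi).2.2.2.1 (hle true i hi), fun x hx hxB => ?_⟩
      obtain ⟨i, hi, hx⟩ := ((hinc true).2 δ self_mem_Iic hδ).mem_iff.1 hx
      exact hA.subset (incB'.le hi.le hδβ) ((hJ i hi).2.2.2.2 x hx hxB))
  have hJ := fun i (hi : i ≤ β) => hJ i (Order.lt_succ_iff.2 hi)
  obtain ⟨j1, j2, j3, j4, -⟩ := hJ β le_rfl
  have hst := hs.nfStar_concat (hinc false).of_succ (hinc true).of_succ (fun i hi => (hJ i hi).2.1)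
    (j1 false) (j1 true) fun i hi => hΦ i (Order.succ_lt_succ hi)
  have hPA : P 0 false = A' 0 := by rw [hP0]; rfl
  have hPB : P 0 true = B' 0 := by rw [hP0]; rfl
  obtain ⟨γ, E, F, e, hdec, hF, hE0, hE1, hF0, hF1⟩ := exists_lift_of_nfStar hst
  rw [hPA] at hE0
  rw [hPB] at hF0
  have := hs.NF_of_lift hQ hdec hF kAα kB0 kBα (by rw [hE0]; exact incA'.le zero_le le_rfl)
    (by rwa [hE0]) (hs.le_of_NF_steps incA' incB' h0 h') (incB'.le zero_le le_rfl)
    (by rwa [hE1]) (by rw [hF0]; exact hA.refl_right h0) j4 (by rw [hF1]; exact hA.refl_right j4)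
  rwa [hE0] at this

theorem NF_isNonforkingAmalgamation (hs : s.IsSemiGoodExceptLocalCharacter κ)
    (hQ : s.AdmissibleClass κ (s.K3uq κ)) : s.IsNonforkingAmalgamation κ (s.NF κ) where
  mem _ _ _ _ h := h.1
  disjointness _ _ _ _ h := by
    obtain ⟨-, h01, h13, h02, h23, -⟩ := id h
    exact ⟨h01, h13, h02, h23, Subset.antisymm (fun x hx => hs.NF_disjoint hQ h x hx.1 hx.2)
      fun x hx => ⟨hs.aec.subset h01 hx, hs.aec.subset h02 hx⟩⟩
  monotonicity := by
    rintro M₀ M₁ M₂ M₃ _ N₁ N₂ N₃ h - k1 k2 k3 rfl h1 h2 h01 h13 h02 h23 ⟨P, hM, hN⟩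
    exact hs.NF_mono hQ h k1 k2 k3 h1 h2 h01 h13 h02 h23 hM hN
  existence N₀ N₁ N₂ k0 k1 k2 h01 h02 hdisj := by
    obtain ⟨N₃, h, -⟩ := hs.exists_NF hQ k0 k1 k2 h01 h02
      (fun x hx1 hx2 => hdisj.subset ⟨hx1, hx2⟩) ∅ small_empty
    exact ⟨N₃, h⟩
  weak_uniqueness N₀ N₁ N₂ Na Nb h h' := by
    obtain ⟨P, g, kP, hP, hg, hid⟩ := hs.NF_unique hQ h h'
    exact ⟨id, g, P, kP, ⟨isEmb_of_le hP fun _ _ => rfl, fun _ _ => rfl⟩, hg, hid⟩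
  symmetry _ _ _ _ := ⟨hs.NF_symm hQ, hs.NF_symm hQ⟩
  long_transitivity _ _ _ hk hA hB h0 h :=
    hs.NF_long_trans hQ (fun i hi => (hk i hi).1) (fun i hi => (hk i hi).2) hA hB h0 h

variable {R : Model L → Model L → Model L → Model L → Prop}

theorem nonforkingAmalgamation_transfer (hs : s.IsSemiGoodExceptLocalCharacter κ)
    (hiso : IsoClosed R) (hR : s.IsNonforkingAmalgamation κ R) {M₀ M₁ M₂ M₃ N P : Model L}
    {g : ZFSet.{u} → ZFSet.{u}} (h : R M₀ M₁ M₂ M₃) (kN : s.KCard κ N)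
    (h1 : s.le M₁ N) (h2 : s.le M₂ N) (h3 : s.le M₃ P) (hg : s.IsEmb g N P)
    (hid : ∀ x ∈ M₁.carrier ∪ M₂.carrier, g x = x) : R M₀ M₁ M₂ N := by
  refine transfer hs.aec hiso (fun M₀ M₁ M₂ M₃ N₃ P h k h1 h2 h3 h4 => ?_) h
    (hR.disjointness _ _ _ _ h).1 kN h1 h2 h3 hg hid
  obtain ⟨k0, k1, k2, -⟩ := hR.mem _ _ _ _ h
  obtain ⟨h01, -, h02, -⟩ := hR.disjointness _ _ _ _ h
  exact hR.monotonicity _ _ _ _ _ _ _ _ h k0 k1 k2 k rfl (hs.aec.refl_right h01)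
    (hs.aec.refl_right h02) h01 h1 h02 h2 ⟨P, h3, h4⟩

/-- Steps of lifts of uniqueness triples satisfy every respectful amalgamation relation. -/
theorem nonforkingAmalgamation_of_k3uq (hs : s.IsSemiGoodExceptLocalCharacter κ)
    (hQ : s.AdmissibleClass κ (s.K3uq κ)) (hiso : IsoClosed R)
    (hR : s.IsNonforkingAmalgamation κ R) (hresp : s.Respects R) {X X' Y Y' : Model L}
    {d : ZFSet.{u}} (h : s.K3uq κ X X' d) (hnf : s.nf X Y d Y') (hX'Y' : s.le X' Y')
    (kY' : s.KCard κ Y') : R X X' Y Y' := by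
  have hA := hs.aec
  obtain ⟨kX, kX', hXX', -, -, hb⟩ := h.1
  obtain ⟨-, kY, -, hXY, hYY', -⟩ := hs.nf_sub _ _ _ _ hnf
  obtain ⟨N, hN⟩ := hR.existence X X' Y kX kX' kY hXX' hXY (Subset.antisymm
    (fun x hx => (hQ.reduced _ _ _ h).2 _ _ kY' hX'Y' hnf x hx.2 hx.1)
    fun x hx => ⟨hA.subset hXX' hx, hA.subset hXY hx⟩)
  obtain ⟨-, -, -, kN⟩ := hR.mem _ _ _ _ hN
  obtain ⟨-, hX'N, -⟩ := hR.disjointness _ _ _ _ hN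
  obtain ⟨P, g, -, p1, p2, p3, p4⟩ := hs.k3uq_amalg h kN kY' hX'N hX'Y' (hresp _ _ _ _ _ hN hb) hnf
  exact hs.nonforkingAmalgamation_transfer hiso hR hN kY' hX'Y' hYY' p1 p2 fun x hx =>
    hx.elim (p3 x) (p4 x)

theorem nonforkingAmalgamation_eq_NF (hs : s.IsSemiGoodExceptLocalCharacter κ)
    (hQ : s.AdmissibleClass κ (s.K3uq κ)) (hiso : IsoClosed R)
    (hR : s.IsNonforkingAmalgamation κ R) (hresp : s.Respects R) : R = s.NF κ := by
  have hA := hs.aec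
  have hsub : ∀ M₀ M₁ M₂ M₃, s.NF κ M₀ M₁ M₂ M₃ → R M₀ M₁ M₂ M₃ := by
    intro M₀ M₁ M₂ M₃ h
    obtain ⟨⟨k0, k1, k2, k3⟩, h01, h13, h02, h23, -⟩ := id h
    obtain ⟨α, A, B, d, hdec, hB, rfl, h1, h2, h3⟩ := exists_lift_of_NF h
    have hlong := hR.long_transitivity α A B (fun i hi => ⟨hdec.2.2.1 i hi, hB.2.1 i hi⟩) hdec.2.1
      hB.1 (hB.2.2.1 0 zero_le) fun i hi =>
        hs.nonforkingAmalgamation_of_k3uq hQ hiso hR hresp (hdec.2.2.2 i hi) (hB.2.2.2 i hi)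
          (hB.2.2.1 _ (Order.succ_le_of_lt hi)) (hB.2.1 _ (Order.succ_le_of_lt hi))
    exact hR.monotonicity _ _ _ _ _ _ _ _ hlong k0 k1 k2 k3 rfl h1 h2 h01 h13 h02 h23
      ⟨B α, hA.refl_right h3, h3⟩
  funext M₀ M₁ M₂ M₃
  refine propext ⟨fun h => ?_, hsub _ _ _ _⟩
  obtain ⟨k0, k1, k2, k3⟩ := hR.mem _ _ _ _ h
  obtain ⟨h01, h13, h02, h23, hdisj⟩ := hR.disjointness _ _ _ _ h
  obtain ⟨N, hN, -⟩ := hs.exists_NF hQ k0 k1 k2 h01 h02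
    (fun x hx1 hx2 => hdisj.subset ⟨hx1, hx2⟩) ∅ small_empty
  obtain ⟨f, g, P, kP, ⟨hf, hfid⟩, hg, hgid⟩ := hR.weak_uniqueness _ _ _ _ _ (hsub _ _ _ _ hN) h
  obtain ⟨k, hk, hk1, hk2, -⟩ := hA.exists_rename hf ∅ small_empty
  refine hs.NF_transfer_emb hQ hN k3 h13 h23 hk2
    (hA.emb_comp hg (hA.isEmb_map kP.1 (hk.injOn (s := P.carrier)))) fun x hx => ?_
  have := hk1 x (hx.elim (fun h => hA.subset hN.2.2.1 h) fun h => hA.subset hN.2.2.2.2.1 h)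
  rw [hfid x hx] at this
  rw [Function.comp, hgid x hx, this]

end IsSemiGoodExceptLocalCharacter

end FrameData

end

theorem theorem5p13 {L : FirstOrder.Language.{u, u}} (s : FrameData L) (κ : Cardinal.{u})
    (hs : s.IsSemiGoodExceptLocalCharacter κ) (hws : s.WeaklySuccessful κ)
    (hconj : s.HasConjugation κ) :
    (FrameData.IsoClosed (s.NF κ) ∧ s.IsNonforkingAmalgamation κ (s.NF κ) ∧
      s.Respects (s.NF κ)) ∧
    ∀ R : Model L → Model L → Model L → Model L → Prop,
      FrameData.IsoClosed R → s.IsNonforkingAmalgamation κ R → s.Respects R →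
        R = s.NF κ := by
  have hQ := hs.k3uq_admissible hconj hws
  exact ⟨⟨hs.NF_isoClosed hQ, hs.NF_isNonforkingAmalgamation hQ, hs.NF_respects hQ⟩,
    fun R hiso hR hresp => hs.nonforkingAmalgamation_eq_NF hQ hiso hR hresp⟩
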